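/- Let $\mathsf S>0$ and $\mathsf I\ge 0$. Consider the memoryless complex channel $\mathbf Y=\mathbf X+\sqrt{\mathsf I}\,e^{j\Theta}+\mathbf Z$, where $\mathbf X$, $\Theta$, $\mathbf Z$ are mutually independent, $\Theta$ is uniformly distributed on $[0,2\pi]$, and $\mathbf Z$ is a zero-mean, unit-variance, proper-complex Gaussian random variable (its real and imaginary parts are independent $\mathcal N(0,1/2)$). Let $$\mathsf C(\mathsf S,\mathsf I)=\sup_{F_{\mathbf X}:\ \mathbb E[|\mathbf X|^2]\le \mathsf S} I(\mathbf X;\mathbf Y),$$ where the supremum is over all probability distributions $F_{\mathbf X}$ on $\mathbb C$ with $\mathbb E[|\mathbf X|^2]\le\mathsf S$ and $I(\mathbf X;\mathbf Y)$ is the mutual information. Then the supremum is attained by exactly one distribution $F_{\mathbf X}$. Under it, the modulus and the phase of $\mathbf X$ are independent and the phase is uniform on $[0,2\pi]$; that is, $\mathbf X$ has the same law as $R\,e^{j\Phi}$, where $R$ has the law of $|\mathbf X|$ and $\Phi$ is uniform on $[0,2\pi]$ and independent of $R$. If moreover $\mathsf I>0$, then the law of $|\mathbf X|$ is discrete with countably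 infinitely many mass points, but only finitely many of them in any bounded interval. -/

import Mathlib

open MeasureTheory ProbabilityTheory
open scoped ENNReal NNReal

noncomputable section

namespace RadarChannel

/-- The uniform distribution on `[0, 2π]`. -/
def uniformPhase : Measure ℝ :=
  ProbabilityTheory.cond volume (Set.Icc 0 (2 * Real.pi))

/-- The law of a zero-mean, unit-variance, proper-complex Gaussian variable: its real and
imaginary parts are independent real centred Gaussians of variance `1/2`. -/
def complexGaussian : Measure ℂ :=
  ((gaussianReal 0 (1 / 2)).prod (gaussianReal 0 (1 / 2))).map
    (fun p : ℝ × ℝ => (p.1 : ℂ) + (p.2 : ℂ) * Complex.I)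

/-- The law of the total noise `W = √inr · exp(jΘ) + Z`, where `Θ` is uniform on `[0, 2π]` and
`Z`, independent of `Θ`, is a unit-variance proper-complex Gaussian. -/
def noiseLaw (inr : ℝ) : Measure ℂ :=
  (uniformPhase.prod complexGaussian).map
    (fun p : ℝ × ℂ => (Real.sqrt inr : ℂ) * Complex.exp ((p.1 : ℂ) * Complex.I) + p.2)

/-- The joint law of `(X, Y)` with `Y = X + W`, where `X` has law `μ` and is independent of the
noise `W`. -/
def jointLaw (inr : ℝ) (μ : Measure ℂ) : Measure (ℂ × ℂ) :=
  (μ.prod (noiseLaw inr)).map (fun p : ℂ × ℂ => (p.1, p.1 + p.2))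

/-- The mutual information (in nats) of a pair with joint law `γ`: the Kullback-Leibler
divergence of `γ` from the product of its marginals. -/
def mutualInfo (γ : Measure (ℂ × ℂ)) : ℝ≥0∞ :=
  InformationTheory.klDiv γ (γ.fst.prod γ.snd)

/-- The input distributions that satisfy the average power constraint `E|X|² ≤ snr`. -/
def admissible (snr : ℝ) : Set (Measure ℂ) :=
  {μ | IsProbabilityMeasure μ ∧ ∫⁻ x, ENNReal.ofReal (‖x‖ ^ 2) ∂μ ≤ ENNReal.ofReal snr}

/-- The capacity: the supremum of `I(X; Y)` over the admissible input distributions. -/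
def capacity (snr inr : ℝ) : ℝ≥0∞ :=
  ⨆ μ ∈ admissible snr, mutualInfo (jointLaw inr μ)

/-- `μ` is an admissible input distribution that attains the capacity. -/
def IsCapacityAchieving (snr inr : ℝ) (μ : Measure ℂ) : Prop :=
  μ ∈ admissible snr ∧ mutualInfo (jointLaw inr μ) = capacity snr inr

/-- The law of the modulus `|X|`, for `X` with law `μ`. -/
def modulusLaw (μ : Measure ℂ) : Measure ℝ :=
  μ.map (fun x : ℂ => ‖x‖)

/-- Modulus and phase are independent and the phase is uniform on `[0, 2π]`: `X` has the law of
`R · exp(jΘ)`, where `R` has the law of `|X|` and `Θ` is uniform on `[0, 2π]` and independent of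
`R`. (The number `0` has no phase of its own, so an atom of `X` at `0` is harmless here, whereas
it would spoil the independence of `|X|` and `Complex.arg X`, as `Complex.arg 0 = 0`.) -/
def HasIndepUniformPhase (μ : Measure ℂ) : Prop :=
  μ = ((modulusLaw μ).prod uniformPhase).map
    (fun p : ℝ × ℝ => (p.1 : ℂ) * Complex.exp ((p.2 : ℂ) * Complex.I))

/-- The mass points of a distribution on the line. -/
def massPoints (ρ : Measure ℝ) : Set ℝ :=
  {r | 0 < ρ {r}}

/-- `ρ` is discrete, with countably infinitely many mass points, of which only finitely many lie
in any bounded interval. -/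
def IsDiscreteInfiniteLocallyFinite (ρ : Measure ℝ) : Prop :=
  ρ (massPoints ρ)ᶜ = 0 ∧
  (massPoints ρ).Countable ∧ (massPoints ρ).Infinite ∧
  ∀ a b : ℝ, (massPoints ρ ∩ Set.Icc a b).Finite

end RadarChannel

end

/-! Write `W` for the total noise and `a = √inr`. Since `W` is independent of `X`, `I(X;Y) = h(Y) -
h(W)` (`mutualInfo_jointLaw`), so achieving the capacity means maximizing the output entropy
(`isCapacityAchieving_iff_isOptimal`). The power constraint makes the admissible laws tight and the
entropy is upper semicontinuous along them, so a maximizer exists (`exists_isMaxOn_outEntropy`).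
Entropy is strictly concave in the output density and convolution with the noise is injective
(`eq_of_conv_noise_eq`), so the maximizer is unique. The problem is rotation invariant, hence so is
its unique solution, which gives the independent uniform phase.

Discreteness comes from the Karush–Kuhn–Tucker conditions (`IsOptimal.exists_multiplier`): the loss
`E[-log p(x + W)]` lies below a quadratic `l|x|² + const` and equals it for almost every input. The
loss is analytic in the radius, so the contact radii are locally finite unless the loss is that
quadratic everywhere. In the latter case undoing the Gaussian smoothing shows that the means of
`-log p` over all circles of radius `a` are quadratic in the centre. By rotation invariance `p(y) =
Q(|y|²)` with `Q` entire of exponential type, and `exists_eq_exp_affine_of_circle_means` forces `Q`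
to be the exponential of an affine function. Then `Y` would be Gaussian, although its characteristic
function has the circle's characteristic function as a factor, and that has a zero
(`outDensity_ne_exp`).

The heart is the complex analysis behind that theorem. Differentiating the circle means says that
`Q'/Q`, integrated along the segment from `(r - a)²` to `(r + a)²`, is linear in `r`; this persists
for complex `r` as long as the segments miss the zeros of `Q`. If there were zeros, take one whose
square root is minimal for a norm whose balls have convex squares, and move `r` until an end of the
segment reaches it. A zero of multiplicity `m` at an end contributes a term of order `m (r -
r₀)^(-1/2)`; only the other end could compensate, and it cannot (`ne_zero_at_endpoints`).

There are infinitely many mass points because the support is unbounded (`IsOptimal.not_ae_bounded`):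
bounded support would force `l ≥ 1`, which with `h(Y) ≤ h(W) + snr` and the condition at `x = 0`
leaves only the point mass at `0`, itself not optimal. -/

noncomputable section

namespace RadarChannel

/-! ### Complex analysis: cosine integrals, entire functions, parametric integrals. -/

section

open Complex Metric Filter Topology

/-- `∫ dθ / (w + cos θ)` over a period, squared, for `w` off the segment `[-1, 1]`. -/
lemma sq_integral_inv_add_cos {w : ℂ} (hw : ∀ t : ℝ, |t| ≤ 1 → w ≠ t) :
    (∫ θ in (0 : ℝ)..2 * Real.pi, 1 / (w + Real.cos θ)) ^ 2 = 4 * Real.pi ^ 2 / (w ^ 2 - 1) := by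
  obtain ⟨d, hd⟩ := IsAlgClosed.exists_pow_nat_eq (w ^ 2 - 1) (n := 2) (by norm_num)
  -- The roots of `z² + 2wz + 1`. With `z = exp(iθ)` one has `2z(w + cos θ) = (z - ζ₁)(z - ζ₂)`, so
  -- Cauchy's formula at the root inside the unit disc evaluates the integral. Squaring the result
  -- spares the choice of a branch of `√(w² - 1)`.
  obtain ⟨ζ₁, ζ₂, hmul, hadd, hsq, hlt⟩ : ∃ ζ₁ ζ₂ : ℂ, ζ₁ * ζ₂ = 1 ∧ ζ₁ + ζ₂ = -2 * w ∧
      (ζ₁ - ζ₂) ^ 2 = 4 * (w ^ 2 - 1) ∧ ‖ζ₁‖ < 1 := by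
    have key : (-w + d) * (-w - d) = 1 := by linear_combination -hd
    have hn : ‖-w + d‖ * ‖-w - d‖ = 1 := by rw [← norm_mul, key, norm_one]
    rcases lt_trichotomy ‖-w + d‖ 1 with h | h | h
    · exact ⟨-w + d, -w - d, key, by ring, by linear_combination 4 * hd, h⟩
    -- Two roots on the unit circle would be conjugate, making `w` a real number in `[-1, 1]`.
    · exfalso
      have hc : (-w - d) = (starRingEnd ℂ) (-w + d) := by
        have h0 : (-w + d) ≠ 0 := by
          intro h0; rw [h0, norm_zero] at h; norm_num at h
        apply mul_left_cancel₀ h0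
        rw [key, Complex.mul_conj, Complex.normSq_eq_norm_sq, h]; norm_num
      have hre : w = ((-(-w + d).re : ℝ) : ℂ) := by
        have : (-w + d) + (starRingEnd ℂ) (-w + d) = ((2 * (-w + d).re : ℝ) : ℂ) :=
          Complex.add_conj _
        rw [← hc] at this
        push_cast at this ⊢
        linear_combination (-1 / 2) * this
      refine hw _ ?_ hre
      rw [abs_neg, ← h]
      exact Complex.abs_re_le_norm _
    · refine ⟨-w - d, -w + d, by rw [mul_comm]; exact key, by ring, by linear_combination 4 * hd, ?_⟩
      by_contra hcon
      push Not at hcon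
      nlinarith
  have h2 : 1 < ‖ζ₂‖ := by
    have : ‖ζ₁‖ * ‖ζ₂‖ = 1 := by rw [← norm_mul, hmul, norm_one]
    by_contra hcon
    push Not at hcon
    nlinarith [norm_nonneg ζ₁, norm_nonneg ζ₂]
  have hne : ∀ z : ℂ, ‖z‖ ≤ 1 → z - ζ₂ ≠ 0 := by
    intro z hz h
    rw [sub_eq_zero] at h
    rw [h] at hz; linarith
  have hcauchy := DifferentiableOn.circleIntegral_sub_inv_smul (R := 1) (c := 0) (w := ζ₁)
    (f := fun z => 2 / (z - ζ₂)) (by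
      intro z hz
      have hz' : ‖z‖ ≤ 1 := by simpa using hz
      have := hne z hz'
      fun_prop (disch := assumption)) (by simpa using hlt)
  have hval : (∫ θ in (0 : ℝ)..2 * Real.pi, 1 / (w + Real.cos θ)) = 4 * Real.pi / (ζ₁ - ζ₂) := by
    have e : (∮ z in C(0, 1), (z - ζ₁)⁻¹ • (2 / (z - ζ₂)))
        = ∫ θ in (0 : ℝ)..2 * Real.pi, I * (1 / (w + Real.cos θ)) := by
      rw [circleIntegral]
      apply intervalIntegral.integral_congr
      intro θ _
      simp only [deriv_circleMap, circleMap, zero_add, ofReal_one, one_mul, smul_eq_mul]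
      have hcos : (Real.cos θ : ℂ) = (exp (θ * I) + exp (-(θ * I))) / 2 := by
        rw [Complex.ofReal_cos, Complex.cos]; ring_nf
      have hexp : exp (θ * I) * exp (-(θ * I)) = 1 := by rw [← Complex.exp_add]; simp
      have hnorm : ‖exp (θ * I)‖ = 1 := Complex.norm_exp_ofReal_mul_I θ
      have h1 : exp (θ * I) - ζ₁ ≠ 0 := by
        intro h
        rw [sub_eq_zero] at h; rw [h] at hnorm; linarith
      have h2' : exp (θ * I) - ζ₂ ≠ 0 := hne _ hnorm.le
      have hE : exp (θ * I) ≠ 0 := Complex.exp_ne_zero _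
      have hprod : 2 * exp (θ * I) * (w + Real.cos θ) = (exp (θ * I) - ζ₁) * (exp (θ * I) - ζ₂) := by
        rw [hcos]; linear_combination hexp + exp (θ * I) * hadd - hmul
      have hne3 : w + Real.cos θ ≠ 0 := by
        intro h
        rw [h, mul_zero] at hprod
        exact mul_ne_zero h1 h2' hprod.symm
      field_simp
      linear_combination hprod
    rw [e, intervalIntegral.integral_const_mul] at hcauchy
    have : I * (∫ θ in (0 : ℝ)..2 * Real.pi, 1 / (w + Real.cos θ)) = I * (4 * Real.pi / (ζ₁ - ζ₂)) := by
      rw [hcauchy, smul_eq_mul]; ring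
    exact mul_left_cancel₀ I_ne_zero this
  have h3 : w ^ 2 - 1 ≠ 0 := by
    intro h
    have : (w - 1) * (w + 1) = 0 := by linear_combination h
    rcases mul_eq_zero.1 this with h | h
    · exact hw 1 (by simp) (by push_cast; linear_combination h)
    · exact hw (-1) (by simp) (by push_cast; linear_combination h)
  rw [hval, div_pow, hsq]
  field_simp

/-- An entire function that is not identically zero factors as a power of `s - s₀` times an entire
function that does not vanish at `s₀`. -/
lemma exists_eq_pow_mul_of_differentiable {Q : ℂ → ℂ} (hQ : Differentiable ℂ Q)
    (hne : ∃ z, Q z ≠ 0) (s₀ : ℂ) :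
    ∃ (m : ℕ) (Q₁ : ℂ → ℂ), Differentiable ℂ Q₁ ∧ Q₁ s₀ ≠ 0 ∧ ∀ s, Q s = (s - s₀) ^ m * Q₁ s := by
  obtain ⟨p, hp⟩ := hQ.analyticAt s₀
  have hp0 : p ≠ 0 := by
    intro h
    have hz := hp.locally_zero_iff.2 h
    obtain ⟨z, hz'⟩ := hne
    have han : AnalyticOnNhd ℂ Q Set.univ := fun z _ => hQ.analyticAt z
    exact hz' (han.eqOn_zero_of_preconnected_of_eventuallyEq_zero isPreconnected_univ
      (Set.mem_univ s₀) hz (Set.mem_univ z))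
  refine ⟨p.order, (Function.swap dslope s₀)^[p.order] Q, ?_, hp.iterate_dslope_fslope_ne_zero hp0,
    fun s => by simpa using hp.eq_pow_order_mul_iterate_dslope s⟩
  have : ∀ (n : ℕ) (f : ℂ → ℂ), Differentiable ℂ f → Differentiable ℂ ((Function.swap dslope s₀)^[n] f) := by
    intro n
    induction n with
    | zero => intro f hf; exact hf
    | succ n ih =>
      intro f hf
      rw [Function.iterate_succ_apply]
      apply ih
      rw [← differentiableOn_univ]
      exact (Complex.differentiableOn_dslope Filter.univ_mem).2 hf.differentiableOn
  exact this _ _ hQ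

/-- A zero-free entire function of exponential type is the exponential of an affine function. -/
lemma exists_eq_exp_affine {Q : ℂ → ℂ} (hQ : Differentiable ℂ Q) (hne : ∀ z, Q z ≠ 0) {C : ℝ}
    (hC : ∀ s, ‖Q s‖ ≤ C * Real.exp ‖s‖) :
    ∃ α β : ℂ, ∀ s, Q s = exp (α + β * s) := by
  have hCpos : 0 < C := by
    have h0 := hC 0
    have h1 := norm_pos_iff.2 (hne 0)
    simp at h0; linarith
  have hdd : Differentiable ℂ (deriv Q) := by
    rw [← differentiableOn_univ] at hQ ⊢
    exact hQ.deriv isOpen_univ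
  have hld : Differentiable ℂ (fun z => deriv Q z / Q z) := fun z =>
    (hdd z).div (hQ z) (hne z)
  obtain ⟨g, hg⟩ := hld.isExactOn_univ
  have hg : ∀ z, HasDerivAt g (deriv Q z / Q z) z := fun z => hg z (Set.mem_univ z)
  have hconst : ∀ z, Q z * exp (-g z) = Q 0 * exp (-g 0) := by
    have hd : ∀ z, HasDerivAt (fun z => Q z * exp (-g z)) 0 z := by
      intro z
      refine ((hQ z).hasDerivAt.mul ((hg z).neg.cexp)).congr_deriv ?_
      have := hne z
      field_simp
      ring
    intro z
    exact is_const_of_deriv_eq_zero (fun z => (hd z).differentiableAt) (fun z => (hd z).deriv) z 0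
  set k : ℂ := Complex.log (Q 0 * exp (-g 0)) with hk
  have hk' : exp k = Q 0 * exp (-g 0) := Complex.exp_log (mul_ne_zero (hne 0) (exp_ne_zero _))
  set l : ℂ → ℂ := fun z => k + g z with hl
  have hlQ : ∀ z, exp (l z) = Q z := by
    intro z
    rw [hl]; simp only
    rw [Complex.exp_add, hk', ← hconst z, mul_assoc, ← Complex.exp_add]; simp
  have hld : Differentiable ℂ l := fun z => ((hg z).const_add k).differentiableAt
  have hre : ∀ z, (l z).re ≤ Real.log C + ‖z‖ := by
    intro z
    have h1 : Real.exp (l z).re ≤ C * Real.exp ‖z‖ := by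
      rw [← Complex.norm_exp, hlQ]; exact hC z
    rw [← Real.exp_le_exp, Real.exp_add, Real.exp_log hCpos]; exact h1
  set A : ℝ := |Real.log C| + ‖l 0‖ + 1 with hA
  have hApos : 0 < A := by positivity
  -- Borel–Carathéodory on the disc of radius `2R` turns the linear upper bound on the real part
  -- into a linear bound on `l` itself.
  have hbound : ∀ R : ℝ, 1 ≤ R → ∀ z, ‖z‖ = R → ‖l z‖ ≤ (5 * A + 4) * R := by
    intro R hR z hz
    have h := Complex.borelCaratheodory (f := l) (M := A + 2 * R) (R := 2 * R) (z := z) (by positivity)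
      hld.differentiableOn (by
        intro w hw
        have hw' : ‖w‖ < 2 * R := by simpa using hw
        show (l w).re ≤ _
        have := hre w
        have := le_abs_self (Real.log C)
        have := norm_nonneg (l 0)
        linarith) (by positivity) (by simp [hz]; linarith)
    rw [hz] at h
    have e : 2 * R - R = R := by ring
    rw [e, mul_div_assoc, div_self (by positivity), mul_one, mul_div_assoc] at h
    have e2 : (2 * R + R) / R = 3 := by field_simp; norm_num
    rw [e2] at h
    have : ‖l 0‖ ≤ A := by
      have := abs_nonneg (Real.log C); linarith
    nlinarith
  -- Cauchy's estimate: linear growth divided by `R²` tends to zero.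
  have hdd2 : ∀ c, iteratedDeriv 2 l c = 0 := by
    intro c
    have hest : ∀ R : ℝ, 1 + ‖c‖ ≤ R → ‖iteratedDeriv 2 l c‖ ≤ 4 * (5 * A + 4) / R := by
      intro R hR
      have hRpos : 0 < R := by have := norm_nonneg c; linarith
      have hb : ∀ z ∈ sphere c R, ‖l z‖ ≤ (5 * A + 4) * (2 * R) := by
        intro z hz
        have hzc : ‖z - c‖ = R := by simpa [dist_eq_norm] using hz
        have h1 : ‖z‖ ≤ 2 * R := by
          have := norm_add_le (z - c) c
          rw [sub_add_cancel] at this; linarith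
        have h2 : 1 ≤ ‖z‖ := by
          have := norm_sub_le z c
          linarith
        calc ‖l z‖ ≤ (5 * A + 4) * ‖z‖ := hbound _ h2 z rfl
          _ ≤ _ := by gcongr
      have := Complex.norm_iteratedDeriv_le_of_forall_mem_sphere_norm_le 2 hRpos
        hld.diffContOnCl hb
      refine this.trans (le_of_eq ?_)
      simp [Nat.factorial]
      field_simp
      ring
    have hlim : Tendsto (fun R : ℝ => 4 * (5 * A + 4) / R) atTop (𝓝 0) :=
      tendsto_const_nhds.div_atTop tendsto_id
    have := ge_of_tendsto hlim (Filter.eventually_atTop.2 ⟨1 + ‖c‖, fun R hR => hest R hR⟩)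
    exact norm_le_zero_iff.1 this
  have hldd : Differentiable ℂ (deriv l) := by
    rw [← differentiableOn_univ] at hld ⊢
    exact hld.deriv isOpen_univ
  have hder : ∀ z, deriv l z = deriv l 0 := fun z =>
    is_const_of_deriv_eq_zero hldd (fun c => by
      have := hdd2 c
      rwa [iteratedDeriv_succ, iteratedDeriv_one] at this) z 0
  have haff : ∀ z, l z - deriv l 0 * z = l 0 := by
    intro z
    have hd : ∀ z, HasDerivAt (fun z => l z - deriv l 0 * z) 0 z := by
      intro z
      refine ((hld z).hasDerivAt.sub ((hasDerivAt_id z).const_mul (deriv l 0))).congr_deriv ?_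
      rw [hder z]; simp
    have := is_const_of_deriv_eq_zero (fun z => (hd z).differentiableAt) (fun z => (hd z).deriv) z 0
    simpa using this
  refine ⟨l 0, deriv l 0, fun s => ?_⟩
  rw [← hlQ s, ← haff s]; ring_nf

/-- Holomorphy of a parametric integral under a local domination hypothesis. -/
lemma differentiableAt_integral_of_dominated {α : Type*} [MeasurableSpace α] {ν : Measure α}
    {F : ℂ → α → ℂ} {z₀ : ℂ} {δ : ℝ} (hδ : 0 < δ) {g : α → ℝ} (hg : Integrable g ν)
    (hmeas : ∀ z ∈ ball z₀ δ, AEStronglyMeasurable (F z) ν)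
    (hdiff : ∀ᵐ x ∂ν, DifferentiableOn ℂ (fun z => F z x) (ball z₀ δ))
    (hbound : ∀ᵐ x ∂ν, ∀ z ∈ ball z₀ δ, ‖F z x‖ ≤ g x) :
    DifferentiableAt ℂ (fun z => ∫ x, F z x ∂ν) z₀ := by
  have hz₀ : z₀ ∈ ball z₀ δ := mem_ball_self hδ
  have hsub : ∀ z ∈ ball z₀ (δ / 4), closedBall z (δ / 4) ⊆ ball z₀ δ := by
    intro z hz
    apply closedBall_subset_ball'
    rw [mem_ball] at hz; linarith
  refine (hasDerivAt_integral_of_dominated_loc_of_deriv_le (F := F)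
    (F' := fun z x => deriv (fun z => F z x) z) (bound := fun x => g x / (δ / 4))
    (ball_mem_nhds z₀ (by positivity : 0 < δ / 4)) ?_ ?_ ?_ ?_ ?_ ?_).2.differentiableAt
  · filter_upwards [ball_mem_nhds z₀ hδ] with z hz using hmeas z hz
  · refine hg.mono' (hmeas z₀ hz₀) ?_
    filter_upwards [hbound] with x hx using hx z₀ hz₀
  -- Measurability of the derivative in `x`: it is an almost everywhere limit of difference
  -- quotients along a sequence.
  · set u : ℕ → ℂ := fun n => ((δ / 2 / (n + 1) : ℝ) : ℂ) with hu
    have hu0 : Tendsto u atTop (𝓝[≠] 0) := by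
      rw [tendsto_nhdsWithin_iff]
      constructor
      · have : Tendsto (fun n : ℕ => (δ / 2 / (n + 1) : ℝ)) atTop (𝓝 0) := by
          apply Filter.Tendsto.div_atTop tendsto_const_nhds
          exact tendsto_atTop_add_const_right _ _ tendsto_natCast_atTop_atTop
        have h := (Complex.continuous_ofReal.tendsto 0).comp this
        rw [Complex.ofReal_zero] at h
        exact h
      · refine .of_forall fun n => ?_
        simp only [hu, Set.mem_compl_iff, Set.mem_singleton_iff]
        have : (0:ℝ) < δ / 2 / (n + 1) := by positivity
        exact_mod_cast this.ne'
    have humem : ∀ n, z₀ + u n ∈ ball z₀ δ := by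
      intro n
      simp only [hu, mem_ball, dist_self_add_left, Complex.norm_real, Real.norm_eq_abs]
      rw [abs_of_pos (by positivity), div_lt_iff₀ (by positivity)]
      have : (0:ℝ) ≤ n := n.cast_nonneg
      nlinarith
    refine aestronglyMeasurable_of_tendsto_ae atTop
      (f := fun n x => (u n)⁻¹ • (F (z₀ + u n) x - F z₀ x)) (fun n => ?_) ?_
    · exact ((hmeas _ (humem n)).sub (hmeas _ hz₀)).const_smul (u n)⁻¹
    · filter_upwards [hdiff] with x hx
      have := (hx.differentiableAt (ball_mem_nhds z₀ hδ)).hasDerivAt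
      rw [hasDerivAt_iff_tendsto_slope_zero] at this
      exact this.comp hu0
  · filter_upwards [hdiff, hbound] with x hx hb z hz
    refine Complex.norm_deriv_le_of_forall_mem_sphere_norm_le (by positivity) ?_ ?_
    · apply DifferentiableOn.diffContOnCl
      exact hx.mono (closure_ball_subset_closedBall.trans (hsub z hz))
    · intro w hw
      exact hb w (hsub z hz (sphere_subset_closedBall hw))
  · exact hg.div_const _
  · filter_upwards [hdiff] with x hx z hz
    have : z ∈ ball z₀ δ := ball_subset_ball (by linarith) hz
    exact (hx.differentiableAt (isOpen_ball.mem_nhds this)).hasDerivAt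

/-- Holomorphy of an integral over a bounded interval of a jointly continuous family. -/
lemma differentiableAt_intervalIntegral_of_continuousOn {F : ℂ → ℝ → ℂ} {U : Set ℂ} (hU : IsOpen U)
    {a b : ℝ} (hcont : ContinuousOn (Function.uncurry F) (U ×ˢ Set.uIcc a b))
    (hdiff : ∀ x ∈ Set.uIcc a b, DifferentiableOn ℂ (fun z => F z x) U) {z₀ : ℂ} (hz₀ : z₀ ∈ U) :
    DifferentiableAt ℂ (fun z => ∫ x in a..b, F z x) z₀ := by
  obtain ⟨δ, hδ, hsub⟩ := Metric.isOpen_iff.1 hU z₀ hz₀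
  have hsub' : closedBall z₀ (δ / 2) ⊆ U := (closedBall_subset_ball (by linarith)).trans hsub
  have hK : IsCompact (closedBall z₀ (δ / 2) ×ˢ Set.uIcc a b) :=
    (isCompact_closedBall _ _).prod isCompact_uIcc
  obtain ⟨C, hC⟩ := hK.exists_bound_of_continuousOn
    (hcont.mono (Set.prod_mono hsub' subset_rfl))
  simp_rw [intervalIntegral.intervalIntegral_eq_integral_uIoc]
  refine DifferentiableAt.const_smul ?_ _
  have hmem : ∀ x ∈ Set.uIoc a b, x ∈ Set.uIcc a b := fun x hx => Set.uIoc_subset_uIcc hx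
  refine differentiableAt_integral_of_dominated (δ := δ / 2) (by positivity) (g := fun _ => C)
    ?_ ?_ ?_ ?_
  · exact integrableOn_const (by simp [Set.uIoc])
  · intro z hz
    have : ContinuousOn (F z) (Set.uIcc a b) := by
      refine hcont.comp (f := fun x : ℝ => (z, x)) (by fun_prop) ?_
      intro x hx
      exact ⟨hsub' (ball_subset_closedBall hz), hx⟩
    exact (this.mono Set.uIoc_subset_uIcc).aestronglyMeasurable measurableSet_uIoc
  · filter_upwards [ae_restrict_mem measurableSet_uIoc] with x hx
    exact (hdiff x (hmem x hx)).mono (ball_subset_closedBall.trans hsub')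
  · filter_upwards [ae_restrict_mem measurableSet_uIoc] with x hx z hz
    exact hC (z, x) ⟨ball_subset_closedBall hz, hmem x hx⟩

/-! ### Tilted norms, and the convexity of the squares of their balls. -/

/-- The norm `|Im z| + ε |Re z|`, whose balls are mapped to convex sets by squaring. -/
def tiltedNorm (ε : ℝ) (z : ℂ) : ℝ := |z.im| + ε * |z.re|

lemma tiltedNorm_smul (ε : ℝ) {t : ℝ} (ht : 0 ≤ t) (z : ℂ) :
    tiltedNorm ε (t * z) = t * tiltedNorm ε z := by
  simp [tiltedNorm, abs_mul, abs_of_nonneg ht]; ring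

lemma tiltedNorm_neg (ε : ℝ) (z : ℂ) : tiltedNorm ε (-z) = tiltedNorm ε z := by
  simp [tiltedNorm]

lemma tiltedNorm_add_le {ε : ℝ} (hε : 0 ≤ ε) (z w : ℂ) :
    tiltedNorm ε (z + w) ≤ tiltedNorm ε z + tiltedNorm ε w := by
  simp only [tiltedNorm, add_im, add_re]
  have h1 := abs_add_le z.im w.im
  have h2 := mul_le_mul_of_nonneg_left (abs_add_le z.re w.re) hε
  linarith

lemma continuous_tiltedNorm (ε : ℝ) : Continuous (tiltedNorm ε) := by
  unfold tiltedNorm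
  fun_prop

/-- Since `|x| + |y| = max |x + y| |x - y|`, a ball is the intersection of two strips of the form
`|Re (v z)| < M`, which can be handled one at a time. -/
lemma tiltedNorm_lt_iff {ε M : ℝ} (hε : 0 ≤ ε) (z : ℂ) :
    tiltedNorm ε z < M ↔ |((ε - I) * z).re| < M ∧ |((ε + I) * z).re| < M := by
  have h1 : ((ε - I) * z).re = ε * z.re + z.im := by simp
  have h2 : ((ε + I) * z).re = ε * z.re - z.im := by simp
  rw [h1, h2, tiltedNorm]
  have h3 : ε * |z.re| = |ε * z.re| := by rw [abs_mul, abs_of_nonneg hε]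
  rw [h3]
  generalize ε * z.re = x
  generalize z.im = y
  constructor
  · intro h
    exact ⟨(abs_add_le x y).trans_lt (by linarith), (abs_sub x y).trans_lt (by linarith)⟩
  · rintro ⟨h, h'⟩
    rw [abs_lt] at h h'
    rcases abs_cases x with ⟨hx, _⟩ | ⟨hx, _⟩ <;> rcases abs_cases y with ⟨hy, _⟩ | ⟨hy, _⟩ <;>
      rw [hx, hy] <;> linarith

lemma abs_re_mul_le_tiltedNorm {ε : ℝ} (hε : 0 ≤ ε) (z : ℂ) :
    |((ε - I) * z).re| ≤ tiltedNorm ε z ∧ |((ε + I) * z).re| ≤ tiltedNorm ε z := by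
  constructor
  · exact le_of_forall_gt fun M hM => ((tiltedNorm_lt_iff hε z).1 hM).1
  · exact le_of_forall_gt fun M hM => ((tiltedNorm_lt_iff hε z).1 hM).2

/-- This exhibits `(Re w)²` as a convex function of `w²`, a norm plus a linear form. Hence squaring
sends strips to convex sets, the insides of parabolas. -/
lemma two_mul_re_sq (w : ℂ) : 2 * w.re ^ 2 = ‖w ^ 2‖ + (w ^ 2).re := by
  rw [norm_pow, Complex.sq_norm, Complex.normSq_apply]
  simp [pow_two]; ring

/-- Squares of points with bounded real part form a convex set. -/
lemma re_sq_le_of_sq_eq {v z z₁ z₂ : ℂ} {t : ℝ} (h0 : 0 ≤ t) (h1 : t ≤ 1)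
    (hz : z ^ 2 = (1 - t) * z₁ ^ 2 + t * z₂ ^ 2) :
    (v * z).re ^ 2 ≤ (1 - t) * (v * z₁).re ^ 2 + t * (v * z₂).re ^ 2 := by
  have e : (v * z) ^ 2 = (1 - t) * (v * z₁) ^ 2 + t * (v * z₂) ^ 2 := by
    rw [mul_pow, hz]; ring
  have hre : ((v * z) ^ 2).re = (1 - t) * ((v * z₁) ^ 2).re + t * ((v * z₂) ^ 2).re := by
    rw [e, show (1 - (t:ℂ)) = ((1 - t : ℝ) : ℂ) by push_cast; ring, add_re, re_ofReal_mul, re_ofReal_mul]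
  have hn : ‖(v * z) ^ 2‖ ≤ (1 - t) * ‖(v * z₁) ^ 2‖ + t * ‖(v * z₂) ^ 2‖ := by
    rw [e]
    refine (norm_add_le _ _).trans (le_of_eq ?_)
    rw [show (1 - (t:ℂ)) = ((1 - t : ℝ) : ℂ) by push_cast; ring, norm_mul, norm_mul, norm_real, norm_real,
      Real.norm_of_nonneg h0, Real.norm_of_nonneg (by linarith)]
  have e0 := two_mul_re_sq (v * z)
  have e1 := two_mul_re_sq (v * z₁)
  have e2 := two_mul_re_sq (v * z₂)
  nlinarith

/-- Off a common ray the triangle inequality is strict, so a chord of the parabolic region can touch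
the boundary only at its ends. -/
lemma re_sq_lt_of_sq_eq {v z z₁ z₂ : ℂ} {t : ℝ} (h0 : 0 < t) (h1 : t < 1) (hv : v ≠ 0)
    (hray : ¬ SameRay ℝ (z₁ ^ 2) (z₂ ^ 2))
    (hz : z ^ 2 = (1 - t) * z₁ ^ 2 + t * z₂ ^ 2) :
    (v * z).re ^ 2 < (1 - t) * (v * z₁).re ^ 2 + t * (v * z₂).re ^ 2 := by
  have e : (v * z) ^ 2 = (1 - t) * (v * z₁) ^ 2 + t * (v * z₂) ^ 2 := by
    rw [mul_pow, hz]; ring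
  have hre : ((v * z) ^ 2).re = (1 - t) * ((v * z₁) ^ 2).re + t * ((v * z₂) ^ 2).re := by
    rw [e, show (1 - (t:ℂ)) = ((1 - t : ℝ) : ℂ) by push_cast; ring, add_re, re_ofReal_mul, re_ofReal_mul]
  have hn : ‖(v * z) ^ 2‖ < (1 - t) * ‖(v * z₁) ^ 2‖ + t * ‖(v * z₂) ^ 2‖ := by
    have hray' : ¬ SameRay ℝ ((1 - t : ℝ) • z₁ ^ 2) (t • z₂ ^ 2) := by
      intro h
      apply hray
      have h1t : 0 < 1 - t := by linarith
      have := (h.pos_smul_left (inv_pos.2 h1t)).pos_smul_right (inv_pos.2 h0)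
      rwa [smul_smul, smul_smul, inv_mul_cancel₀ h1t.ne', inv_mul_cancel₀ h0.ne', one_smul,
        one_smul] at this
    have := norm_add_lt_of_not_sameRay hray'
    have e3 : (v * z) ^ 2 = v ^ 2 * ((1 - t : ℝ) • z₁ ^ 2 + t • z₂ ^ 2) := by
      rw [e]; simp only [real_smul]; push_cast; ring
    rw [e3, norm_mul, mul_pow, mul_pow, norm_mul, norm_mul]
    rw [norm_smul, norm_smul, Real.norm_of_nonneg h0.le, Real.norm_of_nonneg (by linarith)] at this
    have hv' : 0 < ‖v ^ 2‖ := norm_pos_iff.2 (pow_ne_zero 2 hv)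
    nlinarith
  have e0 := two_mul_re_sq (v * z)
  have e1 := two_mul_re_sq (v * z₁)
  have e2 := two_mul_re_sq (v * z₂)
  nlinarith

lemma tiltedNorm_lt_of_re_sq_lt {ε M : ℝ} (hε : 0 ≤ ε) (hM : 0 < M) {z : ℂ}
    (h1 : ((ε - I) * z).re ^ 2 < M ^ 2) (h2 : ((ε + I) * z).re ^ 2 < M ^ 2) :
    tiltedNorm ε z < M :=
  (tiltedNorm_lt_iff hε z).2 ⟨abs_lt_of_sq_lt_sq h1 hM.le, abs_lt_of_sq_lt_sq h2 hM.le⟩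

lemma tiltedNorm_lt_of_sq_eq {ε M t : ℝ} (hε : 0 ≤ ε) {z z₁ z₂ : ℂ} (h0 : 0 ≤ t) (h1 : t ≤ 1)
    (hz : z ^ 2 = (1 - t) * z₁ ^ 2 + t * z₂ ^ 2) (hz₁ : tiltedNorm ε z₁ < M)
    (hz₂ : tiltedNorm ε z₂ < M) : tiltedNorm ε z < M := by
  obtain ⟨a1, b1⟩ := (tiltedNorm_lt_iff hε z₁).1 hz₁
  obtain ⟨a2, b2⟩ := (tiltedNorm_lt_iff hε z₂).1 hz₂
  have hM : 0 < M := (abs_nonneg _).trans_lt a1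
  have key : ∀ v : ℂ, |(v * z₁).re| < M → |(v * z₂).re| < M → (v * z).re ^ 2 < M ^ 2 := by
    intro v c1 c2
    have := re_sq_le_of_sq_eq (v := v) h0 h1 hz
    have d1 := sq_lt_sq' (abs_lt.1 c1).1 (abs_lt.1 c1).2
    have d2 := sq_lt_sq' (abs_lt.1 c2).1 (abs_lt.1 c2).2
    rcases h0.eq_or_lt with rfl | h0
    · nlinarith
    · nlinarith
  exact tiltedNorm_lt_of_re_sq_lt hε hM (key _ a1 a2) (key _ b1 b2)

lemma tiltedNorm_lt_of_sq_eq_of_not_sameRay {ε M t : ℝ} (hε : 0 ≤ ε) (hM : 0 < M) {z z₁ z₂ : ℂ}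
    (h0 : 0 < t) (h1 : t < 1) (hray : ¬ SameRay ℝ (z₁ ^ 2) (z₂ ^ 2))
    (hz : z ^ 2 = (1 - t) * z₁ ^ 2 + t * z₂ ^ 2) (hz₁ : tiltedNorm ε z₁ ≤ M)
    (hz₂ : tiltedNorm ε z₂ ≤ M) : tiltedNorm ε z < M := by
  obtain ⟨a1, b1⟩ := abs_re_mul_le_tiltedNorm hε z₁
  obtain ⟨a2, b2⟩ := abs_re_mul_le_tiltedNorm hε z₂
  have key : ∀ v : ℂ, v ≠ 0 → |(v * z₁).re| ≤ M → |(v * z₂).re| ≤ M → (v * z).re ^ 2 < M ^ 2 := by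
    intro v hv c1 c2
    have := re_sq_lt_of_sq_eq (v := v) h0 h1 hv hray hz
    have d1 := sq_le_sq' (abs_le.1 c1).1 (abs_le.1 c1).2
    have d2 := sq_le_sq' (abs_le.1 c2).1 (abs_le.1 c2).2
    nlinarith
  refine tiltedNorm_lt_of_re_sq_lt hε hM (key _ ?_ (a1.trans hz₁) (a2.trans hz₂))
    (key _ ?_ (b1.trans hz₁) (b2.trans hz₂))
  · intro h; simpa using congrArg Complex.im h
  · intro h; simpa using congrArg Complex.im h

/-- A positive ratio `d²` of the squares would give `r + a = ±d (r - a)`. Imaginary parts exclude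
the minus sign and force `d = 1`, that is `a = -a`. -/
lemma not_sameRay_sq {r : ℂ} {a : ℝ} (ha : 0 < a) (hr : 0 < r.im) :
    ¬ SameRay ℝ ((r - a) ^ 2) ((r + a) ^ 2) := by
  intro h
  have h1 : (r - a) ^ 2 ≠ 0 := pow_ne_zero 2 fun h => by
    have := congrArg Complex.im h; simp at this; linarith
  have h2 : (r + a) ^ 2 ≠ 0 := pow_ne_zero 2 fun h => by
    have := congrArg Complex.im h; simp at this; linarith
  obtain ⟨c, hc, hcc⟩ := h.exists_pos_left h1 h2
  obtain ⟨d, hd, rfl⟩ : ∃ d : ℝ, 0 < d ∧ c = d ^ 2 := ⟨√c, Real.sqrt_pos.2 hc, (Real.sq_sqrt hc.le).symm⟩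
  rw [real_smul] at hcc
  have : (d * (r - a) - (r + a)) * (d * (r - a) + (r + a)) = 0 := by
    push_cast at hcc; linear_combination hcc
  rcases mul_eq_zero.1 this with h | h
  · have him := congrArg Complex.im h
    have hre := congrArg Complex.re h
    simp at him hre
    have : d = 1 := by
      have : (d - 1) * r.im = 0 := by linarith
      rcases mul_eq_zero.1 this with h | h <;> linarith
    subst this
    linarith
  · have him := congrArg Complex.im h
    simp at him
    nlinarith

/-! ### Blow-up of the logarithmic derivative at the ends of a segment. -/

/-- If `X + Y` stays bounded while `δ → 0`, then `δ X²` and `δ Y²` have the same limit. -/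
lemma eq_of_tendsto_mul_sq {ι : Type*} {l : Filter ι} [l.NeBot] {X Y δ : ι → ℂ} {A B : ℂ} {C : ℝ}
    (hδ : Tendsto δ l (𝓝 0)) (hC : ∀ᶠ i in l, ‖X i + Y i‖ ≤ C)
    (hX : Tendsto (fun i => δ i * X i ^ 2) l (𝓝 A)) (hY : Tendsto (fun i => δ i * Y i ^ 2) l (𝓝 B)) :
    A = B := by
  have aux : ∀ (Z : ι → ℂ) (D : ℂ), Tendsto (fun i => δ i * Z i ^ 2) l (𝓝 D) →
      Tendsto (fun i => δ i * Z i) l (𝓝 0) := by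
    intro Z D hZ
    have h := (hδ.mul hZ).norm
    rw [zero_mul, norm_zero] at h
    have h' := h.sqrt
    rw [Real.sqrt_zero] at h'
    rw [tendsto_zero_iff_norm_tendsto_zero]
    refine h'.congr fun i => ?_
    rw [show δ i * (δ i * Z i ^ 2) = (δ i * Z i) ^ 2 by ring, norm_pow, Real.sqrt_sq (norm_nonneg _)]
  -- The difference `δX² - δY²` factors as `(X + Y)(δX - δY)`, and `δX → 0` because `(δX)² = δ ·
  -- (δX²)`.
  have h1 : Tendsto (fun i => (X i + Y i) * (δ i * X i - δ i * Y i)) l (𝓝 0) := by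
    have h0 := (aux X A hX).sub (aux Y B hY)
    rw [sub_zero] at h0
    rw [tendsto_zero_iff_norm_tendsto_zero] at h0 ⊢
    have h2 := h0.const_mul C
    rw [mul_zero] at h2
    refine squeeze_zero' (.of_forall fun i => norm_nonneg _) ?_ h2
    filter_upwards [hC] with i hi
    rw [norm_mul]
    gcongr
  have h2 := hX.sub hY
  have h3 := tendsto_nhds_unique h2 (h1.congr fun i => by ring)
  exact sub_eq_zero.1 h3

/-- The contribution of a simple pole of the logarithmic derivative to its integral along the
segment between `(r - a)²` and `(r + a)²`. -/
lemma integral_pole_segment {r w s : ℂ} {a : ℝ} (ha : a ≠ 0) (hr : r ≠ 0)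
    (hw : ∀ t : ℝ, |t| ≤ 1 → w ≠ t) (hs : r ^ 2 + a ^ 2 - s = 2 * r * a * w) :
    ∫ θ in (0 : ℝ)..2 * Real.pi,
      1 / (r ^ 2 + a ^ 2 + 2 * r * a * Real.cos θ - s) * (2 * r + 2 * a * Real.cos θ)
    = 1 / r * (2 * Real.pi + (r / a - w) * ∫ θ in (0 : ℝ)..2 * Real.pi, 1 / (w + Real.cos θ)) := by
  have ha' : (a : ℂ) ≠ 0 := by exact_mod_cast ha
  have hne : ∀ θ : ℝ, w + Real.cos θ ≠ 0 := by
    intro θ h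
    refine hw (-Real.cos θ) (by rw [abs_neg]; exact Real.abs_cos_le_one θ) ?_
    push_cast at h ⊢
    linear_combination h
  have hint : IntervalIntegrable (fun θ : ℝ => 1 / (w + Real.cos θ)) volume 0 (2 * Real.pi) := by
    apply Continuous.intervalIntegrable
    refine continuous_const.div (by fun_prop) hne
  have hc : (∫ θ in (0 : ℝ)..2 * Real.pi, (1 : ℂ)) = 2 * Real.pi := by simp
  rw [← intervalIntegral.integral_const_mul, ← hc, ← intervalIntegral.integral_add (by simp)
    (hint.const_mul _), ← intervalIntegral.integral_const_mul]
  apply intervalIntegral.integral_congr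
  intro θ _
  have e : r ^ 2 + a ^ 2 + 2 * r * a * Real.cos θ - s = 2 * r * a * (w + Real.cos θ) := by
    linear_combination hs
  have := hne θ
  simp only [e]
  field_simp
  ring

/-- Blow-up rate of the pole contribution as one end of the segment approaches the pole. -/
lemma tendsto_pole_contribution {r₀ : ℂ} {a : ℝ} {e : ℂ} {m : ℕ} (ha : a ≠ 0) (hr₀ : r₀ ≠ 0) (he : e ^ 2 = 1)
    (hne : r₀ - e * a ≠ 0) {ι : Type*} {l : Filter ι} {r w : ι → ℂ} (hr : Tendsto r l (𝓝 r₀))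
    (hrne : ∀ᶠ i in l, r i ≠ r₀)
    (hw : ∀ i, w i = (r i ^ 2 + a ^ 2 - (r₀ - e * a) ^ 2) / (2 * r i * a))
    (hoff : ∀ᶠ i in l, m ≠ 0 → ∀ t : ℝ, |t| ≤ 1 → w i ≠ t) :
    Tendsto (fun i => (r i - r₀) *
      (m * ((r i / a - w i) * ∫ θ in (0 : ℝ)..2 * Real.pi, 1 / (w i + Real.cos θ))) ^ 2) l
      (𝓝 (m ^ 2 * e * (2 * Real.pi ^ 2 * r₀ / a) * (r₀ - e * a))) := by
  have ha' : (a : ℂ) ≠ 0 := by exact_mod_cast ha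
  have he0 : e ≠ 0 := by rintro rfl; norm_num at he
  -- The sign `e` selects the end: the pole is at `(r₀ - a)²` for `e = 1` and at `(r₀ + a)²` for `e
  -- = -1`. Either way `w` tends to `e`, where the cosine integral is singular.
  have hwlim : Tendsto w l (𝓝 e) := by
    have h1 : Tendsto (fun i => (r i ^ 2 + a ^ 2 - (r₀ - e * a) ^ 2) / (2 * r i * a)) l
        (𝓝 ((r₀ ^ 2 + a ^ 2 - (r₀ - e * a) ^ 2) / (2 * r₀ * a))) := by
      refine Tendsto.div ?_ ?_ (by simp [hr₀, ha'])
      · exact ((hr.pow 2).add_const _).sub_const _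
      · exact (hr.const_mul 2).mul_const _
    have h2 : (r₀ ^ 2 + a ^ 2 - (r₀ - e * a) ^ 2) / (2 * r₀ * a) = e := by
      field_simp
      linear_combination -(a:ℂ) ^ 2 * he
    rw [h2] at h1
    exact h1.congr fun i => (hw i).symm
  have hlim : Tendsto (fun i => m ^ 2 * (r i / a - w i) ^ 2 * (4 * Real.pi ^ 2) *
      (4 * r i ^ 2 * a ^ 2) / ((r i + r₀ - 2 * (e * a)) * ((r i + e * a) ^ 2 - (r₀ - e * a) ^ 2))) l
      (𝓝 (m ^ 2 * (r₀ / a - e) ^ 2 * (4 * Real.pi ^ 2) *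
      (4 * r₀ ^ 2 * a ^ 2) / ((r₀ + r₀ - 2 * (e * a)) * ((r₀ + e * a) ^ 2 - (r₀ - e * a) ^ 2)))) := by
    refine Tendsto.div ?_ ?_ ?_
    · refine Tendsto.mul (Tendsto.mul (Tendsto.mul tendsto_const_nhds ?_) tendsto_const_nhds) ?_
      · exact ((hr.div_const _).sub hwlim).pow 2
      · exact ((hr.pow 2).const_mul 4).mul_const _
    · exact ((hr.add_const _).sub_const _).mul (((hr.add_const _).pow 2).sub_const _)
    · rw [show (r₀ + r₀ - 2 * (e * a)) * ((r₀ + e * a) ^ 2 - (r₀ - e * a) ^ 2)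
        = 8 * (r₀ - e * a) * (r₀ * e * a) by ring]
      simp [hne, hr₀, he0, ha']
  have hval : m ^ 2 * (r₀ / a - e) ^ 2 * (4 * Real.pi ^ 2) *
      (4 * r₀ ^ 2 * a ^ 2) / ((r₀ + r₀ - 2 * (e * a)) * ((r₀ + e * a) ^ 2 - (r₀ - e * a) ^ 2))
      = m ^ 2 * e * (2 * Real.pi ^ 2 * r₀ / a) * (r₀ - e * a) := by
    rw [show (r₀ + r₀ - 2 * (e * a)) * ((r₀ + e * a) ^ 2 - (r₀ - e * a) ^ 2)
        = 8 * (r₀ - e * a) * (r₀ * e * a) by ring]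
    rw [show r₀ / a - e = (r₀ - e * a) / a by field_simp, div_eq_iff (by simp [hne, hr₀, he0, ha'])]
    field_simp
    linear_combination (-16 * (m : ℂ) ^ 2) * he
  rw [hval] at hlim
  refine hlim.congr' ?_
  filter_upwards [hrne, hoff, hr.eventually_ne hr₀] with i h1 h2 h3
  rcases Nat.eq_zero_or_pos m with rfl | hm
  · simp
  have h2 := h2 hm.ne'
  have hsq := sq_integral_inv_add_cos h2
  rw [mul_pow, mul_pow, hsq]
  -- `w² - 1` contains the factor `r - r₀` exactly once, so multiplying the square `4π²/(w² - 1)` by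
  -- `r - r₀` leaves a finite limit.
  have hw1 : w i ^ 2 - 1 = (r i - r₀) * ((r i + r₀ - 2 * (e * a)) *
      ((r i + e * a) ^ 2 - (r₀ - e * a) ^ 2)) / (4 * r i ^ 2 * a ^ 2) := by
    rw [eq_div_iff (by simp [h3, ha'])]
    have hwi : w i * (2 * r i * a) = r i ^ 2 + a ^ 2 - (r₀ - e * a) ^ 2 := by
      rw [hw i, div_mul_cancel₀]; simp [h3, ha']
    linear_combination (w i * (2 * r i * a) + (r i ^ 2 + a ^ 2 - (r₀ - e * a) ^ 2)) * hwi
      + (a ^ 4 * e ^ 2 + 2 * r i ^ 2 * a ^ 2 - a ^ 4 + 2 * a ^ 2 * r₀ ^ 2 - 4 * a ^ 3 * r₀ * e) * he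
  have hw0 : w i ^ 2 - 1 ≠ 0 := by
    intro h
    have : (w i - 1) * (w i + 1) = 0 := by linear_combination h
    rcases mul_eq_zero.1 this with h | h
    · exact h2 1 (by simp) (by push_cast; linear_combination h)
    · exact h2 (-1) (by simp) (by push_cast; linear_combination h)
  have hδ : r i - r₀ ≠ 0 := sub_ne_zero.2 h1
  have hD : (r i + r₀ - 2 * (e * a)) * ((r i + e * a) ^ 2 - (r₀ - e * a) ^ 2) ≠ 0 := by
    intro h
    rw [hw1, h] at hw0
    simp at hw0
  rw [hw1]
  generalize (r i + r₀ - 2 * (e * a)) * ((r i + e * a) ^ 2 - (r₀ - e * a) ^ 2) = D at hD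
  field_simp

lemma segment_eq (r : ℂ) (a c : ℝ) :
    r ^ 2 + a ^ 2 + 2 * r * a * c
      = (1 - ((1 + c) / 2 : ℝ)) * (r - a) ^ 2 + ((1 + c) / 2 : ℝ) * (r + a) ^ 2 := by
  push_cast; ring

/-- Each point of the segment is a square, and by convexity its root lies in the open ball of radius
`M`, which contains no root of a zero. -/
lemma ne_zero_on_segment {Q : ℂ → ℂ} {ε M a : ℝ} (hε : 0 ≤ ε)
    (hz : ∀ z, Q (z ^ 2) = 0 → M ≤ tiltedNorm ε z) {r : ℂ} (h1 : tiltedNorm ε (r - a) < M)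
    (h2 : tiltedNorm ε (r + a) < M) {c : ℝ} (hc : |c| ≤ 1) :
    Q (r ^ 2 + a ^ 2 + 2 * r * a * c) ≠ 0 := by
  intro h
  obtain ⟨z, hzz⟩ := IsAlgClosed.exists_pow_nat_eq (r ^ 2 + a ^ 2 + 2 * r * a * c) (n := 2) (by norm_num)
  rw [abs_le] at hc
  have := tiltedNorm_lt_of_sq_eq hε (by linarith) (by linarith) (hzz.trans (segment_eq r a c)) h1 h2
  exact absurd this (not_lt.2 (hz z (by rw [hzz]; exact h)))

/-- Strict convexity: when the ends are allowed on the boundary, the interior of the segment still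
stays strictly inside. -/
lemma eq_endpoint_of_zero_on_segment {Q : ℂ → ℂ} {ε M a : ℝ} (hε : 0 ≤ ε) (hM : 0 < M) (ha : 0 < a)
    (hz : ∀ z, Q (z ^ 2) = 0 → M ≤ tiltedNorm ε z) {r : ℂ} (hr : 0 < r.im)
    (h1 : tiltedNorm ε (r - a) ≤ M) (h2 : tiltedNorm ε (r + a) ≤ M) {c : ℝ} (hc : |c| ≤ 1)
    (h : Q (r ^ 2 + a ^ 2 + 2 * r * a * c) = 0) : c = -1 ∨ c = 1 := by
  by_contra hcon
  push Not at hcon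
  obtain ⟨z, hzz⟩ := IsAlgClosed.exists_pow_nat_eq (r ^ 2 + a ^ 2 + 2 * r * a * c) (n := 2) (by norm_num)
  rw [abs_le] at hc
  have hc1 : -1 < c := lt_of_le_of_ne hc.1 (Ne.symm hcon.1)
  have hc2 : c < 1 := lt_of_le_of_ne hc.2 hcon.2
  have := tiltedNorm_lt_of_sq_eq_of_not_sameRay hε hM (by linarith) (by linarith)
    (not_sameRay_sq ha hr) (hzz.trans (segment_eq r a c)) h1 h2
  exact absurd this (not_lt.2 (hz z (by rw [hzz]; exact h)))

/-! ### Segment integrals and the exclusion of zeros. -/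

/-- The logarithmic derivative of `Q` integrated over the segment from `(r - a)²` to `(r + a)²`
against the arcsine weight. -/
noncomputable def segmentIntegral (Q : ℂ → ℂ) (a : ℝ) (r : ℂ) : ℂ :=
  ∫ θ in (0 : ℝ)..2 * Real.pi,
    deriv Q (r ^ 2 + a ^ 2 + 2 * r * a * Real.cos θ) / Q (r ^ 2 + a ^ 2 + 2 * r * a * Real.cos θ)
      * (2 * r + 2 * a * Real.cos θ)

lemma differentiableAt_segmentIntegral {Q : ℂ → ℂ} (hQ : Differentiable ℂ Q) {a : ℝ} {U : Set ℂ}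
    (hU : IsOpen U) (hne : ∀ r ∈ U, ∀ c : ℝ, |c| ≤ 1 → Q (r ^ 2 + a ^ 2 + 2 * r * a * c) ≠ 0)
    {r : ℂ} (hr : r ∈ U) : DifferentiableAt ℂ (segmentIntegral Q a) r := by
  have hdd : Differentiable ℂ (deriv Q) := by
    rw [← differentiableOn_univ] at hQ ⊢
    exact hQ.deriv isOpen_univ
  have hQc := hQ.continuous
  have hdc := hdd.continuous
  refine differentiableAt_intervalIntegral_of_continuousOn hU ?_ ?_ hr
  · refine ContinuousOn.mul (ContinuousOn.div ?_ ?_ ?_) ?_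
    · exact Continuous.continuousOn (by fun_prop)
    · exact Continuous.continuousOn (by fun_prop)
    · rintro ⟨r, θ⟩ ⟨h, -⟩
      exact hne r h _ (Real.abs_cos_le_one θ)
    · exact Continuous.continuousOn (by fun_prop)
  · intro θ _ r hr
    have := hne r hr _ (Real.abs_cos_le_one θ)
    refine DifferentiableAt.differentiableWithinAt ?_
    refine DifferentiableAt.mul (DifferentiableAt.div ?_ ?_ this) (by fun_prop)
    · exact (hdd _).comp r (f := fun r : ℂ => r ^ 2 + a ^ 2 + 2 * r * a * Real.cos θ) (by fun_prop)
    · exact (hQ _).comp r (f := fun r : ℂ => r ^ 2 + a ^ 2 + 2 * r * a * Real.cos θ) (by fun_prop)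

/-- If the segment integral is linear on the real line, it is linear on the convex neighbourhood of
the origin on which the segments avoid the zeros of `Q`. -/
lemma segmentIntegral_eq_linear {Q : ℂ → ℂ} (hQ : Differentiable ℂ Q) {a lam ε M : ℝ} (ha : 0 < a)
    (hmean : ∀ r : ℝ, segmentIntegral Q a r = lam * r) (hε : 0 ≤ ε) (hM : ε * a < M)
    (hz : ∀ z, Q (z ^ 2) = 0 → M ≤ tiltedNorm ε z) {r : ℂ} (h1 : tiltedNorm ε (r - a) < M)
    (h2 : tiltedNorm ε (r + a) < M) : segmentIntegral Q a r = lam * r := by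
  set W : Set ℂ := {r | tiltedNorm ε (r - a) < M ∧ tiltedNorm ε (r + a) < M} with hW
  have hWo : IsOpen W := by
    have := continuous_tiltedNorm ε
    exact (isOpen_lt (f := fun r : ℂ => tiltedNorm ε (r - a)) (by fun_prop) continuous_const).inter
      (isOpen_lt (f := fun r : ℂ => tiltedNorm ε (r + a)) (by fun_prop) continuous_const)
  have hWc : Convex ℝ W := by
    intro x hx y hy s t hs ht hst
    have hsC : (s : ℂ) + t = 1 := by exact_mod_cast hst
    have key : ∀ b : ℂ, tiltedNorm ε (x + b) < M → tiltedNorm ε (y + b) < M →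
        tiltedNorm ε (s • x + t • y + b) < M := by
      intro b hb1 hb2
      have e : s • x + t • y + b = s * (x + b) + t * (y + b) := by
        simp only [real_smul]; linear_combination -b * hsC
      rw [e]
      refine (tiltedNorm_add_le hε _ _).trans_lt ?_
      rw [tiltedNorm_smul ε hs, tiltedNorm_smul ε ht]
      rcases hs.eq_or_lt with rfl | hs
      · have : t = 1 := by linarith
        subst this; simpa using hb2
      · have e1 : s * tiltedNorm ε (x + b) < s * M := mul_lt_mul_of_pos_left hb1 hs
        have e2 : t * tiltedNorm ε (y + b) ≤ t * M := mul_le_mul_of_nonneg_left hb2.le ht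
        have e3 : s * M + t * M = M := by rw [← add_mul, hst, one_mul]
        linarith
    refine ⟨?_, key a hx.2 hy.2⟩
    have hx1 := hx.1
    have hy1 := hy.1
    rw [sub_eq_add_neg] at hx1 hy1 ⊢
    exact key (-a) hx1 hy1
  have hne : ∀ r ∈ W, ∀ c : ℝ, |c| ≤ 1 → Q (r ^ 2 + a ^ 2 + 2 * r * a * c) ≠ 0 :=
    fun r hr c hc => ne_zero_on_segment hε hz hr.1 hr.2 hc
  have han : AnalyticOnNhd ℂ (segmentIntegral Q a) W := by
    apply DifferentiableOn.analyticOnNhd _ hWo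
    intro r hr
    exact (differentiableAt_segmentIntegral hQ hWo hne hr).differentiableWithinAt
  have han2 : AnalyticOnNhd ℂ (fun r : ℂ => lam * r) W := by
    apply DifferentiableOn.analyticOnNhd _ hWo
    fun_prop
  have h0 : (0 : ℂ) ∈ W := by
    constructor <;> simp [tiltedNorm, abs_of_pos ha, hM]
  -- Both sides are analytic on the convex set `W` and agree at real points, which accumulate at
  -- `0`; the hypothesis `ε * a < M` is what puts `0` in `W`.
  refine han.eqOn_of_preconnected_of_frequently_eq han2 hWc.isPreconnected h0 ?_ ⟨h1, h2⟩
  have hreal : Tendsto (fun x : ℝ => (x : ℂ)) (𝓝[≠] 0) (𝓝[≠] 0) := by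
    refine tendsto_nhdsWithin_iff.2 ⟨?_, ?_⟩
    · exact (Complex.continuous_ofReal.tendsto' 0 0 (by simp)).mono_left nhdsWithin_le_nhds
    · filter_upwards [self_mem_nhdsWithin] with x hx
      simpa using hx
  exact hreal.frequently (Eventually.frequently (.of_forall fun x => hmean x))

/-- The coordinate `w` satisfies `s = r² + a² - 2raw`, so a value in `[-1, 1]` would place the zero
`s` on the segment. -/
lemma not_mem_unit_segment {Q : ℂ → ℂ} {ε M a : ℝ} (ha : 0 < a) (hε : 0 ≤ ε)
    (hz : ∀ z, Q (z ^ 2) = 0 → M ≤ tiltedNorm ε z) {r s w : ℂ} (hr0 : r ≠ 0)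
    (h1 : tiltedNorm ε (r - a) < M) (h2 : tiltedNorm ε (r + a) < M) (hs : Q s = 0)
    (hw : w = (r ^ 2 + a ^ 2 - s) / (2 * r * a)) : ∀ t : ℝ, |t| ≤ 1 → w ≠ t := by
  intro t ht h
  have ha' : (a : ℂ) ≠ 0 := by exact_mod_cast ha.ne'
  apply ne_zero_on_segment hε hz h1 h2 (c := -t) (by rwa [abs_neg])
  rw [hw, div_eq_iff (by simp [hr0, ha'])] at h
  rw [← hs]
  congr 1
  push_cast
  linear_combination h

/-- A convex zero-free region cannot have a zero of `Q` at an end of a limiting segment. -/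
lemma ne_zero_at_endpoints {Q : ℂ → ℂ} (hQ : Differentiable ℂ Q) {a lam ε M : ℝ} (ha : 0 < a)
    (hmean : ∀ r : ℝ, segmentIntegral Q a r = lam * r) (hε : 0 ≤ ε) (hM0 : 0 < M) (hM : ε * a < M)
    (hQ0 : ∃ z, Q z ≠ 0)
    (hz : ∀ z, Q (z ^ 2) = 0 → M ≤ tiltedNorm ε z) {r₀ : ℂ} (him : 0 < r₀.im)
    (h1 : tiltedNorm ε (r₀ - a) ≤ M) (h2 : tiltedNorm ε (r₀ + a) ≤ M) :
    Q ((r₀ - a) ^ 2) ≠ 0 ∧ Q ((r₀ + a) ^ 2) ≠ 0 := by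
  have ha' : (a : ℂ) ≠ 0 := by exact_mod_cast ha.ne'
  have hr₀ : r₀ ≠ 0 := by rintro rfl; simp at him
  have hm0 : r₀ - a ≠ 0 := by intro h; have := congrArg Complex.im h; simp at this; linarith
  have hp0 : r₀ + a ≠ 0 := by intro h; have := congrArg Complex.im h; simp at this; linarith
  -- `m` and `n` are the multiplicities, possibly zero, of `Q` at the two ends; the aim is `m = n =
  -- 0`.
  obtain ⟨m, Q₁, hQ₁, hQ₁0, hfac₁⟩ := exists_eq_pow_mul_of_differentiable hQ hQ0 ((r₀ - a) ^ 2)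
  obtain ⟨n, Q₂, hQ₂, hQ₂0, hfac₂⟩ :=
    exists_eq_pow_mul_of_differentiable hQ₁ ⟨_, hQ₁0⟩ ((r₀ + a) ^ 2)
  have hQ₂0' : Q₂ ((r₀ - a) ^ 2) ≠ 0 := by
    intro h
    rw [hfac₂, h, mul_zero] at hQ₁0
    exact hQ₁0 rfl
  have hfac : ∀ s, Q s = (s - (r₀ - a) ^ 2) ^ m * ((s - (r₀ + a) ^ 2) ^ n * Q₂ s) := by
    intro s; rw [hfac₁, hfac₂]
  have hsne : (r₀ - a) ^ 2 - (r₀ + a) ^ 2 ≠ 0 := by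
    rw [show (r₀ - a) ^ 2 - (r₀ + a) ^ 2 = -4 * r₀ * a by ring]
    simp [hr₀, ha']
  have hQm : m ≠ 0 → Q ((r₀ - a) ^ 2) = 0 := by
    intro h; rw [hfac]; simp [h]
  have hQp : n ≠ 0 → Q ((r₀ + a) ^ 2) = 0 := by
    intro h; rw [hfac]; simp [h]
  -- `Q₂` has no zero on the limiting segment
  have hQ₂seg : ∀ c : ℝ, |c| ≤ 1 → Q₂ (r₀ ^ 2 + a ^ 2 + 2 * r₀ * a * c) ≠ 0 := by
    intro c hc h
    have hQz : Q (r₀ ^ 2 + a ^ 2 + 2 * r₀ * a * c) = 0 := by rw [hfac, h]; simp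
    rcases eq_endpoint_of_zero_on_segment hε hM0 ha hz him h1 h2 hc hQz with rfl | rfl
    · apply hQ₂0'; rw [← h]; congr 1; push_cast; ring
    · apply hQ₂0; rw [← h]; congr 1; push_cast; ring
  obtain ⟨δ, hδ, hball⟩ : ∃ δ > 0, ∀ r ∈ ball r₀ δ, ∀ c : ℝ, |c| ≤ 1 →
      Q₂ (r ^ 2 + a ^ 2 + 2 * r * a * c) ≠ 0 := by
    have hc := hQ₂.continuous
    have hev : ∀ᶠ r in 𝓝 r₀, ∀ c ∈ Set.Icc (-1 : ℝ) 1, Q₂ (r ^ 2 + a ^ 2 + 2 * r * a * c) ≠ 0 := by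
      apply isCompact_Icc.eventually_forall_of_forall_eventually
      intro c hc'
      have hcont : Continuous fun p : ℂ × ℝ => Q₂ (p.1 ^ 2 + a ^ 2 + 2 * p.1 * a * p.2) := by fun_prop
      exact hcont.continuousAt.eventually_ne (hQ₂seg c (abs_le.2 hc'))
    obtain ⟨δ, hδ, h⟩ := Metric.eventually_nhds_iff_ball.1 hev
    exact ⟨δ, hδ, fun r hr c hc => h r hr c (abs_le.1 hc)⟩
  have hBc : ContinuousAt (segmentIntegral Q₂ a) r₀ :=
    (differentiableAt_segmentIntegral hQ₂ isOpen_ball hball (mem_ball_self hδ)).continuousAt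
  -- the radial path to `r₀`
  set ρ : ℝ → ℂ := fun τ => τ * r₀ with hρ
  set l : Filter ℝ := 𝓝[<] 1 with hl
  have hρlim : Tendsto ρ l (𝓝 r₀) := by
    have : Continuous ρ := by fun_prop
    exact (this.tendsto' 1 r₀ (by simp [hρ])).mono_left nhdsWithin_le_nhds
  have hunit : ∀ᶠ τ in l, 0 < τ ∧ τ < 1 := by
    filter_upwards [Ioo_mem_nhdsLT (show (0 : ℝ) < 1 by norm_num)] with τ hτ using hτ
  have hρne : ∀ᶠ τ in l, ρ τ ≠ r₀ := by
    filter_upwards [hunit] with τ hτ h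
    have : ((τ : ℂ) - 1) * r₀ = 0 := by rw [sub_mul, one_mul]; exact sub_eq_zero.2 h
    rcases mul_eq_zero.1 this with h | h
    · have : (τ : ℂ) = 1 := by linear_combination h
      have : τ = 1 := by exact_mod_cast this
      linarith [hτ.2]
    · exact hr₀ h
  -- Convexity of the norm between `b`, of norm `ε a < M`, and `r₀ + b`, of norm at most `M`: before
  -- the end of the path the segments lie in the open region.
  have hW : ∀ b : ℝ, |b| = a → tiltedNorm ε (r₀ + b) ≤ M → ∀ τ : ℝ, 0 < τ → τ < 1 →
      tiltedNorm ε (ρ τ + b) < M := by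
    intro b hb hbM τ h0 h1
    have e : ρ τ + b = τ * (r₀ + b) + (1 - τ : ℝ) * (b : ℂ) := by
      simp only [hρ]; push_cast; ring
    rw [e]
    refine (tiltedNorm_add_le hε _ _).trans_lt ?_
    rw [tiltedNorm_smul ε h0.le, tiltedNorm_smul ε (by linarith)]
    have e2 : tiltedNorm ε (b : ℂ) = ε * a := by simp [tiltedNorm, hb]
    rw [e2]
    have : (1 - τ) * (ε * a) < (1 - τ) * M := mul_lt_mul_of_pos_left hM (by linarith)
    nlinarith
  have hW1 : ∀ τ : ℝ, 0 < τ → τ < 1 → tiltedNorm ε (ρ τ - a) < M := by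
    intro τ h0 h1'
    have := hW (-a) (by simp [abs_of_pos ha]) (by simpa [sub_eq_add_neg] using h1) τ h0 h1'
    simpa [sub_eq_add_neg] using this
  have hW2 : ∀ τ : ℝ, 0 < τ → τ < 1 → tiltedNorm ε (ρ τ + a) < M :=
    hW a (abs_of_pos ha) h2
  have hρ0 : ∀ τ : ℝ, 0 < τ → ρ τ ≠ 0 := by
    intro τ h
    simp only [hρ]
    exact mul_ne_zero (by exact_mod_cast h.ne') hr₀
  set w₁ : ℝ → ℂ := fun τ => (ρ τ ^ 2 + a ^ 2 - (r₀ - 1 * a) ^ 2) / (2 * ρ τ * a) with hw₁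
  set w₂ : ℝ → ℂ := fun τ => (ρ τ ^ 2 + a ^ 2 - (r₀ - (-1) * a) ^ 2) / (2 * ρ τ * a) with hw₂
  have hoff₁ : ∀ τ : ℝ, 0 < τ → τ < 1 → m ≠ 0 → ∀ t : ℝ, |t| ≤ 1 → w₁ τ ≠ t := fun τ h0 h1 hm =>
    not_mem_unit_segment ha hε hz (hρ0 τ h0) (hW1 τ h0 h1) (hW2 τ h0 h1) (hQm hm)
      (by simp only [hw₁, one_mul])
  have hoff₂ : ∀ τ : ℝ, 0 < τ → τ < 1 → n ≠ 0 → ∀ t : ℝ, |t| ≤ 1 → w₂ τ ≠ t := fun τ h0 h1 hn =>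
    not_mem_unit_segment ha hε hz (hρ0 τ h0) (hW1 τ h0 h1) (hW2 τ h0 h1) (hQp hn)
      (by simp only [hw₂, neg_mul, one_mul, sub_neg_eq_add])
  -- `X` and `Y` are `ρ` times the integrals of the two pole terms, up to the constants `2πm` and
  -- `2πn`.
  set X : ℝ → ℂ := fun τ =>
    m * ((ρ τ / a - w₁ τ) * ∫ θ in (0 : ℝ)..2 * Real.pi, 1 / (w₁ τ + Real.cos θ)) with hX
  set Y : ℝ → ℂ := fun τ =>
    n * ((ρ τ / a - w₂ τ) * ∫ θ in (0 : ℝ)..2 * Real.pi, 1 / (w₂ τ + Real.cos θ)) with hY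
  have hXl := tendsto_pole_contribution (m := m) (e := 1) ha.ne' hr₀ (by norm_num)
    (by simpa using hm0) hρlim hρne (w := w₁) (fun _ => rfl)
    (by filter_upwards [hunit] with τ hτ using hoff₁ τ hτ.1 hτ.2)
  have hYl := tendsto_pole_contribution (m := n) (e := -1) ha.ne' hr₀ (by norm_num)
    (by simpa using hp0) hρlim hρne (w := w₂) (fun _ => rfl)
    (by filter_upwards [hunit] with τ hτ using hoff₂ τ hτ.1 hτ.2)
  have hpole : ∀ (k : ℕ) (s w : ℂ) (τ : ℝ), 0 < τ → (k ≠ 0 → ∀ t : ℝ, |t| ≤ 1 → w ≠ t) →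
      w = (ρ τ ^ 2 + a ^ 2 - s) / (2 * ρ τ * a) →
      (k : ℂ) * ((ρ τ / a - w) * ∫ θ in (0 : ℝ)..2 * Real.pi, 1 / (w + Real.cos θ))
        = ρ τ * (∫ θ in (0 : ℝ)..2 * Real.pi, (k : ℂ) *
          (1 / (ρ τ ^ 2 + a ^ 2 + 2 * ρ τ * a * Real.cos θ - s) * (2 * ρ τ + 2 * a * Real.cos θ)))
          - 2 * Real.pi * k := by
    intro k s w τ hτ hk hws
    rcases Nat.eq_zero_or_pos k with rfl | hkpos
    · simp
    have h0 := hρ0 τ hτ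
    rw [intervalIntegral.integral_const_mul, integral_pole_segment ha.ne' h0 (hk hkpos.ne') (w := w)
      (by rw [hws]; field_simp)]
    field_simp
    ring
  have hsum : ∀ τ : ℝ, 0 < τ → τ < 1 → X τ + Y τ
      = ρ τ * (lam * ρ τ - segmentIntegral Q₂ a (ρ τ)) - 2 * Real.pi * (m + n) ∨ ρ τ ∉ ball r₀ δ := by
    intro τ h0 h1
    by_cases hτδ : ρ τ ∈ ball r₀ δ
    swap
    · exact Or.inr hτδ
    left
    have hXe : X τ = _ := hpole m ((r₀ - a) ^ 2) (w₁ τ) τ h0 (hoff₁ τ h0 h1) (by simp only [hw₁, one_mul])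
    have hYe : Y τ = _ := hpole n ((r₀ + a) ^ 2) (w₂ τ) τ h0 (hoff₂ τ h0 h1)
      (by simp only [hw₂, neg_mul, one_mul, sub_neg_eq_add])
    have hlin := segmentIntegral_eq_linear hQ ha hmean hε hM hz (hW1 τ h0 h1) (hW2 τ h0 h1)
    rw [hXe, hYe, ← hlin]
    have hQs : ∀ θ : ℝ, Q (ρ τ ^ 2 + a ^ 2 + 2 * ρ τ * a * Real.cos θ) ≠ 0 := fun θ =>
      ne_zero_on_segment hε hz (hW1 τ h0 h1) (hW2 τ h0 h1) (Real.abs_cos_le_one θ)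
    have hcontpole : ∀ (k : ℕ) (s : ℂ), (k ≠ 0 → Q s = 0) → IntervalIntegrable (fun θ : ℝ => (k : ℂ) *
          (1 / (ρ τ ^ 2 + a ^ 2 + 2 * ρ τ * a * Real.cos θ - s) * (2 * ρ τ + 2 * a * Real.cos θ)))
          volume 0 (2 * Real.pi) := by
      intro k s hs
      rcases Nat.eq_zero_or_pos k with rfl | hk
      · simp
      apply Continuous.intervalIntegrable
      refine continuous_const.mul (Continuous.mul (continuous_const.div (by fun_prop) ?_) (by fun_prop))
      intro θ h
      apply hQs θ
      rw [sub_eq_zero.1 h]; exact hs hk.ne'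
    have hcQ₂ := hQ₂.continuous
    have hdQ₂ : Continuous (deriv Q₂) := by
      have : Differentiable ℂ (deriv Q₂) := by
        have h := hQ₂
        rw [← differentiableOn_univ] at h ⊢
        exact h.deriv isOpen_univ
      exact this.continuous
    have hcontreg : IntervalIntegrable (fun θ : ℝ =>
        deriv Q₂ (ρ τ ^ 2 + a ^ 2 + 2 * ρ τ * a * Real.cos θ) /
          Q₂ (ρ τ ^ 2 + a ^ 2 + 2 * ρ τ * a * Real.cos θ) * (2 * ρ τ + 2 * a * Real.cos θ))
          volume 0 (2 * Real.pi) := by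
      apply Continuous.intervalIntegrable
      refine Continuous.mul (Continuous.div (by fun_prop) (by fun_prop) ?_) (by fun_prop)
      intro θ
      exact hball _ hτδ _ (Real.abs_cos_le_one θ)
    have hdecomp : segmentIntegral Q a (ρ τ) =
        (∫ θ in (0 : ℝ)..2 * Real.pi, (m : ℂ) *
          (1 / (ρ τ ^ 2 + a ^ 2 + 2 * ρ τ * a * Real.cos θ - (r₀ - a) ^ 2) * (2 * ρ τ + 2 * a * Real.cos θ)))
        + (∫ θ in (0 : ℝ)..2 * Real.pi, (n : ℂ) *
          (1 / (ρ τ ^ 2 + a ^ 2 + 2 * ρ τ * a * Real.cos θ - (r₀ + a) ^ 2) * (2 * ρ τ + 2 * a * Real.cos θ)))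
        + segmentIntegral Q₂ a (ρ τ) := by
      rw [segmentIntegral, segmentIntegral, ← intervalIntegral.integral_add (hcontpole m _ hQm)
        (hcontpole n _ hQp), ← intervalIntegral.integral_add
        ((hcontpole m _ hQm).add (hcontpole n _ hQp)) hcontreg]
      apply intervalIntegral.integral_congr
      intro θ _
      simp only
      have hQθ := hQs θ
      generalize ρ τ ^ 2 + a ^ 2 + 2 * ρ τ * a * (Real.cos θ : ℂ) = s at hQθ
      have hld : logDeriv Q s = m * logDeriv (fun s => s - (r₀ - a) ^ 2) s
          + (n * logDeriv (fun s => s - (r₀ + a) ^ 2) s + logDeriv Q₂ s) := by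
        have hQf : Q = fun s => (s - (r₀ - a) ^ 2) ^ m * ((s - (r₀ + a) ^ 2) ^ n * Q₂ s) := funext hfac
        rw [hfac] at hQθ
        have h1 := left_ne_zero_of_mul hQθ
        have h23 := right_ne_zero_of_mul hQθ
        have h2 := left_ne_zero_of_mul h23
        have h3 := right_ne_zero_of_mul h23
        have d1 : DifferentiableAt ℂ (fun s => (s - (r₀ - a) ^ 2) ^ m) s := by fun_prop
        have d2 : DifferentiableAt ℂ (fun s => (s - (r₀ + a) ^ 2) ^ n) s := by fun_prop
        have e1 := logDeriv_mul s h1 h23 d1 (d2.mul (hQ₂ s))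
        have e2 := logDeriv_mul s h2 h3 d2 (hQ₂ s)
        have e3 := logDeriv_fun_pow (f := fun s : ℂ => s - (r₀ - a) ^ 2) (x := s) (by fun_prop) m
        have e4 := logDeriv_fun_pow (f := fun s : ℂ => s - (r₀ + a) ^ 2) (x := s) (by fun_prop) n
        rw [hQf, ← e3, ← e4, ← e2]
        exact e1
      simp only [logDeriv_apply, deriv_sub_const, deriv_id''] at hld
      rw [hld]
      ring
    rw [hdecomp]
    ring
  -- Each of `X` and `Y` may diverge, but their sum is a linear segment integral minus a regular
  -- part, hence bounded near `r₀`.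
  obtain ⟨C, hC⟩ : ∃ C : ℝ, ∀ᶠ τ in l, ‖X τ + Y τ‖ ≤ C := by
    have hlim : Tendsto (fun τ => ρ τ * (lam * ρ τ - segmentIntegral Q₂ a (ρ τ)) - 2 * Real.pi * (m + n)) l
        (𝓝 (r₀ * (lam * r₀ - segmentIntegral Q₂ a r₀) - 2 * Real.pi * (m + n))) :=
      (hρlim.mul ((hρlim.const_mul _).sub (hBc.tendsto.comp hρlim))).sub_const _
    refine ⟨‖r₀ * (lam * r₀ - segmentIntegral Q₂ a r₀) - 2 * Real.pi * (m + n)‖ + 1, ?_⟩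
    filter_upwards [hunit, hρlim.eventually (ball_mem_nhds r₀ hδ),
      hlim.norm.eventually (gt_mem_nhds (lt_add_one _))] with τ hτ hb hle
    rcases hsum τ hτ.1 hτ.2 with h | h
    · rw [h]; exact hle.le
    · exact absurd hb h
  have hδ0 : Tendsto (fun τ => ρ τ - r₀) l (𝓝 0) := by
    simpa using hρlim.sub_const r₀
  have heq := eq_of_tendsto_mul_sq hδ0 hC hXl hYl
  -- The opposite signs `e = ±1` in the two limits put both multiplicities on the same side. Since
  -- `r₀ - a` and `r₀ + a` share the positive imaginary part of `r₀`, the two terms cannot cancel.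
  have hfin : (m : ℂ) ^ 2 * (r₀ - a) + n ^ 2 * (r₀ + a) = 0 := by
    have hK : (2 * Real.pi ^ 2 * r₀ / a : ℂ) ≠ 0 := by
      have : (Real.pi : ℂ) ≠ 0 := by exact_mod_cast Real.pi_ne_zero
      simp [this, hr₀, ha']
    apply mul_left_cancel₀ hK
    rw [mul_zero]
    linear_combination heq
  have himz : ((m : ℝ) ^ 2 + n ^ 2) * r₀.im = 0 := by
    have h := congrArg Complex.im hfin
    rw [show (m : ℂ) ^ 2 = ((m ^ 2 : ℝ) : ℂ) by push_cast; ring,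
      show (n : ℂ) ^ 2 = ((n ^ 2 : ℝ) : ℂ) by push_cast; ring] at h
    rw [add_im, im_ofReal_mul, im_ofReal_mul] at h
    simp only [sub_im, add_im, ofReal_im, sub_zero, add_zero, zero_im] at h
    linarith
  have hmn : (m : ℝ) ^ 2 + n ^ 2 = 0 := (mul_eq_zero.1 himz).resolve_right him.ne'
  have hm : m = 0 := by
    have : (m : ℝ) = 0 := by nlinarith [sq_nonneg (m : ℝ), sq_nonneg (n : ℝ)]
    exact_mod_cast this
  have hn : n = 0 := by
    have : (n : ℝ) = 0 := by nlinarith [sq_nonneg (m : ℝ), sq_nonneg (n : ℝ)]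
    exact_mod_cast this
  subst hm hn
  constructor <;> rw [hfac]
  · simpa using hQ₂0'
  · simpa using hQ₂0

/-- For `ε > 0` the norm has compact sublevel sets, so the minimum over a closed set is attained;
`|Im|` alone has unbounded ones. -/
lemma exists_tiltedNorm_minimal_zero {Q : ℂ → ℂ} (hQ : Continuous Q) {ε : ℝ} (hε : 0 < ε)
    {z : ℂ} (hz : Q (z ^ 2) = 0) :
    ∃ z₀, Q (z₀ ^ 2) = 0 ∧ ∀ z, Q (z ^ 2) = 0 → tiltedNorm ε z₀ ≤ tiltedNorm ε z := by
  set K : Set ℂ := {w | Q (w ^ 2) = 0} ∩ {w | tiltedNorm ε w ≤ tiltedNorm ε z} with hK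
  have hcl : IsClosed K :=
    (isClosed_eq (by fun_prop) continuous_const).inter
      (isClosed_le (continuous_tiltedNorm ε) continuous_const)
  have hbd : Bornology.IsBounded K := by
    refine (isBounded_iff_forall_norm_le).2 ⟨(1 + 1 / ε) * tiltedNorm ε z, ?_⟩
    rintro w ⟨-, hw⟩
    have hw : tiltedNorm ε w ≤ tiltedNorm ε z := hw
    have h1 : |w.im| ≤ tiltedNorm ε z := by
      refine le_trans ?_ hw
      unfold tiltedNorm
      have := mul_nonneg hε.le (abs_nonneg w.re)
      linarith
    have h2 : |w.re| ≤ 1 / ε * tiltedNorm ε z := by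
      rw [one_div, ← div_eq_inv_mul, le_div_iff₀ hε]
      refine le_trans ?_ hw
      unfold tiltedNorm
      have := abs_nonneg w.im
      linarith
    have := Complex.norm_le_abs_re_add_abs_im w
    linarith
  obtain ⟨z₀, hz₀, hmin⟩ := (Metric.isCompact_of_isClosed_isBounded hcl hbd).exists_isMinOn
    ⟨z, hz, le_refl (tiltedNorm ε z)⟩ (continuous_tiltedNorm ε).continuousOn
  refine ⟨z₀, hz₀.1, fun w hw => ?_⟩
  by_cases h : tiltedNorm ε w ≤ tiltedNorm ε z
  · exact hmin ⟨hw, h⟩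
  · exact hz₀.2.trans (not_le.1 h).le

/-- An entire function whose segment integrals are linear on the real line has no zeros, provided
it has none on the half line `[0, ∞)`. -/
lemma ne_zero_of_segmentIntegral_linear {Q : ℂ → ℂ} (hQ : Differentiable ℂ Q) {a lam : ℝ} (ha : 0 < a)
    (hmean : ∀ r : ℝ, segmentIntegral Q a r = lam * r) (hpos : ∀ x : ℝ, 0 ≤ x → Q x ≠ 0) (s : ℂ) :
    Q s ≠ 0 := by
  have hQ0 : ∃ z, Q z ≠ 0 := ⟨((0 : ℝ) : ℂ), hpos 0 le_rfl⟩
  have himne : ∀ z, Q (z ^ 2) = 0 → z.im ≠ 0 := by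
    intro z hz h
    apply hpos (z.re ^ 2) (sq_nonneg _)
    rw [← hz]
    congr 1
    apply Complex.ext <;> simp [pow_two, h]
  intro hs
  obtain ⟨zs, rfl⟩ := IsAlgClosed.exists_pow_nat_eq s (n := 2) (by norm_num)
  -- If `|Re z| ≥ a` at a minimal root `z`, step by `2a` towards the imaginary axis: the norm does
  -- not grow, so `z` and the new point bound an admissible segment with a zero at one end.
  have claim : ∀ ε : ℝ, 0 < ε → ∃ z, Q (z ^ 2) = 0 ∧ |z.re| < a ∧
      ∀ w, Q (w ^ 2) = 0 → tiltedNorm ε z ≤ tiltedNorm ε w := by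
    intro ε hε
    obtain ⟨z', hz', hmin'⟩ := exists_tiltedNorm_minimal_zero hQ.continuous hε hs
    obtain ⟨z, hz, hmin, him⟩ : ∃ z, Q (z ^ 2) = 0 ∧
        (∀ w, Q (w ^ 2) = 0 → tiltedNorm ε z ≤ tiltedNorm ε w) ∧ 0 < z.im := by
      rcases lt_or_gt_of_ne (himne z' hz') with h | h
      · exact ⟨-z', by simpa using hz', by simpa [tiltedNorm_neg] using hmin', by simpa using h⟩
      · exact ⟨z', hz', hmin', h⟩
    refine ⟨z, hz, ?_, hmin⟩
    by_contra hcon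
    push Not at hcon
    have hM0 : 0 < tiltedNorm ε z := by
      unfold tiltedNorm
      have := abs_pos.2 him.ne'
      have := mul_nonneg hε.le (abs_nonneg z.re)
      linarith
    have hM : ε * a < tiltedNorm ε z := by
      unfold tiltedNorm
      have := abs_pos.2 him.ne'
      have := mul_le_mul_of_nonneg_left hcon hε.le
      linarith
    rcases le_abs'.1 hcon with h | h
    · have := (ne_zero_at_endpoints hQ ha hmean hε.le hM0 hM hQ0 hmin (r₀ := z + a) (by simpa using him)
        (by simp) (by
          simp only [tiltedNorm, add_im, ofReal_im, add_zero, add_re, ofReal_re]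
          gcongr ?_ + ε * ?_
          · exact le_rfl
          · rw [abs_of_nonpos (by linarith : z.re ≤ 0), abs_le]
            constructor <;> linarith)).1
      apply this
      rw [← hz]; congr 1; ring
    · have := (ne_zero_at_endpoints hQ ha hmean hε.le hM0 hM hQ0 hmin (r₀ := z - a) (by simpa using him)
        (by
          simp only [tiltedNorm, sub_im, ofReal_im, sub_zero, sub_re, ofReal_re]
          gcongr ?_ + ε * ?_
          · exact le_rfl
          · rw [abs_of_nonneg (by linarith : 0 ≤ z.re), abs_le]
            constructor <;> linarith) (by simp)).2
      apply this
      rw [← hz]; congr 1; ring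
  have hεpos : ∀ n : ℕ, (0 : ℝ) < 1 / ((n : ℝ) + 1) := fun n => by positivity
  have hεle : ∀ n : ℕ, 1 / ((n : ℝ) + 1) ≤ 1 := fun n => by
    rw [div_le_one (by positivity)]
    have : (0:ℝ) ≤ n := n.cast_nonneg
    linarith
  choose ζ hζ hζre hζmin using fun n : ℕ => claim _ (hεpos n)
  -- The bound `|Re| < a` keeps the minimal roots in a fixed ball as `ε → 0`; a limit point
  -- minimizes `|Im|`.
  obtain ⟨z₀, -, φ, hφ, hlim⟩ := tendsto_subseq_of_bounded (x := ζ)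
    (s := closedBall 0 (a + tiltedNorm 1 zs)) isBounded_closedBall (by
      intro n
      rw [mem_closedBall_zero_iff]
      have h1 := hζmin n zs hs
      have h2 : tiltedNorm (1 / ((n : ℝ) + 1)) zs ≤ tiltedNorm 1 zs := by
        unfold tiltedNorm
        have := mul_le_mul_of_nonneg_right (hεle n) (abs_nonneg zs.re)
        linarith
      have h3 : |(ζ n).im| ≤ tiltedNorm (1 / ((n : ℝ) + 1)) (ζ n) := by
        unfold tiltedNorm
        have := mul_nonneg (hεpos n).le (abs_nonneg (ζ n).re)
        linarith
      have := Complex.norm_le_abs_re_add_abs_im (ζ n)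
      have := hζre n
      linarith)
  have hz₀ : Q (z₀ ^ 2) = 0 := by
    have hc : Continuous fun z => Q (z ^ 2) := by have := hQ.continuous; fun_prop
    have := (hc.tendsto z₀).comp hlim
    exact (tendsto_nhds_unique this (tendsto_const_nhds.congr fun n => (hζ (φ n)).symm))
  have hmin : ∀ w, Q (w ^ 2) = 0 → |z₀.im| ≤ |w.im| := by
    intro w hw
    have hl : Tendsto (fun n => |(ζ (φ n)).im|) atTop (𝓝 |z₀.im|) :=
      ((Complex.continuous_im.abs).tendsto z₀).comp hlim
    have hr : Tendsto (fun n => tiltedNorm (1 / (((φ n : ℕ) : ℝ) + 1)) w) atTop (𝓝 |w.im|) := by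
      have h1 := (tendsto_one_div_add_atTop_nhds_zero_nat (𝕜 := ℝ)).comp hφ.tendsto_atTop
      have h2 := (h1.mul_const |w.re|).const_add |w.im|
      simpa [tiltedNorm] using h2
    refine le_of_tendsto_of_tendsto' hl hr fun n => ?_
    refine le_trans ?_ (hζmin (φ n) w hw)
    unfold tiltedNorm
    have := mul_nonneg (hεpos (φ n)).le (abs_nonneg (ζ (φ n)).re)
    linarith
  obtain ⟨z, hz, hmin, him⟩ : ∃ z, Q (z ^ 2) = 0 ∧ (∀ w, Q (w ^ 2) = 0 → |z.im| ≤ |w.im|) ∧ 0 < z.im := by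
    rcases lt_or_gt_of_ne (himne z₀ hz₀) with h | h
    · exact ⟨-z₀, by simpa using hz₀, by simpa using hmin, by simpa using h⟩
    · exact ⟨z₀, hz₀, hmin, h⟩
  -- With `ε = 0` horizontal translation preserves the norm, so `z` and `z + 2a` are admissible ends
  -- whatever the real part of `z`.
  have := (ne_zero_at_endpoints (ε := 0) (M := |z.im|) hQ ha hmean le_rfl (abs_pos.2 him.ne')
    (by simpa using him.ne') hQ0
    (by simpa [tiltedNorm] using hmin) (r₀ := z + a) (by simpa using him)
    (by simp [tiltedNorm]) (by simp [tiltedNorm])).1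
  apply this
  rw [← hz]; congr 1; ring

/-! ### From circle means to the exponential of an affine function. -/

lemma deriv_im_eq_zero {Q : ℂ → ℂ} (hQ : Differentiable ℂ Q) (hreal : ∀ x : ℝ, 0 ≤ x → (Q x).im = 0)
    {x : ℝ} (hx : 0 ≤ x) : (deriv Q x).im = 0 := by
  have h1 : HasDerivAt (fun y : ℝ => (Q y).im) (deriv Q x).im x := by
    have h := ((hQ x).hasDerivAt.comp_ofReal)
    exact (Complex.imCLM.hasFDerivAt.comp_hasDerivAt x h)
  -- Reality is known on `[0, ∞)` only, so `x = 0` requires a one-sided derivative.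
  have h2 : HasDerivWithinAt (fun y : ℝ => (Q y).im) 0 (Set.Ici x) x := by
    refine (hasDerivWithinAt_const x (Set.Ici x) (0 : ℝ)).congr (fun y hy => hreal y (hx.trans hy)) (hreal x hx)
  exact (uniqueDiffWithinAt_Ici x).eq_deriv _ h1.hasDerivWithinAt h2

/-- An entire function of exponential type, positive on `[0, ∞)`, whose logarithm has quadratic means
along all circles of a given radius `a > 0`, is the exponential of an affine function. -/
theorem exists_eq_exp_affine_of_circle_means {Q : ℂ → ℂ} (hQ : Differentiable ℂ Q) {a C A B : ℝ}
    (ha : 0 < a) (hC : ∀ s, ‖Q s‖ ≤ C * Real.exp ‖s‖) (hreal : ∀ x : ℝ, 0 ≤ x → (Q x).im = 0)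
    (hpos : ∀ x : ℝ, 0 ≤ x → 0 < (Q x).re)
    (hmean : ∀ r : ℝ, ∫ θ in (0 : ℝ)..2 * Real.pi,
      Real.log (Q ((r ^ 2 + a ^ 2 + 2 * r * a * Real.cos θ : ℝ) : ℂ)).re = A * r ^ 2 + B) :
    ∃ α β : ℂ, ∀ s, Q s = exp (α + β * s) := by
  have hs0 : ∀ r θ : ℝ, 0 ≤ r ^ 2 + a ^ 2 + 2 * r * a * Real.cos θ := by
    intro r θ
    nlinarith [sq_nonneg (r + a * Real.cos θ), Real.sin_sq_add_cos_sq θ, sq_nonneg (a * Real.sin θ)]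
  have hdd : Continuous (deriv Q) := by
    have : Differentiable ℂ (deriv Q) := by
      have h := hQ
      rw [← differentiableOn_univ] at h ⊢
      exact h.deriv isOpen_univ
    exact this.continuous
  have hQc := hQ.continuous
  -- Differentiating in `r` removes `B` and replaces `log Q` by `Q'/Q`, which needs no branch and
  -- continues to complex `r`.
  have hlin : ∀ r : ℝ, segmentIntegral Q a r = ((2 * A : ℝ) : ℂ) * r := by
    intro r
    set F' : ℝ → ℝ → ℝ := fun r θ =>
      (2 * r + 2 * a * Real.cos θ) * (deriv Q ((r ^ 2 + a ^ 2 + 2 * r * a * Real.cos θ : ℝ) : ℂ)).re /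
        (Q ((r ^ 2 + a ^ 2 + 2 * r * a * Real.cos θ : ℝ) : ℂ)).re with hF'
    have hcF' : Continuous (Function.uncurry F') := by
      simp only [hF', Function.uncurry_def]
      refine Continuous.div (by fun_prop) (by fun_prop) fun p => (hpos _ (hs0 p.1 p.2)).ne'
    obtain ⟨K, hK⟩ := ((isCompact_Icc (a := r - 1) (b := r + 1)).prod
      (isCompact_Icc (a := (0:ℝ)) (b := 2 * Real.pi))).exists_bound_of_continuousOn hcF'.continuousOn
    have hlogc : ∀ r : ℝ, Continuous fun θ : ℝ =>
        Real.log (Q ((r ^ 2 + a ^ 2 + 2 * r * a * Real.cos θ : ℝ) : ℂ)).re := by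
      intro r
      refine Continuous.log (by fun_prop) fun θ => (hpos _ (hs0 r θ)).ne'
    have hder := (intervalIntegral.hasDerivAt_integral_of_dominated_loc_of_deriv_le
      (μ := volume) (a := 0) (b := 2 * Real.pi)
      (F := fun (r : ℝ) (θ : ℝ) => Real.log (Q ((r ^ 2 + a ^ 2 + 2 * r * a * Real.cos θ : ℝ) : ℂ)).re)
      (F' := F') (x₀ := r) (s := Set.Icc (r - 1) (r + 1)) (bound := fun _ => K)
      (Icc_mem_nhds (by linarith) (by linarith))
      (.of_forall fun r => (hlogc r).aestronglyMeasurable) ((hlogc r).intervalIntegrable _ _)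
      (Continuous.aestronglyMeasurable (hcF'.comp (by fun_prop : Continuous fun θ : ℝ => (r, θ))))
      (.of_forall fun θ hθ x hx => hK (x, θ) ⟨hx, by
        rw [Set.uIoc_of_le (by positivity)] at hθ
        exact ⟨hθ.1.le, hθ.2⟩⟩)
      (by simp) (.of_forall fun θ hθ x hx => by
        have h1 : HasDerivAt (fun x : ℝ => x ^ 2 + a ^ 2 + 2 * x * a * Real.cos θ)
            (2 * x + 2 * a * Real.cos θ) x := by
          have := (((hasDerivAt_id x).pow 2).add_const (a ^ 2)).add
            ((((hasDerivAt_id x).const_mul 2).mul_const a).mul_const (Real.cos θ))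
          refine this.congr_deriv ?_
          simp
        have h2 := ((hQ _).hasDerivAt (x := ((x ^ 2 + a ^ 2 + 2 * x * a * Real.cos θ : ℝ) : ℂ))).real_of_complex
        have h4 : HasDerivAt (fun x : ℝ => (Q ((x ^ 2 + a ^ 2 + 2 * x * a * Real.cos θ : ℝ) : ℂ)).re)
            ((deriv Q ((x ^ 2 + a ^ 2 + 2 * x * a * Real.cos θ : ℝ) : ℂ)).re * (2 * x + 2 * a * Real.cos θ)) x :=
          HasDerivAt.comp (h₂ := fun y : ℝ => (Q y).re) x h2 h1
        refine (h4.log (hpos _ (hs0 x θ)).ne').congr_deriv ?_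
        simp only [hF']
        ring)).2
    have hder2 : HasDerivAt (fun r : ℝ => A * r ^ 2 + B) (2 * A * r) r := by
      have := (((hasDerivAt_id r).pow 2).const_mul A).add_const B
      refine this.congr_deriv ?_
      simp; ring
    have heq : ∫ θ in (0 : ℝ)..2 * Real.pi, F' r θ = 2 * A * r := by
      refine hder.unique (hder2.congr_of_eventuallyEq (.of_forall fun r => ?_))
      exact hmean r
    rw [segmentIntegral]
    have : (∫ θ in (0 : ℝ)..2 * Real.pi, ((F' r θ : ℝ) : ℂ)) = ((2 * A : ℝ) : ℂ) * r := by
      rw [intervalIntegral.integral_ofReal, heq]; push_cast; ring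
    rw [← this]
    apply intervalIntegral.integral_congr
    intro θ _
    have e : ((r : ℂ) ^ 2 + a ^ 2 + 2 * r * a * Real.cos θ)
        = ((r ^ 2 + a ^ 2 + 2 * r * a * Real.cos θ : ℝ) : ℂ) := by push_cast; ring
    simp only [e, hF']
    have e1 : Q ((r ^ 2 + a ^ 2 + 2 * r * a * Real.cos θ : ℝ) : ℂ)
        = ((Q ((r ^ 2 + a ^ 2 + 2 * r * a * Real.cos θ : ℝ) : ℂ)).re : ℂ) := by
      apply Complex.ext <;> simp only [ofReal_re, ofReal_im, hreal _ (hs0 r θ)]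
    have e2 : deriv Q ((r ^ 2 + a ^ 2 + 2 * r * a * Real.cos θ : ℝ) : ℂ)
        = ((deriv Q ((r ^ 2 + a ^ 2 + 2 * r * a * Real.cos θ : ℝ) : ℂ)).re : ℂ) := by
      apply Complex.ext <;> simp only [ofReal_re, ofReal_im, deriv_im_eq_zero hQ hreal (hs0 r θ)]
    rw [ofReal_div, ofReal_mul, ← e1, ← e2]
    push_cast
    ring
  refine exists_eq_exp_affine hQ (ne_zero_of_segmentIntegral_linear hQ ha hlin fun x hx h => ?_) hC
  have := hpos x hx
  rw [h] at this
  simp at this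

end

/-! ### Densities of the noise and of the channel output. -/

section

open Filter Topology

/-- The density of `complexGaussian`. -/
def gaussDensity (w : ℂ) : ℝ := Real.pi⁻¹ * Real.exp (-‖w‖ ^ 2)

/-- The uniform distribution on the circle of radius `a`. -/
def ringLaw (a : ℝ) : Measure ℂ :=
  uniformPhase.map (fun θ : ℝ => (a : ℂ) * Complex.exp ((θ : ℂ) * Complex.I))

/-- The law of the sum of a point on the circle of radius `a` and a Gaussian variable. -/
def noise (a : ℝ) : Measure ℂ := ringLaw a ∗ complexGaussian

instance : IsProbabilityMeasure uniformPhase := by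
  unfold uniformPhase
  refine cond_isProbabilityMeasure_of_finite ?_ ?_
  · simp [Real.pi_pos]
  · simpa using ENNReal.mul_ne_top (by simp) (by simp)

instance (a : ℝ) : IsProbabilityMeasure (ringLaw a) :=
  Measure.isProbabilityMeasure_map (by fun_prop)

instance : IsProbabilityMeasure complexGaussian :=
  Measure.isProbabilityMeasure_map (by fun_prop)

instance (a : ℝ) : IsProbabilityMeasure (noise a) := by
  unfold noise; infer_instance

lemma noiseLaw_eq (inr : ℝ) : noiseLaw inr = noise (Real.sqrt inr) := by
  unfold noiseLaw noise ringLaw Measure.conv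
  have h : Measurable (fun θ : ℝ => (Real.sqrt inr : ℂ) * Complex.exp ((θ : ℂ) * Complex.I)) := by
    fun_prop
  have e := Measure.map_prod_map uniformPhase complexGaussian h measurable_id
  rw [Measure.map_id] at e
  rw [e, Measure.map_map (by fun_prop) (by fun_prop)]
  rfl

lemma integral_uniformPhase (g : ℝ → ℝ) :
    ∫ θ, g θ ∂uniformPhase = (2 * Real.pi)⁻¹ * ∫ θ in (0 : ℝ)..2 * Real.pi, g θ := by
  unfold uniformPhase ProbabilityTheory.cond
  rw [integral_smul_measure, integral_Icc_eq_integral_Ioc,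
    intervalIntegral.integral_of_le (by positivity)]
  simp [ENNReal.toReal_ofReal, Real.pi_pos.le]

lemma continuous_gaussDensity : Continuous gaussDensity := by
  unfold gaussDensity; fun_prop

lemma gaussDensity_pos (w : ℂ) : 0 < gaussDensity w := by
  unfold gaussDensity; positivity

lemma gaussDensity_le (w : ℂ) : gaussDensity w ≤ Real.pi⁻¹ := by
  unfold gaussDensity
  have : Real.exp (-‖w‖ ^ 2) ≤ 1 := Real.exp_le_one_iff.2 (by simp)
  have : 0 < Real.pi⁻¹ := by positivity
  nlinarith

lemma complexGaussian_eq :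
    complexGaussian = volume.withDensity (fun w => ENNReal.ofReal (gaussDensity w)) := by
  unfold complexGaussian
  rw [gaussianReal_of_var_ne_zero 0 (by norm_num), prod_withDensity (by fun_prop) (by fun_prop)]
  have hmap := Complex.volume_preserving_equiv_real_prod.symm
  refine Measure.ext_of_lintegral _ fun φ hφ => ?_
  rw [lintegral_map hφ (by fun_prop), lintegral_withDensity_eq_lintegral_mul _ (by fun_prop) (by fun_prop),
    lintegral_withDensity_eq_lintegral_mul _
      (by have := continuous_gaussDensity.measurable; fun_prop) hφ,
    ← hmap.lintegral_comp_emb Complex.measurableEquivRealProd.symm.measurableEmbedding]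
  refine lintegral_congr fun p => ?_
  have e : Complex.measurableEquivRealProd.symm p = (p.1 : ℂ) + (p.2 : ℂ) * Complex.I := by
    apply Complex.ext <;> simp
  rw [e]
  simp only [Pi.mul_apply]
  congr 1
  rw [gaussianPDF, gaussianPDF, ← ENNReal.ofReal_mul (gaussianPDFReal_nonneg _ _ _)]
  congr 1
  simp only [gaussianPDFReal, gaussDensity]
  have e2 : ‖(p.1 : ℂ) + (p.2 : ℂ) * Complex.I‖ ^ 2 = p.1 ^ 2 + p.2 ^ 2 := by
    rw [Complex.sq_norm, Complex.normSq_apply]; simp; ring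
  rw [e2]
  have e3 : (2 * Real.pi * ((1 / 2 : ℝ≥0) : ℝ)) = Real.pi := by push_cast; ring
  rw [e3]
  have e4 : (√Real.pi)⁻¹ * (√Real.pi)⁻¹ = Real.pi⁻¹ := by
    rw [← mul_inv, Real.mul_self_sqrt Real.pi_pos.le]
  calc _ = ((√Real.pi)⁻¹ * (√Real.pi)⁻¹) * (Real.exp (-(p.1 - 0) ^ 2 / (2 * ((1 / 2 : ℝ≥0) : ℝ))) *
        Real.exp (-(p.2 - 0) ^ 2 / (2 * ((1 / 2 : ℝ≥0) : ℝ)))) := by ring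
    _ = _ := by
      rw [e4, ← Real.exp_add]
      congr 2
      push_cast
      ring

/-- Convolving a finite measure with a bounded continuous function. -/
def smoothed (ν : Measure ℂ) (g : ℂ → ℝ) (y : ℂ) : ℝ := ∫ u, g (y - u) ∂ν

section smoothed

variable {ν : Measure ℂ} [IsProbabilityMeasure ν] {g : ℂ → ℝ}

lemma integrable_smoothed (hc : Continuous g) {K : ℝ} (h0 : ∀ w, 0 ≤ g w) (hK : ∀ w, g w ≤ K) (y : ℂ) :
    Integrable (fun u => g (y - u)) ν := by
  refine (integrable_const K).mono' (by fun_prop : Continuous fun u => g (y - u)).aestronglyMeasurable ?_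
  exact .of_forall fun u => by rw [Real.norm_of_nonneg (h0 _)]; exact hK _

lemma continuous_smoothed (hc : Continuous g) {K : ℝ} (h0 : ∀ w, 0 ≤ g w) (hK : ∀ w, g w ≤ K) :
    Continuous (smoothed ν g) := by
  unfold smoothed
  refine continuous_of_dominated (bound := fun _ => K)
    (fun y => (by fun_prop : Continuous fun u => g (y - u)).aestronglyMeasurable) ?_
    (integrable_const K) ?_
  · exact fun y => .of_forall fun u => by rw [Real.norm_of_nonneg (h0 _)]; exact hK _
  · exact .of_forall fun u => by fun_prop

lemma smoothed_pos (hc : Continuous g) {K : ℝ} (h0 : ∀ w, 0 < g w) (hK : ∀ w, g w ≤ K) (y : ℂ) :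
    0 < smoothed ν g y := by
  unfold smoothed
  rw [integral_pos_iff_support_of_nonneg (fun u => (h0 _).le)
    (integrable_smoothed hc (fun w => (h0 w).le) hK y)]
  have : (Function.support fun u => g (y - u)) = Set.univ := by
    ext u; simp [(h0 (y - u)).ne']
  rw [this]; simp

lemma smoothed_le (hc : Continuous g) {K : ℝ} (h0 : ∀ w, 0 ≤ g w) (hK : ∀ w, g w ≤ K) (y : ℂ) :
    smoothed ν g y ≤ K := by
  unfold smoothed
  calc _ ≤ ∫ _, K ∂ν := integral_mono (integrable_smoothed hc h0 hK y) (integrable_const K) fun u => hK _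
    _ = K := by simp

lemma conv_withDensity (hc : Continuous g) {K : ℝ} (h0 : ∀ w, 0 ≤ g w) (hK : ∀ w, g w ≤ K) :
    ν ∗ (volume.withDensity fun w => ENNReal.ofReal (g w))
      = volume.withDensity fun y => ENNReal.ofReal (smoothed ν g y) := by
  have hm : Measurable g := hc.measurable
  have hms : Measurable (smoothed ν g) := (continuous_smoothed hc h0 hK).measurable
  refine Measure.ext_of_lintegral _ fun φ hφ => ?_
  rw [Measure.lintegral_conv hφ, lintegral_withDensity_eq_lintegral_mul _ (by fun_prop) hφ]
  have e1 : ∀ x, ∫⁻ w, φ (x + w) ∂(volume.withDensity fun w => ENNReal.ofReal (g w))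
      = ∫⁻ y, ENNReal.ofReal (g (y - x)) * φ y := by
    intro x
    rw [lintegral_withDensity_eq_lintegral_mul _ (by fun_prop) (by fun_prop)]
    rw [← lintegral_add_right_eq_self (fun y => ENNReal.ofReal (g (y - x)) * φ y) x]
    simp [add_comm]
  simp_rw [e1]
  rw [lintegral_lintegral_swap (by fun_prop)]
  refine lintegral_congr fun y => ?_
  rw [lintegral_mul_const _ (by fun_prop), Pi.mul_apply, smoothed,
    ofReal_integral_eq_lintegral_ofReal (integrable_smoothed hc h0 hK y) (.of_forall fun u => h0 _)]

end smoothed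

/-- The density of the noise. -/
def noiseDensity (a : ℝ) : ℂ → ℝ := smoothed (ringLaw a) gaussDensity

/-- The density of the channel output for the input law `μ`. -/
def outDensity (a : ℝ) (μ : Measure ℂ) : ℂ → ℝ := smoothed μ (noiseDensity a)

lemma continuous_noiseDensity (a : ℝ) : Continuous (noiseDensity a) :=
  continuous_smoothed continuous_gaussDensity (fun w => (gaussDensity_pos w).le) gaussDensity_le

lemma noiseDensity_pos (a : ℝ) (w : ℂ) : 0 < noiseDensity a w :=
  smoothed_pos continuous_gaussDensity gaussDensity_pos gaussDensity_le w

lemma noiseDensity_le (a : ℝ) (w : ℂ) : noiseDensity a w ≤ Real.pi⁻¹ :=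
  smoothed_le continuous_gaussDensity (fun w => (gaussDensity_pos w).le) gaussDensity_le w

lemma noise_eq (a : ℝ) : noise a = volume.withDensity fun w => ENNReal.ofReal (noiseDensity a w) := by
  rw [noise, complexGaussian_eq]
  exact conv_withDensity continuous_gaussDensity (fun w => (gaussDensity_pos w).le) gaussDensity_le

section out

variable (a : ℝ) (μ : Measure ℂ) [IsProbabilityMeasure μ]

lemma continuous_outDensity : Continuous (outDensity a μ) :=
  continuous_smoothed (continuous_noiseDensity a) (fun w => (noiseDensity_pos a w).le) (noiseDensity_le a)

lemma outDensity_pos (w : ℂ) : 0 < outDensity a μ w :=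
  smoothed_pos (continuous_noiseDensity a) (noiseDensity_pos a) (noiseDensity_le a) w

lemma outDensity_le (w : ℂ) : outDensity a μ w ≤ Real.pi⁻¹ :=
  smoothed_le (continuous_noiseDensity a) (fun w => (noiseDensity_pos a w).le) (noiseDensity_le a) w

lemma conv_noise_eq :
    μ ∗ noise a = volume.withDensity fun w => ENNReal.ofReal (outDensity a μ w) := by
  rw [noise_eq]
  exact conv_withDensity (continuous_noiseDensity a) (fun w => (noiseDensity_pos a w).le) (noiseDensity_le a)

end out

lemma ae_norm_ringLaw (a : ℝ) : ∀ᵐ u ∂ringLaw a, ‖u‖ = |a| := by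
  unfold ringLaw
  rw [ae_map_iff (by fun_prop) (measurableSet_eq_fun (by fun_prop) (by fun_prop))]
  exact .of_forall fun θ => by simp [Complex.norm_exp_ofReal_mul_I]

lemma noiseDensity_ge (a : ℝ) (w : ℂ) :
    Real.pi⁻¹ * Real.exp (-2 * ‖w‖ ^ 2 - 2 * a ^ 2) ≤ noiseDensity a w := by
  have h1 : ∫ _, Real.pi⁻¹ * Real.exp (-2 * ‖w‖ ^ 2 - 2 * a ^ 2) ∂ringLaw a
      = Real.pi⁻¹ * Real.exp (-2 * ‖w‖ ^ 2 - 2 * a ^ 2) := by simp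
  rw [← h1]
  refine integral_mono_ae (integrable_const _) (integrable_smoothed continuous_gaussDensity
    (fun w => (gaussDensity_pos w).le) gaussDensity_le w) ?_
  filter_upwards [ae_norm_ringLaw a] with u hu
  unfold gaussDensity
  gcongr
  have h2 : ‖w - u‖ ≤ ‖w‖ + |a| := by rw [← hu]; exact norm_sub_le _ _
  have h3 : |a| ^ 2 = a ^ 2 := sq_abs a
  nlinarith [norm_nonneg (w - u), sq_nonneg (‖w‖ - |a|), norm_nonneg w, abs_nonneg a]

/-- `E exp(-4|X|²)` is positive for every probability law, so a Gaussian lower bound needs no moment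
assumption. The `4` comes from `|y - x|² ≤ 2|y|² + 2|x|²` inside the noise bound. -/
lemma exists_outDensity_ge (a : ℝ) (μ : Measure ℂ) [IsProbabilityMeasure μ] :
    ∃ c > 0, ∀ y, c * Real.exp (-4 * ‖y‖ ^ 2) ≤ outDensity a μ y := by
  have hint : Integrable (fun x : ℂ => Real.exp (-4 * ‖x‖ ^ 2)) μ := by
    refine (integrable_const (1 : ℝ)).mono' (by fun_prop) (.of_forall fun x => ?_)
    rw [Real.norm_of_nonneg (Real.exp_pos _).le]
    exact Real.exp_le_one_iff.2 (by nlinarith [sq_nonneg ‖x‖])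
  refine ⟨Real.pi⁻¹ * Real.exp (-2 * a ^ 2) * ∫ x, Real.exp (-4 * ‖x‖ ^ 2) ∂μ, ?_, fun y => ?_⟩
  · have : 0 < ∫ x, Real.exp (-4 * ‖x‖ ^ 2) ∂μ := integral_exp_pos hint
    positivity
  · have e : Real.pi⁻¹ * Real.exp (-2 * a ^ 2) * (∫ x, Real.exp (-4 * ‖x‖ ^ 2) ∂μ) * Real.exp (-4 * ‖y‖ ^ 2)
        = ∫ x, (Real.pi⁻¹ * Real.exp (-2 * a ^ 2) * Real.exp (-4 * ‖y‖ ^ 2)) * Real.exp (-4 * ‖x‖ ^ 2) ∂μ := by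
      rw [integral_const_mul]; ring
    rw [e]
    refine integral_mono (hint.const_mul _) (integrable_smoothed (continuous_noiseDensity a)
      (fun w => (noiseDensity_pos a w).le) (noiseDensity_le a) y) fun x => ?_
    refine le_trans ?_ (noiseDensity_ge a (y - x))
    simp only
    rw [mul_assoc, mul_assoc, ← Real.exp_add, ← Real.exp_add]
    gcongr
    have := norm_sub_le y x
    nlinarith [norm_nonneg (y - x), sq_nonneg (‖y‖ - ‖x‖), norm_nonneg x, norm_nonneg y]

/-! ### Quadratic growth and integrability. -/

/-- Continuous functions of at most quadratic growth. -/
def QuadGrowth (φ : ℂ → ℝ) : Prop := Continuous φ ∧ ∃ A, ∀ y, |φ y| ≤ A * (1 + ‖y‖ ^ 2)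

lemma quadGrowth_log_of_bounds {p : ℂ → ℝ} (hp : Continuous p) {c K B : ℝ} (hc : 0 < c)
    (hl : ∀ y, c * Real.exp (-B * ‖y‖ ^ 2) ≤ p y) (hu : ∀ y, p y ≤ K) :
    QuadGrowth fun y => -Real.log (p y) := by
  have hpos : ∀ y, 0 < p y := fun y => lt_of_lt_of_le (by positivity) (hl y)
  refine ⟨(hp.log fun y => (hpos y).ne').neg, |Real.log K| + |Real.log c| + |B|, fun y => ?_⟩
  have h1 : Real.log (p y) ≤ Real.log K := Real.log_le_log (hpos y) (hu y)
  have h2 : Real.log c - B * ‖y‖ ^ 2 ≤ Real.log (p y) := by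
    have := Real.log_le_log (by positivity) (hl y)
    rw [Real.log_mul hc.ne' (Real.exp_pos _).ne', Real.log_exp] at this
    linarith
  have h3 := le_abs_self (Real.log K)
  have h4 := neg_abs_le (Real.log c)
  have h5 := le_abs_self B
  have h6 := sq_nonneg ‖y‖
  have h7 : B * ‖y‖ ^ 2 ≤ |B| * ‖y‖ ^ 2 := mul_le_mul_of_nonneg_right h5 h6
  have h8 := mul_nonneg (abs_nonneg (Real.log K)) h6
  have h9 := mul_nonneg (abs_nonneg (Real.log c)) h6
  have h10 := abs_nonneg (Real.log K)
  have h11 := abs_nonneg (Real.log c)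
  have h12 := abs_nonneg B
  rw [abs_neg, abs_le]
  constructor <;> nlinarith

lemma quadGrowth_outDensity (a : ℝ) (μ : Measure ℂ) [IsProbabilityMeasure μ] :
    QuadGrowth fun y => -Real.log (outDensity a μ y) := by
  obtain ⟨c, hc, h⟩ := exists_outDensity_ge a μ
  exact quadGrowth_log_of_bounds (continuous_outDensity a μ) hc h (outDensity_le a μ)

lemma outDensity_dirac_zero (a : ℝ) : outDensity a (Measure.dirac 0) = noiseDensity a := by
  ext y; simp [outDensity, smoothed]

lemma quadGrowth_noiseDensity (a : ℝ) : QuadGrowth fun y => -Real.log (noiseDensity a y) := by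
  rw [← outDensity_dirac_zero]
  exact quadGrowth_outDensity a _

lemma integrable_norm_sq_complexGaussian : Integrable (fun w : ℂ => ‖w‖ ^ 2) complexGaussian := by
  unfold complexGaussian
  rw [integrable_map_measure (by fun_prop) (by fun_prop)]
  have h : Integrable (fun x : ℝ => x ^ 2) (gaussianReal 0 (1 / 2)) :=
    (memLp_id_gaussianReal 2).integrable_sq
  refine ((h.comp_fst _).add (h.comp_snd _)).congr (.of_forall fun p => ?_)
  simp only [Function.comp, Pi.add_apply]
  rw [Complex.sq_norm, Complex.normSq_apply]; simp; ring

lemma integrable_norm_sq_noise (a : ℝ) : Integrable (fun w : ℂ => ‖w‖ ^ 2) (noise a) := by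
  unfold noise Measure.conv
  rw [integrable_map_measure (by fun_prop) (by fun_prop)]
  have h1 : Integrable (fun u : ℂ => ‖u‖ ^ 2) (ringLaw a) := by
    refine (integrable_const (|a| ^ 2)).congr ?_
    filter_upwards [ae_norm_ringLaw a] with u hu
    rw [hu]
  refine (((h1.comp_fst complexGaussian).const_mul 2).add
    ((integrable_norm_sq_complexGaussian.comp_snd (ringLaw a)).const_mul 2)).mono' (by fun_prop)
    (.of_forall fun p => ?_)
  simp only [Function.comp, Pi.add_apply]
  rw [Real.norm_of_nonneg (by positivity)]
  have := norm_add_le p.1 p.2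
  nlinarith [norm_nonneg (p.1 + p.2), sq_nonneg (‖p.1‖ - ‖p.2‖), norm_nonneg p.1, norm_nonneg p.2]

lemma QuadGrowth.integrable {φ : ℂ → ℝ} (hφ : QuadGrowth φ) {ν : Measure ℂ} [IsFiniteMeasure ν]
    (hν : Integrable (fun w : ℂ => ‖w‖ ^ 2) ν) : Integrable φ ν := by
  obtain ⟨hc, A, hA⟩ := hφ
  refine (((integrable_const (1 : ℝ)).add hν).const_mul A).mono' hc.aestronglyMeasurable
    (.of_forall fun w => ?_)
  simpa using hA w

lemma QuadGrowth.translate {φ : ℂ → ℝ} (hφ : QuadGrowth φ) (x : ℂ) : QuadGrowth fun w => φ (x + w) := by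
  obtain ⟨hc, A, hA⟩ := hφ
  have hA0 : 0 ≤ A := by
    have := (abs_nonneg _).trans (hA 0)
    simpa using this
  refine ⟨by fun_prop, A * (2 + 2 * ‖x‖ ^ 2), fun w => (hA _).trans ?_⟩
  rw [mul_assoc]
  gcongr
  have := norm_add_le x w
  nlinarith [norm_nonneg (x + w), sq_nonneg (‖x‖ - ‖w‖), norm_nonneg x, norm_nonneg w,
    mul_nonneg (sq_nonneg ‖x‖) (sq_nonneg ‖w‖)]

lemma QuadGrowth.integrable_noise {φ : ℂ → ℝ} (hφ : QuadGrowth φ) (a : ℝ) (x : ℂ) :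
    Integrable (fun w => φ (x + w)) (noise a) :=
  (hφ.translate x).integrable (integrable_norm_sq_noise a)

lemma quadGrowth_norm_sq : QuadGrowth fun y => ‖y‖ ^ 2 :=
  ⟨by fun_prop, 1, fun y => by rw [abs_of_nonneg (by positivity)]; linarith⟩

lemma quadGrowth_const (c : ℝ) : QuadGrowth fun _ => c :=
  ⟨by fun_prop, |c|, fun y => by nlinarith [abs_nonneg c, sq_nonneg ‖y‖, mul_nonneg (abs_nonneg c) (sq_nonneg ‖y‖)]⟩

lemma QuadGrowth.add {φ ψ : ℂ → ℝ} (hφ : QuadGrowth φ) (hψ : QuadGrowth ψ) :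
    QuadGrowth fun y => φ y + ψ y := by
  obtain ⟨hc, A, hA⟩ := hφ
  obtain ⟨hd, B, hB⟩ := hψ
  exact ⟨hc.add hd, A + B, fun y => (abs_add_le _ _).trans (by linarith [hA y, hB y])⟩

lemma QuadGrowth.const_mul {φ : ℂ → ℝ} (hφ : QuadGrowth φ) (c : ℝ) : QuadGrowth fun y => c * φ y := by
  obtain ⟨hc, A, hA⟩ := hφ
  refine ⟨by fun_prop, |c| * A, fun y => ?_⟩
  rw [abs_mul, mul_assoc]
  gcongr
  exact hA y

/-! ### Rotational symmetry and second moments. -/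

/-- Rotation by `c` preserves the uniform distribution on a circle. -/
lemma map_mul_ringLaw (a : ℝ) {c : ℂ} (hc : ‖c‖ = 1) : (ringLaw a).map (fun u => c * u) = ringLaw a := by
  have : IsProbabilityMeasure ((ringLaw a).map (fun u => c * u)) :=
    Measure.isProbabilityMeasure_map (by fun_prop)
  refine ext_of_forall_integral_eq_of_IsFiniteMeasure fun f => ?_
  rw [integral_map (by fun_prop) (by fun_prop)]
  unfold ringLaw
  rw [integral_map (by fun_prop) (by fun_prop), integral_map (by fun_prop) (by fun_prop),
    integral_uniformPhase, integral_uniformPhase]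
  congr 1
  set h : ℝ → ℝ := fun θ => f ((a : ℂ) * Complex.exp ((θ : ℂ) * Complex.I)) with hh
  have hper : Function.Periodic h (2 * Real.pi) := by
    intro θ
    simp only [hh]
    congr 2
    push_cast
    rw [add_mul, Complex.exp_add, Complex.exp_two_pi_mul_I, mul_one]
  have e : ∀ θ : ℝ, f (c * ((a : ℂ) * Complex.exp ((θ : ℂ) * Complex.I))) = h (θ + Complex.arg c) := by
    intro θ
    simp only [hh]
    congr 1
    have : c = Complex.exp (Complex.arg c * Complex.I) := by
      have := Complex.norm_mul_exp_arg_mul_I c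
      rw [hc] at this; simpa using this.symm
    push_cast
    rw [add_mul, Complex.exp_add, ← this]
    ring
  simp_rw [e]
  rw [intervalIntegral.integral_comp_add_right]
  have := hper.intervalIntegral_add_eq (Complex.arg c) 0
  rw [zero_add] at this
  rw [zero_add, add_comm (2 * Real.pi)]
  exact this

lemma measurePreserving_mul {c : ℂ} (hc : ‖c‖ = 1) : MeasurePreserving (fun u : ℂ => c * u) := by
  have h := (rotation (⟨c, mem_sphere_zero_iff_norm.2 hc⟩ : Circle)).measurePreserving
  exact h

lemma map_mul_complexGaussian {c : ℂ} (hc : ‖c‖ = 1) :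
    complexGaussian.map (fun u => c * u) = complexGaussian := by
  rw [complexGaussian_eq]
  have hm := continuous_gaussDensity.measurable
  refine Measure.ext_of_lintegral _ fun φ hφ => ?_
  rw [lintegral_map hφ (by fun_prop), lintegral_withDensity_eq_lintegral_mul _ (by fun_prop) (by fun_prop),
    lintegral_withDensity_eq_lintegral_mul _ (by fun_prop) hφ]
  have := (measurePreserving_mul hc).lintegral_comp
    (f := (fun w => ENNReal.ofReal (gaussDensity w)) * φ) (by fun_prop)
  rw [← this]
  refine lintegral_congr fun w => ?_
  simp [gaussDensity, hc]

lemma map_mul_conv (μ ν : Measure ℂ) [IsProbabilityMeasure μ] [IsProbabilityMeasure ν] (c : ℂ) :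
    (μ ∗ ν).map (fun u => c * u) = μ.map (fun u => c * u) ∗ ν.map (fun u => c * u) := by
  unfold Measure.conv
  rw [Measure.map_map (by fun_prop) (by fun_prop), Measure.map_prod_map _ _ (by fun_prop) (by fun_prop),
    Measure.map_map (by fun_prop) (by fun_prop)]
  congr 1
  ext p
  simp [mul_add]

lemma map_mul_noise (a : ℝ) {c : ℂ} (hc : ‖c‖ = 1) : (noise a).map (fun u => c * u) = noise a := by
  rw [noise, map_mul_conv, map_mul_ringLaw a hc, map_mul_complexGaussian hc]

lemma integral_re_mul_of_symm {ν : Measure ℂ} (h : ν.map (fun u => (-1 : ℂ) * u) = ν) (x : ℂ) :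
    ∫ w, ((starRingEnd ℂ) x * w).re ∂ν = 0 := by
  have h2 : ∫ w, ((starRingEnd ℂ) x * w).re ∂ν = ∫ w, -((starRingEnd ℂ) x * w).re ∂ν := by
    conv_lhs => rw [← h]
    rw [integral_map (by fun_prop) (by fun_prop)]
    simp
  rw [integral_neg] at h2
  linarith

lemma integrable_re_mul {ν : Measure ℂ} [IsFiniteMeasure ν] (hν : Integrable (fun w : ℂ => ‖w‖ ^ 2) ν) (x : ℂ) :
    Integrable (fun w : ℂ => ((starRingEnd ℂ) x * w).re) ν := by
  refine (((integrable_const (1 : ℝ)).add hν).const_mul (‖x‖)).mono' (by fun_prop) (.of_forall fun w => ?_)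
  refine (Complex.abs_re_le_norm _).trans ?_
  rw [norm_mul, RCLike.norm_conj]
  gcongr
  simp only [Pi.add_apply]
  nlinarith [sq_nonneg (‖w‖ - 1)]

/-- The cross term is odd in `w`, so symmetry of the law kills it. -/
lemma integral_norm_add_sq_of_symm {ν : Measure ℂ} [IsProbabilityMeasure ν]
    (hν : Integrable (fun w : ℂ => ‖w‖ ^ 2) ν) (h : ν.map (fun u => (-1 : ℂ) * u) = ν) (x : ℂ) :
    ∫ w, ‖x + w‖ ^ 2 ∂ν = ‖x‖ ^ 2 + ∫ w, ‖w‖ ^ 2 ∂ν := by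
  have e : ∀ w : ℂ, ‖x + w‖ ^ 2 = ‖x‖ ^ 2 + 2 * ((starRingEnd ℂ) x * w).re + ‖w‖ ^ 2 := by
    intro w
    rw [Complex.sq_norm, Complex.sq_norm, Complex.sq_norm, Complex.normSq_apply, Complex.normSq_apply,
      Complex.normSq_apply]
    simp; ring
  have hint := (integrable_re_mul hν x).const_mul 2
  simp_rw [e]
  have hsum : Integrable (fun w : ℂ => ‖x‖ ^ 2 + 2 * ((starRingEnd ℂ) x * w).re) ν :=
    (integrable_const _).add hint
  rw [integral_add hsum hν, integral_add (integrable_const _) hint, integral_const_mul,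
    integral_re_mul_of_symm h]
  simp

/-- The mean power of the noise. -/
def noisePower (a : ℝ) : ℝ := ∫ w, ‖w‖ ^ 2 ∂noise a

lemma integral_norm_add_sq_noise (a : ℝ) (x : ℂ) :
    ∫ w, ‖x + w‖ ^ 2 ∂noise a = ‖x‖ ^ 2 + noisePower a :=
  integral_norm_add_sq_of_symm (integrable_norm_sq_noise a) (map_mul_noise a (by simp)) x

lemma noisePower_nonneg (a : ℝ) : 0 ≤ noisePower a := integral_nonneg fun w => by positivity

section conv

variable {a : ℝ} {μ : Measure ℂ} [IsProbabilityMeasure μ]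

lemma integrable_norm_sq_conv (hμ : Integrable (fun x : ℂ => ‖x‖ ^ 2) μ) :
    Integrable (fun y : ℂ => ‖y‖ ^ 2) (μ ∗ noise a) := by
  unfold Measure.conv
  rw [integrable_map_measure (by fun_prop) (by fun_prop)]
  refine (((hμ.comp_fst (noise a)).const_mul 2).add
    (((integrable_norm_sq_noise a).comp_snd μ).const_mul 2)).mono' (by fun_prop)
    (.of_forall fun p => ?_)
  simp only [Function.comp, Pi.add_apply]
  rw [Real.norm_of_nonneg (by positivity)]
  have := norm_add_le p.1 p.2
  nlinarith [norm_nonneg (p.1 + p.2), sq_nonneg (‖p.1‖ - ‖p.2‖), norm_nonneg p.1, norm_nonneg p.2]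

lemma QuadGrowth.integral_conv {φ : ℂ → ℝ} (hφ : QuadGrowth φ) (hμ : Integrable (fun x : ℂ => ‖x‖ ^ 2) μ) :
    ∫ y, φ y ∂(μ ∗ noise a) = ∫ x, ∫ w, φ (x + w) ∂noise a ∂μ :=
  MeasureTheory.integral_conv (hφ.integrable (integrable_norm_sq_conv hμ))

lemma QuadGrowth.integrable_integral_noise {φ : ℂ → ℝ} (hφ : QuadGrowth φ)
    (hμ : Integrable (fun x : ℂ => ‖x‖ ^ 2) μ) :
    Integrable (fun x => ∫ w, φ (x + w) ∂noise a) μ := by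
  have h := hφ.integrable (integrable_norm_sq_conv (a := a) hμ)
  unfold Measure.conv at h
  rw [integrable_map_measure hφ.1.aestronglyMeasurable (by fun_prop)] at h
  exact h.integral_prod_left

lemma integral_norm_sq_conv (hμ : Integrable (fun x : ℂ => ‖x‖ ^ 2) μ) :
    ∫ y, ‖y‖ ^ 2 ∂(μ ∗ noise a) = ∫ x, ‖x‖ ^ 2 ∂μ + noisePower a := by
  rw [quadGrowth_norm_sq.integral_conv hμ]
  simp_rw [integral_norm_add_sq_noise]
  rw [integral_add hμ (integrable_const _)]
  simp

lemma integral_conv_eq_integral_mul (φ : ℂ → ℝ) :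
    ∫ y, φ y ∂(μ ∗ noise a) = ∫ y, outDensity a μ y * φ y := by
  have hm := (continuous_outDensity a μ).measurable
  rw [conv_noise_eq, integral_withDensity_eq_integral_toReal_smul (by fun_prop) (by simp)]
  refine integral_congr_ae (.of_forall fun y => ?_)
  simp [ENNReal.toReal_ofReal (outDensity_pos a μ y).le]

lemma integrable_conv_iff_mul (φ : ℂ → ℝ) :
    Integrable φ (μ ∗ noise a) ↔ Integrable (fun y => outDensity a μ y * φ y) := by
  have hm := (continuous_outDensity a μ).measurable
  rw [conv_noise_eq, integrable_withDensity_iff_integrable_smul' (by fun_prop) (by simp)]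
  refine integrable_congr (.of_forall fun y => ?_)
  simp [ENNReal.toReal_ofReal (outDensity_pos a μ y).le]

lemma integrable_outDensity : Integrable (outDensity a μ) := by
  have := (integrable_conv_iff_mul (a := a) (μ := μ) (fun _ => 1)).1 (integrable_const 1)
  simpa using this

lemma integral_outDensity : ∫ y, outDensity a μ y = 1 := by
  have := integral_conv_eq_integral_mul (a := a) (μ := μ) (fun _ => 1)
  simp at this
  exact this.symm

end conv

/-! ### Entropy, Gibbs' inequality and mutual information. -/

/-- The expected output log-loss `E[-log p_μ(x + W)]` at the input `x`. -/
def loss (a : ℝ) (μ : Measure ℂ) (x : ℂ) : ℝ := ∫ w, -Real.log (outDensity a μ (x + w)) ∂noise a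

/-- The differential entropy of the channel output. -/
def outEntropy (a : ℝ) (μ : Measure ℂ) : ℝ := ∫ y, -Real.log (outDensity a μ y) ∂(μ ∗ noise a)

/-- The differential entropy of the noise. -/
def noiseEntropy (a : ℝ) : ℝ := ∫ w, -Real.log (noiseDensity a w) ∂noise a

/-- Gibbs' inequality for positive continuous densities, with the equality case. -/
lemma gibbs {p q : ℂ → ℝ} (hp : Continuous p) (hq : Continuous q) (hp0 : ∀ y, 0 < p y) (hq0 : ∀ y, 0 < q y)
    (hpi : Integrable p) (hqi : Integrable q) (hpq : ∫ y, q y = ∫ y, p y)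
    (h1 : Integrable fun y => p y * -Real.log (p y)) (h2 : Integrable fun y => p y * -Real.log (q y)) :
    ∫ y, p y * -Real.log (p y) ≤ ∫ y, p y * -Real.log (q y) ∧
      (∫ y, p y * -Real.log (q y) ≤ ∫ y, p y * -Real.log (p y) → p = q) := by
  -- Adding `q - p`, of integral zero, makes the relative-entropy integrand nonnegative pointwise.
  set k : ℂ → ℝ := fun y => (p y * -Real.log (q y) - p y * -Real.log (p y)) + (q y - p y) with hk
  have hkc : Continuous k := by
    have e1 := hp.log fun y => (hp0 y).ne'
    have e2 := hq.log fun y => (hq0 y).ne'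
    fun_prop
  have hlog : ∀ y, Real.log (q y / p y) = Real.log (q y) - Real.log (p y) := fun y =>
    Real.log_div (hq0 y).ne' (hp0 y).ne'
  have hk0 : ∀ y, 0 ≤ k y := by
    intro y
    have h := Real.log_le_sub_one_of_pos (div_pos (hq0 y) (hp0 y))
    rw [hlog] at h
    have h' := mul_le_mul_of_nonneg_left h (hp0 y).le
    have e : p y * (q y / p y - 1) = q y - p y := by
      have := (hp0 y).ne'
      field_simp
    rw [e] at h'
    simp only [hk]
    linarith
  have h21 : Integrable fun y => p y * -Real.log (q y) - p y * -Real.log (p y) := h2.sub h1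
  have hqp : Integrable fun y => q y - p y := hqi.sub hpi
  have hki : Integrable k := h21.add hqp
  have hkint : ∫ y, k y = (∫ y, p y * -Real.log (q y)) - ∫ y, p y * -Real.log (p y) := by
    simp only [hk]
    rw [integral_add h21 hqp, integral_sub h2 h1, integral_sub hqi hpi, hpq]
    ring
  have hnn : 0 ≤ ∫ y, k y := integral_nonneg fun y => hk0 y
  refine ⟨by linarith, fun h => ?_⟩
  · have hz : ∫ y, k y = 0 := le_antisymm (by linarith) hnn
    rw [integral_eq_zero_iff_of_nonneg hk0 hki] at hz
    have hz' : k = 0 := (hkc.ae_eq_iff_eq volume continuous_zero).1 hz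
    ext y
    by_contra hne
    have h := Real.log_lt_sub_one_of_pos (div_pos (hq0 y) (hp0 y)) (by
      intro h; rw [div_eq_one_iff_eq (hp0 y).ne'] at h; exact hne h.symm)
    rw [hlog] at h
    have h' := mul_lt_mul_of_pos_left h (hp0 y)
    have e : p y * (q y / p y - 1) = q y - p y := by
      have := (hp0 y).ne'
      field_simp
    rw [e] at h'
    have := congrFun hz' y
    simp only [hk, Pi.zero_apply] at this
    linarith

section gibbs

variable {a : ℝ} {μ μ' : Measure ℂ} [IsProbabilityMeasure μ] [IsProbabilityMeasure μ']

lemma integrable_loss (hμ : Integrable (fun x : ℂ => ‖x‖ ^ 2) μ) : Integrable (loss a μ') μ :=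
  (quadGrowth_outDensity a μ').integrable_integral_noise hμ

lemma integral_loss (hμ : Integrable (fun x : ℂ => ‖x‖ ^ 2) μ) :
    ∫ x, loss a μ' x ∂μ = ∫ y, outDensity a μ y * -Real.log (outDensity a μ' y) := by
  rw [← integral_conv_eq_integral_mul, (quadGrowth_outDensity a μ').integral_conv hμ]
  rfl

lemma outEntropy_eq_integral_loss (hμ : Integrable (fun x : ℂ => ‖x‖ ^ 2) μ) :
    outEntropy a μ = ∫ x, loss a μ x ∂μ :=
  (quadGrowth_outDensity a μ).integral_conv hμ

lemma integrable_mul_log (hμ : Integrable (fun x : ℂ => ‖x‖ ^ 2) μ) :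
    Integrable fun y => outDensity a μ y * -Real.log (outDensity a μ' y) :=
  (integrable_conv_iff_mul _).1 ((quadGrowth_outDensity a μ').integrable (integrable_norm_sq_conv hμ))

/-- Gibbs' inequality for two output densities: measuring the loss with the wrong output law can
only raise its mean. -/
lemma outEntropy_le_integral_loss (hμ : Integrable (fun x : ℂ => ‖x‖ ^ 2) μ) :
    outEntropy a μ ≤ ∫ x, loss a μ' x ∂μ := by
  rw [outEntropy_eq_integral_loss hμ, integral_loss hμ, integral_loss hμ]
  exact (gibbs (continuous_outDensity a μ) (continuous_outDensity a μ') (outDensity_pos a μ)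
    (outDensity_pos a μ') integrable_outDensity integrable_outDensity
    (by rw [integral_outDensity, integral_outDensity]) (integrable_mul_log hμ) (integrable_mul_log hμ)).1

lemma outDensity_eq_of_integral_loss_le (hμ : Integrable (fun x : ℂ => ‖x‖ ^ 2) μ)
    (h : ∫ x, loss a μ' x ∂μ ≤ outEntropy a μ) : outDensity a μ = outDensity a μ' := by
  rw [outEntropy_eq_integral_loss hμ, integral_loss hμ, integral_loss hμ] at h
  exact (gibbs (continuous_outDensity a μ) (continuous_outDensity a μ') (outDensity_pos a μ)
    (outDensity_pos a μ') integrable_outDensity integrable_outDensity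
    (by rw [integral_outDensity, integral_outDensity]) (integrable_mul_log hμ) (integrable_mul_log hμ)).2 h

end gibbs

lemma jointLaw_fst (inr : ℝ) (μ : Measure ℂ) [IsProbabilityMeasure μ] : (jointLaw inr μ).fst = μ := by
  rw [jointLaw, noiseLaw_eq, Measure.fst, Measure.map_map (by fun_prop) (by fun_prop)]
  exact Measure.fst_prod

lemma jointLaw_snd (inr : ℝ) (μ : Measure ℂ) [IsProbabilityMeasure μ] :
    (jointLaw inr μ).snd = μ ∗ noise (Real.sqrt inr) := by
  rw [jointLaw, noiseLaw_eq, Measure.snd, Measure.map_map (by fun_prop) (by fun_prop)]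
  rfl

lemma jointLaw_eq_withDensity (inr : ℝ) (μ : Measure ℂ) [IsProbabilityMeasure μ] :
    jointLaw inr μ = (μ.prod (μ ∗ noise (Real.sqrt inr))).withDensity fun z =>
      ENNReal.ofReal (noiseDensity (Real.sqrt inr) (z.2 - z.1) / outDensity (Real.sqrt inr) μ z.2) := by
  set a := Real.sqrt inr
  have hf := (continuous_noiseDensity a).measurable
  have hp := (continuous_outDensity a μ).measurable
  have hg : Measurable fun z : ℂ × ℂ => ENNReal.ofReal (noiseDensity a (z.2 - z.1) / outDensity a μ z.2) := by
    fun_prop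
  refine Measure.ext_of_lintegral _ fun φ hφ => ?_
  rw [jointLaw, noiseLaw_eq, lintegral_map hφ (by fun_prop), lintegral_prod _ (by fun_prop),
    lintegral_withDensity_eq_lintegral_mul _ hg hφ, lintegral_prod _ (by fun_prop)]
  refine lintegral_congr fun x => ?_
  rw [conv_noise_eq, lintegral_withDensity_eq_lintegral_mul _ (by fun_prop) (by fun_prop), noise_eq,
    lintegral_withDensity_eq_lintegral_mul _ (by fun_prop) (by fun_prop)]
  conv_rhs => rw [← lintegral_add_left_eq_self _ x]
  refine lintegral_congr fun w => ?_
  simp only [Pi.mul_apply, add_sub_cancel_left]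
  rw [← mul_assoc, ← ENNReal.ofReal_mul (outDensity_pos a μ _).le, mul_div_cancel₀ _ (outDensity_pos a μ _).ne']

/-- The log-likelihood ratio is `log f(y - x) - log p(y)`, with `f` the noise density. Finite power
makes the two terms separately integrable, so the divergence splits into a difference of entropies.
-/
lemma mutualInfo_jointLaw (inr : ℝ) {μ : Measure ℂ} [IsProbabilityMeasure μ]
    (hμ : Integrable (fun x : ℂ => ‖x‖ ^ 2) μ) :
    mutualInfo (jointLaw inr μ) =
      ENNReal.ofReal (outEntropy (Real.sqrt inr) μ - noiseEntropy (Real.sqrt inr)) := by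
  have hjd := jointLaw_eq_withDensity inr μ
  set a := Real.sqrt inr
  have hf := (continuous_noiseDensity a).measurable
  have hp := (continuous_outDensity a μ).measurable
  have hg : Measurable fun z : ℂ × ℂ => ENNReal.ofReal (noiseDensity a (z.2 - z.1) / outDensity a μ z.2) := by
    fun_prop
  have hac : jointLaw inr μ ≪ μ.prod (μ ∗ noise a) := by
    rw [hjd]; exact withDensity_absolutelyContinuous _ _
  have hllr : llr (jointLaw inr μ) (μ.prod (μ ∗ noise a)) =ᵐ[jointLaw inr μ]
      fun z => -Real.log (outDensity a μ z.2) - -Real.log (noiseDensity a (z.2 - z.1)) := by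
    refine hac.ae_le ?_
    have h := Measure.rnDeriv_withDensity (μ.prod (μ ∗ noise a)) hg
    rw [← hjd] at h
    filter_upwards [h] with z hz
    rw [llr, hz, ENNReal.toReal_ofReal (div_pos (noiseDensity_pos _ _) (outDensity_pos _ _ _)).le,
      Real.log_div (noiseDensity_pos _ _).ne' (outDensity_pos _ _ _).ne']
    ring
  have hlp : Continuous fun y => Real.log (outDensity a μ y) :=
    (continuous_outDensity a μ).log fun y => (outDensity_pos a μ y).ne'
  have hlp' : AEStronglyMeasurable (fun y => -Real.log (outDensity a μ y))
      ((μ.prod (noise a)).map fun z : ℂ × ℂ => z.1 + z.2) := hlp.neg.aestronglyMeasurable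
  have hlf : Continuous fun y => Real.log (noiseDensity a y) :=
    (continuous_noiseDensity a).log fun y => (noiseDensity_pos a y).ne'
  have hj : jointLaw inr μ = (μ.prod (noise a)).map (fun p : ℂ × ℂ => (p.1, p.1 + p.2)) := by
    rw [jointLaw, noiseLaw_eq]
  have i1 : Integrable (fun p : ℂ × ℂ => -Real.log (outDensity a μ (p.1 + p.2))) (μ.prod (noise a)) := by
    have := (quadGrowth_outDensity a μ).integrable (integrable_norm_sq_conv (a := a) hμ)
    unfold Measure.conv at this
    rwa [integrable_map_measure hlp' (by fun_prop)] at this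
  have i2 : Integrable (fun w : ℂ => -Real.log (noiseDensity a w)) (noise a) :=
    (quadGrowth_noiseDensity a).integrable (integrable_norm_sq_noise a)
  have i3 : Integrable (fun p : ℂ × ℂ => -Real.log (noiseDensity a p.2)) (μ.prod (noise a)) :=
    i2.comp_snd μ
  have hint : Integrable (llr (jointLaw inr μ) (μ.prod (μ ∗ noise a))) (jointLaw inr μ) := by
    rw [integrable_congr hllr, hj, integrable_map_measure (by fun_prop) (by fun_prop)]
    refine (i1.sub i3).congr (.of_forall fun p => ?_)
    simp
  have hjp : IsProbabilityMeasure (jointLaw inr μ) := by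
    rw [hj]; exact Measure.isProbabilityMeasure_map (by fun_prop)
  rw [mutualInfo, jointLaw_fst, jointLaw_snd, InformationTheory.klDiv_of_ac_of_integrable hac hint,
    integral_congr_ae hllr, probReal_univ, probReal_univ, add_sub_cancel_right]
  congr 1
  rw [hj, integral_map (by fun_prop) (by fun_prop)]
  simp only [add_sub_cancel_left]
  rw [integral_sub i1 i3, integral_fun_snd (fun w => -Real.log (noiseDensity a w)), outEntropy, Measure.conv,
    integral_map (by fun_prop) hlp', noiseEntropy]
  simp

lemma mem_admissible_iff {snr : ℝ} (hsnr : 0 ≤ snr) {μ : Measure ℂ} :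
    μ ∈ admissible snr ↔
      IsProbabilityMeasure μ ∧ Integrable (fun x : ℂ => ‖x‖ ^ 2) μ ∧ ∫ x, ‖x‖ ^ 2 ∂μ ≤ snr := by
  unfold admissible
  rw [Set.mem_ofPred_eq]
  refine and_congr_right fun hμ => ⟨fun h => ?_, fun ⟨hi, h⟩ => ?_⟩
  · have hi : Integrable (fun x : ℂ => ‖x‖ ^ 2) μ :=
      (lintegral_ofReal_ne_top_iff_integrable (by fun_prop) (.of_forall fun x => by positivity)).1
        (h.trans_lt ENNReal.ofReal_lt_top).ne
    refine ⟨hi, ?_⟩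
    rwa [← ofReal_integral_eq_lintegral_ofReal hi (.of_forall fun x => by positivity),
      ENNReal.ofReal_le_ofReal_iff hsnr] at h
  · rw [← ofReal_integral_eq_lintegral_ofReal hi (.of_forall fun x => by positivity)]
    exact ENNReal.ofReal_le_ofReal h

lemma loss_dirac_zero (a : ℝ) : loss a (Measure.dirac 0) 0 = noiseEntropy a := by
  simp [loss, noiseEntropy, outDensity_dirac_zero]

lemma outEntropy_dirac (a : ℝ) : outEntropy a (Measure.dirac 0) = noiseEntropy a := by
  rw [outEntropy_eq_integral_loss (integrable_dirac (by simp)), integral_dirac, loss_dirac_zero]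

/-! ### Existence of a maximizer: weak compactness and semicontinuity. -/

lemma integrable_exp_neg_mul_norm_sq {b : ℝ} (hb : 0 < b) :
    Integrable fun w : ℂ => Real.exp (-b * ‖w‖ ^ 2) := by
  have h := (GaussianFourier.integrable_cexp_neg_mul_sq_norm_add (b := (b : ℂ)) (V := ℂ)
    (by simpa using hb) 0 0).norm
  refine h.congr (.of_forall fun w => ?_)
  simp [Complex.norm_exp, ← Complex.ofReal_pow]

/-- The noise density is bounded and continuous, hence a test function for weak convergence. -/
lemma tendsto_outDensity (a : ℝ) {μs : ℕ → ProbabilityMeasure ℂ} {μ : ProbabilityMeasure ℂ}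
    (h : Tendsto μs atTop (𝓝 μ)) (y : ℂ) :
    Tendsto (fun n => outDensity a (μs n) y) atTop (𝓝 (outDensity a μ y)) := by
  have hc := continuous_noiseDensity a
  exact ProbabilityMeasure.tendsto_iff_forall_integral_tendsto.1 h
    (BoundedContinuousFunction.ofNormedAddCommGroup (fun x => noiseDensity a (y - x)) (by fun_prop) Real.pi⁻¹
      fun x => by
        rw [Real.norm_of_nonneg (noiseDensity_pos _ _).le]
        exact noiseDensity_le _ _)

lemma relEntropy_nonneg {t q : ℝ} (ht : 0 < t) (hq : 0 < q) :
    0 ≤ t * (Real.log t - Real.log q) + (q - t) := by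
  have h := Real.log_le_sub_one_of_pos (div_pos hq ht)
  rw [Real.log_div hq.ne' ht.ne'] at h
  have h' := mul_le_mul_of_nonneg_left h ht.le
  have e : t * (q / t - 1) = q - t := by field_simp
  rw [e] at h'
  linarith

/-- The output entropy is upper semicontinuous along weakly convergent sequences of bounded power. -/
lemma le_outEntropy_of_tendsto (a : ℝ) {μs : ℕ → ProbabilityMeasure ℂ} {μ : ProbabilityMeasure ℂ}
    (h : Tendsto μs atTop (𝓝 μ)) {S H : ℝ}
    (hi : ∀ n, Integrable (fun x : ℂ => ‖x‖ ^ 2) (μs n : Measure ℂ))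
    (hS : ∀ n, ∫ x, ‖x‖ ^ 2 ∂(μs n : Measure ℂ) ≤ S)
    (hμ : Integrable (fun x : ℂ => ‖x‖ ^ 2) (μ : Measure ℂ))
    (hH : Tendsto (fun n => outEntropy a (μs n)) atTop (𝓝 H)) : H ≤ outEntropy a μ := by
  suffices key : ∀ b : ℝ, 0 < b → H ≤ outEntropy a μ + b * (S + noisePower a) by
    have : Tendsto (fun b : ℝ => outEntropy a μ + b * (S + noisePower a)) (𝓝[>] 0)
        (𝓝 (outEntropy a μ + 0 * (S + noisePower a))) := by
      refine Tendsto.mono_left ?_ nhdsWithin_le_nhds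
      exact Continuous.tendsto (by fun_prop) 0
    rw [zero_mul, add_zero] at this
    exact ge_of_tendsto this (eventually_mem_nhdsWithin.mono fun b hb => key b hb)
  intro b hb
  -- Entropy is compared with an unnormalized Gaussian so that the integrand `k` is nonnegative and
  -- Fatou applies. The cost of the comparison is at most `b (S + noisePower a)`, which vanishes as
  -- `b → 0`.
  set q : ℂ → ℝ := fun y => Real.exp (-b * ‖y‖ ^ 2) with hq
  have hqi : Integrable q := integrable_exp_neg_mul_norm_sq hb
  set k : Measure ℂ → ℂ → ℝ := fun ν y =>
    outDensity a ν y * (Real.log (outDensity a ν y) - Real.log (q y)) + (q y - outDensity a ν y) with hk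
  have hk0 : ∀ (ν : Measure ℂ) [IsProbabilityMeasure ν] (y), 0 ≤ k ν y := fun ν _ y =>
    relEntropy_nonneg (outDensity_pos _ _ _) (Real.exp_pos _)
  have hkint : ∀ (ν : Measure ℂ) [IsProbabilityMeasure ν], Integrable (fun x : ℂ => ‖x‖ ^ 2) ν →
      Integrable (k ν) ∧
      ∫ y, k ν y = -outEntropy a ν + b * (∫ x, ‖x‖ ^ 2 ∂ν + noisePower a) + ((∫ y, q y) - 1) := by
    intro ν _ hν
    have i1 : Integrable fun y => outDensity a ν y * -Real.log (outDensity a ν y) := integrable_mul_log hν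
    have i2 : Integrable fun y => outDensity a ν y * ‖y‖ ^ 2 :=
      (integrable_conv_iff_mul _).1 (integrable_norm_sq_conv hν)
    have i3 : Integrable fun y => q y - outDensity a ν y := hqi.sub integrable_outDensity
    have e : k ν = fun y => -(outDensity a ν y * -Real.log (outDensity a ν y))
        + b * (outDensity a ν y * ‖y‖ ^ 2) + (q y - outDensity a ν y) := by
      ext y
      simp only [hk, hq, Real.log_exp]
      ring
    have i1' : Integrable fun y => -(outDensity a ν y * -Real.log (outDensity a ν y)) := i1.neg
    have i4 : Integrable fun y => -(outDensity a ν y * -Real.log (outDensity a ν y))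
        + b * (outDensity a ν y * ‖y‖ ^ 2) := i1'.add (i2.const_mul b)
    refine ⟨by rw [e]; exact i4.add i3, ?_⟩
    rw [e, integral_add i4 i3, integral_add i1' (i2.const_mul b), integral_neg, integral_const_mul,
      integral_sub hqi integrable_outDensity, integral_outDensity, ← integral_conv_eq_integral_mul,
      ← integral_conv_eq_integral_mul, integral_norm_sq_conv hν, outEntropy]
  have hkc : ∀ (ν : Measure ℂ) [IsProbabilityMeasure ν], Continuous (k ν) := by
    intro ν _
    have e1 := continuous_outDensity a ν
    have e2 := e1.log fun y => (outDensity_pos a ν y).ne'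
    have e3 : Continuous q := by fun_prop
    have e4 := e3.log fun y => (Real.exp_pos _).ne'
    fun_prop
  have hkt : ∀ y, Tendsto (fun n => ENNReal.ofReal (k (μs n) y)) atTop (𝓝 (ENNReal.ofReal (k μ y))) := by
    intro y
    refine ENNReal.tendsto_ofReal ?_
    have h1 := tendsto_outDensity a h y
    have h2 := h1.log (outDensity_pos a (μ : Measure ℂ) y).ne'
    exact (h1.mul (h2.sub tendsto_const_nhds)).add (tendsto_const_nhds.sub h1)
  set C : ℕ → ℝ := fun n => -outEntropy a (μs n) + b * (S + noisePower a) + ((∫ y, q y) - 1) with hC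
  have hkC : ∀ n, ∫ y, k (μs n) y ≤ C n := by
    intro n
    rw [(hkint _ (hi n)).2]
    have := mul_le_mul_of_nonneg_left (hS n) hb.le
    simp only [hC]
    linarith
  have hC0 : ∀ n, 0 ≤ C n := fun n => (integral_nonneg fun y => hk0 _ y).trans (hkC n)
  have hCt : Tendsto C atTop (𝓝 (-H + b * (S + noisePower a) + ((∫ y, q y) - 1))) :=
    (hH.neg.add tendsto_const_nhds).add tendsto_const_nhds
  have hfatou : ENNReal.ofReal (∫ y, k μ y)
      ≤ ENNReal.ofReal (-H + b * (S + noisePower a) + ((∫ y, q y) - 1)) := by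
    rw [ofReal_integral_eq_lintegral_ofReal (hkint _ hμ).1 (.of_forall fun y => hk0 _ y)]
    calc ∫⁻ y, ENNReal.ofReal (k μ y)
        = ∫⁻ y, liminf (fun n => ENNReal.ofReal (k (μs n) y)) atTop :=
          lintegral_congr fun y => (hkt y).liminf_eq.symm
      _ ≤ liminf (fun n => ∫⁻ y, ENNReal.ofReal (k (μs n) y)) atTop :=
          lintegral_liminf_le fun n => (hkc _).measurable.ennreal_ofReal
      _ ≤ liminf (fun n => ENNReal.ofReal (C n)) atTop := by
          refine liminf_le_liminf (.of_forall fun n => ?_)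
          rw [← ofReal_integral_eq_lintegral_ofReal (hkint _ (hi n)).1 (.of_forall fun y => hk0 _ y)]
          exact ENNReal.ofReal_le_ofReal (hkC n)
      _ = _ := (ENNReal.tendsto_ofReal hCt).liminf_eq
  rw [ENNReal.ofReal_le_ofReal_iff (ge_of_tendsto' hCt hC0), (hkint _ hμ).2] at hfatou
  have : 0 ≤ b * (∫ x, ‖x‖ ^ 2 ∂(μ : Measure ℂ) + noisePower a) :=
    mul_nonneg hb.le (add_nonneg (integral_nonneg fun x => by positivity) (noisePower_nonneg a))
  linarith

/-- Markov's inequality for `|x|²`, uniformly over the admissible laws. -/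
lemma isTightMeasureSet_admissible (snr : ℝ) : IsTightMeasureSet (admissible snr) := by
  rw [isTightMeasureSet_iff_exists_isCompact_measure_compl_le]
  intro ε hε
  have ht : Tendsto (fun R : ℝ => ENNReal.ofReal snr / ENNReal.ofReal R) atTop (𝓝 0) :=
    ENNReal.Tendsto.const_div ENNReal.tendsto_ofReal_atTop (.inr ENNReal.ofReal_ne_top)
      |>.trans_eq (by simp)
  obtain ⟨R, hR, hR1⟩ := ((ht.eventually_le_const hε).and (eventually_gt_atTop 0)).exists
  refine ⟨Metric.closedBall 0 (Real.sqrt R), isCompact_closedBall _ _, fun μ hμ => ?_⟩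
  obtain ⟨hp, hm⟩ := hμ
  refine le_trans ?_ hR
  refine le_trans (measure_mono ?_) ((meas_ge_le_lintegral_div (f := fun x : ℂ => ENNReal.ofReal (‖x‖ ^ 2))
    (by fun_prop) (ε := ENNReal.ofReal R) (by simpa using hR1) (by simp)).trans (by gcongr))
  intro x hx
  simp only [Set.mem_compl_iff, mem_closedBall_zero_iff, not_le] at hx
  rw [Set.mem_ofPred_eq]
  refine ENNReal.ofReal_le_ofReal ?_
  rw [Real.sqrt_lt' (lt_of_le_of_lt (Real.sqrt_nonneg _) hx)] at hx
  exact hx.le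

/-- Power is lower semicontinuous under weak convergence, by the portmanteau theorem on open sets.
-/
lemma mem_admissible_of_tendsto {snr : ℝ} {μs : ℕ → ProbabilityMeasure ℂ} {μ : ProbabilityMeasure ℂ}
    (h : Tendsto μs atTop (𝓝 μ)) (hs : ∀ n, (μs n : Measure ℂ) ∈ admissible snr) :
    (μ : Measure ℂ) ∈ admissible snr := by
  refine ⟨inferInstance, ?_⟩
  refine (lintegral_le_liminf_lintegral_of_forall_isOpen_measure_le_liminf_measure
    (f := fun x : ℂ => ‖x‖ ^ 2) (μs := fun n => (μs n : Measure ℂ)) (by fun_prop)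
    (fun x => by positivity) fun G hG => ProbabilityMeasure.le_liminf_measure_open_of_tendsto h hG).trans ?_
  refine liminf_le_of_frequently_le' (.of_forall fun n => (hs n).2)

/-- By Prokhorov a maximizing sequence has a weakly convergent subsequence, and semicontinuity shows
that its limit is a maximizer. The entropies are bounded above by the mean loss relative to the
noise law, which has quadratic growth. -/
lemma exists_isMaxOn_outEntropy (a : ℝ) {snr : ℝ} (hsnr : 0 ≤ snr) :
    ∃ μ ∈ admissible snr, ∀ ν ∈ admissible snr, outEntropy a ν ≤ outEntropy a μ := by
  have h0 : Measure.dirac (0 : ℂ) ∈ admissible snr := ⟨inferInstance, by simp⟩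
  have hbdd : BddAbove (outEntropy a '' admissible snr) := by
    obtain ⟨A, hA⟩ := (quadGrowth_outDensity a (Measure.dirac 0)).2
    refine ⟨A * (1 + (snr + noisePower a)), ?_⟩
    rintro _ ⟨μ, hμ, rfl⟩
    obtain ⟨hp, hi, hs⟩ := (mem_admissible_iff hsnr).1 hμ
    have hA0 : 0 ≤ A := by simpa using (abs_nonneg _).trans (hA 0)
    have hic := integrable_norm_sq_conv (a := a) hi
    calc outEntropy a μ ≤ ∫ x, loss a (Measure.dirac 0) x ∂μ := outEntropy_le_integral_loss hi
      _ = ∫ y, -Real.log (outDensity a (Measure.dirac 0) y) ∂(μ ∗ noise a) :=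
        ((quadGrowth_outDensity a (Measure.dirac 0)).integral_conv hi).symm
      _ ≤ ∫ y, A * (1 + ‖y‖ ^ 2) ∂(μ ∗ noise a) :=
        integral_mono ((quadGrowth_outDensity a (Measure.dirac 0)).integrable hic)
          (((integrable_const _).add hic).const_mul A) fun y => (le_abs_self _).trans (hA y)
      _ = A * (1 + (∫ x, ‖x‖ ^ 2 ∂μ + noisePower a)) := by
        rw [integral_const_mul, integral_add (integrable_const _) hic, integral_norm_sq_conv hi]
        simp
      _ ≤ _ := by gcongr
  obtain ⟨u, -, hu, hmem⟩ := exists_seq_tendsto_sSup (Set.Nonempty.image _ ⟨_, h0⟩) hbdd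
  choose ν hν hνu using hmem
  let μs : ℕ → ProbabilityMeasure ℂ := fun n => ⟨ν n, (hν n).1⟩
  have hcomp : IsCompact (closure {μ : ProbabilityMeasure ℂ | (μ : Measure ℂ) ∈ admissible snr}) := by
    refine isCompact_closure_of_isTightMeasureSet ((isTightMeasureSet_admissible snr).subset ?_)
    rintro _ ⟨μ, hμ, rfl⟩
    exact hμ
  obtain ⟨μ, -, φ, hφ, hlim⟩ := hcomp.tendsto_subseq (x := μs) fun n => subset_closure (hν n)
  have hμ : (μ : Measure ℂ) ∈ admissible snr := mem_admissible_of_tendsto hlim fun n => hν (φ n)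
  refine ⟨μ, hμ, fun ν' hν' => (le_csSup hbdd ⟨ν', hν', rfl⟩).trans ?_⟩
  refine le_outEntropy_of_tendsto a hlim (S := snr) (fun n => ((mem_admissible_iff hsnr).1 (hν (φ n))).2.1)
    (fun n => ((mem_admissible_iff hsnr).1 (hν (φ n))).2.2) ((mem_admissible_iff hsnr).1 hμ).2.1 ?_
  refine (hu.comp hφ.tendsto_atTop).congr fun n => ?_
  simp only [Function.comp]
  rw [← hνu]
  rfl

/-! ### Injectivity of convolution with the noise. -/

lemma charFun_complexGaussian (ξ : ℂ) : charFun complexGaussian ξ = Complex.exp (-‖ξ‖ ^ 2 / 4) := by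
  have hm := continuous_gaussDensity.measurable
  have h := GaussianFourier.integral_cexp_neg_mul_sq_norm_add (b := 1) (V := ℂ) (by simp) Complex.I ξ
  rw [charFun_apply, complexGaussian_eq, integral_withDensity_eq_integral_toReal_smul (by fun_prop) (by simp)]
  have e : ∀ w : ℂ, (ENNReal.ofReal (gaussDensity w)).toReal • Complex.exp (↑(inner ℝ w ξ) * Complex.I)
      = (Real.pi : ℂ)⁻¹ * Complex.exp (-1 * ‖w‖ ^ 2 + Complex.I * ↑(inner ℝ ξ w)) := by
    intro w
    rw [ENNReal.toReal_ofReal (gaussDensity_pos w).le, gaussDensity, Complex.real_smul, Complex.exp_add,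
      real_inner_comm]
    push_cast
    rw [mul_comm Complex.I]
    ring_nf
  simp_rw [e]
  rw [integral_const_mul, h, Complex.finrank_real_complex]
  have hpi : (Real.pi : ℂ) ≠ 0 := by exact_mod_cast Real.pi_ne_zero
  simp [Complex.I_sq, hpi]

lemma charFun_noise (a : ℝ) (ξ : ℂ) :
    charFun (noise a) ξ = charFun (ringLaw a) ξ * Complex.exp (-‖ξ‖ ^ 2 / 4) := by
  rw [noise, charFun_conv, charFun_complexGaussian]

lemma differentiable_charFun_ringLaw (a : ℝ) (ξ : ℂ) :
    Differentiable ℂ fun z : ℂ => ∫ u, Complex.exp (z * (inner ℝ u ξ : ℝ) * Complex.I) ∂ringLaw a := by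
  intro z₀
  refine differentiableAt_integral_of_dominated (δ := 1)
    (g := fun _ => Real.exp ((‖z₀‖ + 1) * (|a| * ‖ξ‖))) one_pos (integrable_const _) ?_ ?_ ?_
  · intro z _
    exact Continuous.aestronglyMeasurable (by fun_prop)
  · refine .of_forall fun u => Differentiable.differentiableOn (by fun_prop)
  · filter_upwards [ae_norm_ringLaw a] with u hu z hz
    rw [Complex.norm_exp]
    refine Real.exp_le_exp.2 ((Complex.re_le_norm _).trans ?_)
    rw [norm_mul, norm_mul, Complex.norm_I, mul_one, Complex.norm_real, ← hu]
    have h1 : ‖z‖ ≤ ‖z₀‖ + 1 := by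
      have := norm_sub_norm_le z z₀
      rw [Metric.mem_ball, dist_eq_norm] at hz
      linarith
    have h2 := norm_inner_le_norm (𝕜 := ℝ) u ξ
    gcongr

/-- Along a ray the circle's characteristic function is entire in the scale and equals `1` at scale
`0`, so its zeros are isolated. Non-vanishing at nearby scales is enough to cancel it and pass to
the limit. -/
lemma eventually_charFun_noise_ne_zero (a : ℝ) (ξ : ℂ) :
    ∀ᶠ t : ℝ in 𝓝[≠] 1, charFun (noise a) (t • ξ) ≠ 0 := by
  set E : ℂ → ℂ := fun z => ∫ u, Complex.exp (z * (inner ℝ u ξ : ℝ) * Complex.I) ∂ringLaw a with hE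
  have hd : Differentiable ℂ E := differentiable_charFun_ringLaw a ξ
  have han : AnalyticOnNhd ℂ E Set.univ := fun z _ => hd.analyticAt z
  have h1 : ∀ᶠ z in 𝓝[≠] (1 : ℂ), E z ≠ 0 := by
    rcases (hd.analyticAt 1).eventually_eq_zero_or_eventually_ne_zero with h | h
    · have := han.eqOn_zero_of_preconnected_of_eventuallyEq_zero isPreconnected_univ (Set.mem_univ 1) h
        (Set.mem_univ 0)
      simp [hE] at this
    · exact h
  have ht : Tendsto (fun t : ℝ => (t : ℂ)) (𝓝[≠] 1) (𝓝[≠] 1) := by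
    refine tendsto_nhdsWithin_of_tendsto_nhds_of_eventually_within _ ?_ ?_
    · exact (Complex.continuous_ofReal.tendsto' 1 1 (by simp)).mono_left nhdsWithin_le_nhds
    · filter_upwards [self_mem_nhdsWithin] with t ht
      simpa using ht
  filter_upwards [ht.eventually h1] with t ht
  rw [charFun_noise]
  refine mul_ne_zero ?_ (Complex.exp_ne_zero _)
  convert! ht using 1
  simp only [hE, charFun_apply]
  refine integral_congr_ae (.of_forall fun u => ?_)
  simp only [real_inner_smul_right, Complex.ofReal_mul]

/-- Convolution with the noise is injective on probability measures. -/
lemma eq_of_conv_noise_eq {a : ℝ} {μ μ' : Measure ℂ} [IsProbabilityMeasure μ] [IsProbabilityMeasure μ']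
    (h : μ ∗ noise a = μ' ∗ noise a) : μ = μ' := by
  refine Measure.ext_of_charFun (funext fun ξ => ?_)
  have hev : ∀ᶠ t : ℝ in 𝓝[≠] 1, charFun μ (t • ξ) = charFun μ' (t • ξ) := by
    filter_upwards [eventually_charFun_noise_ne_zero a ξ] with t ht
    have := congrArg (fun ν => charFun ν (t • ξ)) h
    simp only [charFun_conv] at this
    exact mul_right_cancel₀ ht this
  have hlim : ∀ ν : Measure ℂ, IsProbabilityMeasure ν →
      Tendsto (fun t : ℝ => charFun ν (t • ξ)) (𝓝[≠] 1) (𝓝 (charFun ν ξ)) := by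
    intro ν _
    have : Continuous fun t : ℝ => charFun ν (t • ξ) := continuous_charFun.comp (by fun_prop)
    exact (this.tendsto' 1 _ (by simp)).mono_left nhdsWithin_le_nhds
  exact tendsto_nhds_unique_of_eventuallyEq (hlim μ inferInstance) (hlim μ' inferInstance) hev

lemma eq_of_outDensity_eq {a : ℝ} {μ μ' : Measure ℂ} [IsProbabilityMeasure μ] [IsProbabilityMeasure μ']
    (h : outDensity a μ = outDensity a μ') : μ = μ' :=
  eq_of_conv_noise_eq (a := a) (by rw [conv_noise_eq, conv_noise_eq, h])

/-! ### Mixtures, uniqueness and the Karush–Kuhn–Tucker conditions. -/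

/-- The mixture `(1 - t) μ + t μ'`. -/
def mix (t : ℝ) (μ μ' : Measure ℂ) : Measure ℂ :=
  ENNReal.ofReal (1 - t) • μ + ENNReal.ofReal t • μ'

section mix

variable {t : ℝ} {μ μ' : Measure ℂ}

lemma isProbabilityMeasure_mix [IsProbabilityMeasure μ] [IsProbabilityMeasure μ'] (h0 : 0 ≤ t) (h1 : t ≤ 1) :
    IsProbabilityMeasure (mix t μ μ') := by
  refine ⟨?_⟩
  simp only [mix, Measure.coe_add, Measure.coe_smul, Pi.add_apply, Pi.smul_apply, measure_univ, smul_eq_mul,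
    mul_one]
  rw [← ENNReal.ofReal_add (by linarith) h0]
  simp

lemma integrable_mix {g : ℂ → ℝ} (h : Integrable g μ) (h' : Integrable g μ') : Integrable g (mix t μ μ') :=
  (h.smul_measure ENNReal.ofReal_ne_top).add_measure (h'.smul_measure ENNReal.ofReal_ne_top)

lemma integral_mix {g : ℂ → ℝ} (h0 : 0 ≤ t) (h1 : t ≤ 1) (h : Integrable g μ) (h' : Integrable g μ') :
    ∫ x, g x ∂mix t μ μ' = (1 - t) * ∫ x, g x ∂μ + t * ∫ x, g x ∂μ' := by
  rw [mix, integral_add_measure (h.smul_measure ENNReal.ofReal_ne_top)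
    (h'.smul_measure ENNReal.ofReal_ne_top), integral_smul_measure, integral_smul_measure,
    ENNReal.toReal_ofReal (by linarith), ENNReal.toReal_ofReal h0, smul_eq_mul, smul_eq_mul]

lemma outDensity_mix [IsProbabilityMeasure μ] [IsProbabilityMeasure μ'] (a : ℝ) (h0 : 0 ≤ t) (h1 : t ≤ 1)
    (y : ℂ) : outDensity a (mix t μ μ') y = (1 - t) * outDensity a μ y + t * outDensity a μ' y :=
  integral_mix h0 h1
    (integrable_smoothed (continuous_noiseDensity a) (fun w => (noiseDensity_pos a w).le) (noiseDensity_le a) y)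
    (integrable_smoothed (continuous_noiseDensity a) (fun w => (noiseDensity_pos a w).le) (noiseDensity_le a) y)

lemma mix_mem_admissible {snr : ℝ} (hsnr : 0 ≤ snr) (h0 : 0 ≤ t) (h1 : t ≤ 1) (hμ : μ ∈ admissible snr)
    (hμ' : μ' ∈ admissible snr) : mix t μ μ' ∈ admissible snr := by
  rw [mem_admissible_iff hsnr] at *
  obtain ⟨hp, hi, hs⟩ := hμ
  obtain ⟨hp', hi', hs'⟩ := hμ'
  refine ⟨isProbabilityMeasure_mix h0 h1, integrable_mix hi hi', ?_⟩
  rw [integral_mix h0 h1 hi hi']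
  have := mul_le_mul_of_nonneg_left hs (sub_nonneg.2 h1)
  have := mul_le_mul_of_nonneg_left hs' h0
  linarith

lemma outEntropy_mix [IsProbabilityMeasure μ] [IsProbabilityMeasure μ'] (a : ℝ) (h0 : 0 ≤ t) (h1 : t ≤ 1)
    (hi : Integrable (fun x : ℂ => ‖x‖ ^ 2) μ) (hi' : Integrable (fun x : ℂ => ‖x‖ ^ 2) μ') :
    outEntropy a (mix t μ μ') =
      (1 - t) * ∫ x, loss a (mix t μ μ') x ∂μ + t * ∫ x, loss a (mix t μ μ') x ∂μ' := by
  have := isProbabilityMeasure_mix (μ := μ) (μ' := μ') h0 h1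
  rw [outEntropy_eq_integral_loss (integrable_mix hi hi'),
    integral_mix h0 h1 (integrable_loss hi) (integrable_loss hi')]

end mix

/-- `μ` maximizes the output entropy under the power constraint. -/
def IsOptimal (a snr : ℝ) (μ : Measure ℂ) : Prop :=
  μ ∈ admissible snr ∧ ∀ ν ∈ admissible snr, outEntropy a ν ≤ outEntropy a μ

section optimal

variable {a snr : ℝ} {μ : Measure ℂ}

/-- Strict concavity: the midpoint cannot beat the maximum, so Gibbs' inequality is an equality for
both laws, and both output densities equal that of the midpoint. -/
lemma IsOptimal.unique (hsnr : 0 ≤ snr) {μ' : Measure ℂ} (h : IsOptimal a snr μ) (h' : IsOptimal a snr μ') :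
    μ = μ' := by
  obtain ⟨hp, hi, hs⟩ := (mem_admissible_iff hsnr).1 h.1
  obtain ⟨hp', hi', hs'⟩ := (mem_admissible_iff hsnr).1 h'.1
  have h0 : (0 : ℝ) ≤ 1 / 2 := by norm_num
  have h1 : (1 / 2 : ℝ) ≤ 1 := by norm_num
  have hpm := isProbabilityMeasure_mix (μ := μ) (μ' := μ') h0 h1
  have e := h.2 _ (mix_mem_admissible hsnr h0 h1 h.1 h'.1)
  rw [outEntropy_mix a h0 h1 hi hi'] at e
  have g := outEntropy_le_integral_loss (a := a) (μ' := mix (1 / 2) μ μ') hi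
  have g' := outEntropy_le_integral_loss (a := a) (μ' := mix (1 / 2) μ μ') hi'
  have hle := h.2 _ h'.1
  have hle' := h'.2 _ h.1
  have d := outDensity_eq_of_integral_loss_le hi (μ' := mix (1 / 2) μ μ') (a := a) (by linarith)
  have d' := outDensity_eq_of_integral_loss_le hi' (μ' := mix (1 / 2) μ μ') (a := a) (by linarith)
  exact eq_of_outDensity_eq (d.trans d'.symm)

/-- First-order condition: the derivative of the entropy from `μ` towards `μ'` is the mean loss
under `μ'` minus the entropy. Gibbs' inequality along the mixtures replaces differentiation. -/
lemma IsOptimal.integral_loss_le (hsnr : 0 ≤ snr) (h : IsOptimal a snr μ) {μ' : Measure ℂ}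
    (h' : μ' ∈ admissible snr) : ∫ x, loss a μ x ∂μ' ≤ outEntropy a μ := by
  obtain ⟨hp, hi, hs⟩ := (mem_admissible_iff hsnr).1 h.1
  obtain ⟨hp', hi', hs'⟩ := (mem_admissible_iff hsnr).1 h'
  -- Weights at most `1/2` keep the mixed density above half of the density of `μ`, which provides
  -- the dominating function.
  set t : ℕ → ℝ := fun n => ((n : ℝ) + 2)⁻¹ with ht
  have ht0 : ∀ n, 0 < t n := fun n => by positivity
  have ht2 : ∀ n, t n ≤ 1 / 2 := fun n => by
    simp only [ht]
    rw [one_div]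
    exact inv_anti₀ two_pos (by linarith [n.cast_nonneg (α := ℝ)])
  have htt : Tendsto t atTop (𝓝 0) :=
    tendsto_inv_atTop_zero.comp (tendsto_natCast_atTop_atTop.atTop_add tendsto_const_nhds)
  have hle : ∀ n, ∫ x, loss a (mix (t n) μ μ') x ∂μ' ≤ outEntropy a μ := by
    intro n
    have h1 : t n ≤ 1 := (ht2 n).trans (by norm_num)
    have hpm := isProbabilityMeasure_mix (μ := μ) (μ' := μ') (ht0 n).le h1
    have e := h.2 _ (mix_mem_admissible hsnr (ht0 n).le h1 h.1 h')
    rw [outEntropy_mix a (ht0 n).le h1 hi hi'] at e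
    have g := mul_le_mul_of_nonneg_left
      (outEntropy_le_integral_loss (a := a) (μ' := mix (t n) μ μ') hi) (sub_nonneg.2 h1)
    refine le_of_mul_le_mul_left ?_ (ht0 n)
    linarith
  have hq := quadGrowth_outDensity a μ
  have hic := integrable_norm_sq_conv (a := a) hi'
  have hlim : Tendsto (fun n => ∫ x, loss a (mix (t n) μ μ') x ∂μ') atTop (𝓝 (∫ x, loss a μ x ∂μ')) := by
    have e : ∀ ν : Measure ℂ, IsProbabilityMeasure ν →
        ∫ x, loss a ν x ∂μ' = ∫ y, -Real.log (outDensity a ν y) ∂(μ' ∗ noise a) := fun ν _ =>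
      ((quadGrowth_outDensity a ν).integral_conv hi').symm
    have hpm : ∀ n, IsProbabilityMeasure (mix (t n) μ μ') := fun n =>
      isProbabilityMeasure_mix (ht0 n).le ((ht2 n).trans (by norm_num))
    rw [e μ hp]
    simp_rw [fun n => e _ (hpm n)]
    refine tendsto_integral_of_dominated_convergence
      (fun y => |-Real.log (outDensity a μ y)| + Real.log 2 + |Real.log Real.pi⁻¹|) ?_ ?_ ?_ ?_
    · intro n
      have := hpm n
      exact (quadGrowth_outDensity a (mix (t n) μ μ')).1.aestronglyMeasurable
    · exact ((hq.integrable hic).abs.add (integrable_const _)).add (integrable_const _)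
    · intro n
      have := hpm n
      refine .of_forall fun y => ?_
      have hp1 := outDensity_pos a μ y
      have hp2 := outDensity_pos a μ' y
      have hlow : outDensity a μ y / 2 ≤ outDensity a (mix (t n) μ μ') y := by
        rw [outDensity_mix a (ht0 n).le ((ht2 n).trans (by norm_num))]
        nlinarith [ht2 n, ht0 n, mul_pos (ht0 n) hp2]
      have l1 := Real.log_le_log (by positivity) hlow
      have l2 := Real.log_le_log (outDensity_pos a (mix (t n) μ μ') y) (outDensity_le a _ y)
      rw [Real.log_div hp1.ne' two_ne_zero] at l1
      rw [norm_neg, Real.norm_eq_abs, abs_le]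
      have := neg_abs_le (-Real.log (outDensity a μ y))
      have := le_abs_self (-Real.log (outDensity a μ y))
      have := le_abs_self (Real.log Real.pi⁻¹)
      have := Real.log_pos one_lt_two
      have := abs_nonneg (Real.log Real.pi⁻¹)
      have := abs_nonneg (-Real.log (outDensity a μ y))
      constructor <;> linarith
    · refine .of_forall fun y => ?_
      refine (Tendsto.log ?_ (outDensity_pos a μ y).ne').neg
      have : Tendsto (fun n => (1 - t n) * outDensity a μ y + t n * outDensity a μ' y) atTop
          (𝓝 ((1 - 0) * outDensity a μ y + 0 * outDensity a μ' y)) :=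
        ((tendsto_const_nhds.sub htt).mul_const _).add (htt.mul_const _)
      rw [sub_zero, one_mul, zero_mul, add_zero] at this
      refine this.congr fun n => ?_
      rw [outDensity_mix a (ht0 n).le ((ht2 n).trans (by norm_num))]
  exact le_of_tendsto' hlim hle

lemma integrable_norm_sq_dirac (x : ℂ) : Integrable (fun x : ℂ => ‖x‖ ^ 2) (Measure.dirac x) :=
  integrable_dirac (by simp)

/-- The Karush–Kuhn–Tucker conditions for the optimal input. -/
lemma IsOptimal.exists_multiplier (hsnr : 0 < snr) (h : IsOptimal a snr μ) :
    ∃ l : ℝ, 0 ≤ l ∧ (∀ x, loss a μ x ≤ outEntropy a μ + l * (‖x‖ ^ 2 - snr)) ∧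
      ∀ᵐ x ∂μ, loss a μ x = outEntropy a μ + l * (‖x‖ ^ 2 - snr) := by
  obtain ⟨hp, hi, hs⟩ := (mem_admissible_iff hsnr.le).1 h.1
  set H := outEntropy a μ with hH
  have hint : ∀ x, Integrable (loss a μ) (Measure.dirac x) := fun x =>
    integrable_loss (integrable_norm_sq_dirac x)
  have hpt : ∀ x : ℂ, ‖x‖ ^ 2 ≤ snr → loss a μ x ≤ H := by
    intro x hx
    have := h.integral_loss_le hsnr.le (μ' := Measure.dirac x)
      ((mem_admissible_iff hsnr.le).2 ⟨inferInstance, integrable_norm_sq_dirac x, by simpa using hx⟩)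
    simpa using this
  -- The two-point law on `x` and `y` with power exactly `snr` is admissible; its first-order
  -- condition orders the slopes on either side of `snr`.
  have htwo : ∀ x y : ℂ, ‖x‖ ^ 2 < snr → snr < ‖y‖ ^ 2 →
      (loss a μ y - H) / (‖y‖ ^ 2 - snr) ≤ (loss a μ x - H) / (‖x‖ ^ 2 - snr) := by
    intro x y hx hy
    set s : ℝ := (snr - ‖x‖ ^ 2) / (‖y‖ ^ 2 - ‖x‖ ^ 2) with hsdef
    have hd : 0 < ‖y‖ ^ 2 - ‖x‖ ^ 2 := by linarith
    have hs0 : 0 ≤ s := div_nonneg (by linarith) hd.le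
    have hs1 : s ≤ 1 := by rw [hsdef, div_le_one hd]; linarith
    have hsd : s * (‖y‖ ^ 2 - ‖x‖ ^ 2) = snr - ‖x‖ ^ 2 := div_mul_cancel₀ _ hd.ne'
    have hm := h.integral_loss_le hsnr.le (μ' := mix s (Measure.dirac x) (Measure.dirac y))
      ((mem_admissible_iff hsnr.le).2 ⟨isProbabilityMeasure_mix hs0 hs1,
        integrable_mix (integrable_norm_sq_dirac x) (integrable_norm_sq_dirac y), by
          rw [integral_mix hs0 hs1 (integrable_norm_sq_dirac x) (integrable_norm_sq_dirac y), integral_dirac,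
            integral_dirac]
          linarith⟩)
    rw [integral_mix hs0 hs1 (hint x) (hint y), integral_dirac, integral_dirac] at hm
    have hmul := mul_le_mul_of_nonneg_right hm hd.le
    rw [div_le_iff₀ (by linarith), div_mul_eq_mul_div, ← neg_div_neg_eq, le_div_iff₀ (by linarith)]
    have e1 : ((1 - s) * loss a μ x + s * loss a μ y) * (‖y‖ ^ 2 - ‖x‖ ^ 2)
        = (‖y‖ ^ 2 - snr) * loss a μ x + (snr - ‖x‖ ^ 2) * loss a μ y := by
      linear_combination (loss a μ y - loss a μ x) * hsd
    rw [e1] at hmul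
    linarith
  -- The multiplier is the infimum of the slopes from inside the power level; it dominates all the
  -- slopes from outside.
  set A : Set ℝ := (fun x : ℂ => (loss a μ x - H) / (‖x‖ ^ 2 - snr)) '' {x | ‖x‖ ^ 2 < snr} with hA
  have hne : A.Nonempty := ⟨_, 0, by simpa using hsnr, rfl⟩
  have hA0 : ∀ r ∈ A, 0 ≤ r := by
    rintro _ ⟨x, hx, rfl⟩
    have hx' : ‖x‖ ^ 2 < snr := hx
    exact div_nonneg_of_nonpos (by linarith [hpt x hx'.le]) (by linarith)
  have hle : ∀ x, loss a μ x ≤ H + sInf A * (‖x‖ ^ 2 - snr) := by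
    intro x
    rcases lt_trichotomy (‖x‖ ^ 2) snr with hx | hx | hx
    · have : sInf A ≤ (loss a μ x - H) / (‖x‖ ^ 2 - snr) := csInf_le ⟨0, hA0⟩ ⟨x, hx, rfl⟩
      rw [le_div_iff_of_neg (by linarith)] at this
      linarith
    · rw [hx]; linarith [hpt x hx.le]
    · have : (loss a μ x - H) / (‖x‖ ^ 2 - snr) ≤ sInf A := by
        refine le_csInf hne ?_
        rintro _ ⟨y, hy, rfl⟩
        exact htwo y x hy hx
      rw [div_le_iff₀ (by linarith)] at this
      linarith
  have hl0 : 0 ≤ sInf A := le_csInf hne hA0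
  refine ⟨sInf A, hl0, hle, ?_⟩
  have i1 : Integrable (fun x => H + sInf A * (‖x‖ ^ 2 - snr)) μ :=
    (integrable_const _).add ((hi.sub (integrable_const _)).const_mul _)
  have hnn : 0 ≤ fun x => H + sInf A * (‖x‖ ^ 2 - snr) - loss a μ x := fun x => sub_nonneg.2 (hle x)
  have i2 : Integrable (fun x => H + sInf A * (‖x‖ ^ 2 - snr) - loss a μ x) μ := i1.sub (integrable_loss hi)
  have i3 : Integrable (fun x : ℂ => ‖x‖ ^ 2 - snr) μ := hi.sub (integrable_const _)
  -- The integral equals the multiplier times `E|X|² - snr ≤ 0`, while the integrand is nonnegative.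
  have hz : ∫ x, (H + sInf A * (‖x‖ ^ 2 - snr) - loss a μ x) ∂μ = 0 := by
    refine le_antisymm ?_ (integral_nonneg hnn)
    rw [integral_sub i1 (integrable_loss hi), ← outEntropy_eq_integral_loss hi,
      integral_add (integrable_const _) (i3.const_mul _), integral_const_mul,
      integral_sub hi (integrable_const _)]
    simp only [integral_const, probReal_univ, one_smul, ← hH]
    nlinarith
  rw [integral_eq_zero_iff_of_nonneg hnn i2] at hz
  filter_upwards [hz] with x hx
  simp only [Pi.zero_apply] at hx
  linarith

end optimal

/-! ### Rotation invariance of the optimal input. -/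

lemma noiseDensity_mul (a : ℝ) {c : ℂ} (hc : ‖c‖ = 1) (w : ℂ) : noiseDensity a (c * w) = noiseDensity a w := by
  have hG := continuous_gaussDensity
  unfold noiseDensity smoothed
  conv_lhs => rw [← map_mul_ringLaw a hc]
  rw [integral_map (by fun_prop) (by fun_prop)]
  refine integral_congr_ae (.of_forall fun u => ?_)
  simp only [← mul_sub]
  simp [gaussDensity, hc]

lemma outDensity_map_mul (a : ℝ) (μ : Measure ℂ) {c : ℂ} (hc : ‖c‖ = 1) (y : ℂ) :
    outDensity a (μ.map fun u => c * u) (c * y) = outDensity a μ y := by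
  have hf := continuous_noiseDensity a
  unfold outDensity smoothed
  rw [integral_map (by fun_prop) (by fun_prop)]
  simp only [← mul_sub, noiseDensity_mul a hc]

lemma outEntropy_map_mul (a : ℝ) (μ : Measure ℂ) [IsProbabilityMeasure μ] {c : ℂ} (hc : ‖c‖ = 1) :
    outEntropy a (μ.map fun u => c * u) = outEntropy a μ := by
  have hp : IsProbabilityMeasure (μ.map fun u => c * u) := Measure.isProbabilityMeasure_map (by fun_prop)
  have hq := (quadGrowth_outDensity a (μ.map fun u => c * u)).1
  have e : (μ.map fun u => c * u) ∗ noise a = (μ ∗ noise a).map fun u => c * u := by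
    rw [map_mul_conv, map_mul_noise a hc]
  rw [outEntropy, e, integral_map (by fun_prop) hq.aestronglyMeasurable]
  simp only [outDensity_map_mul a μ hc]
  rfl

/-- Rotation preserves both power and output entropy, so a rotated optimum is optimal; uniqueness
identifies the two. -/
lemma IsOptimal.map_mul_eq {a snr : ℝ} {μ : Measure ℂ} (hsnr : 0 ≤ snr) (h : IsOptimal a snr μ) {c : ℂ}
    (hc : ‖c‖ = 1) : μ.map (fun u => c * u) = μ := by
  have hp := h.1.1
  refine IsOptimal.unique hsnr ⟨⟨Measure.isProbabilityMeasure_map (by fun_prop), ?_⟩, fun ν hν => ?_⟩ h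
  · rw [lintegral_map (by fun_prop) (by fun_prop)]
    simpa [hc] using h.1.2
  · rw [outEntropy_map_mul a μ hc]
    exact h.2 ν hν

/-- The mean of a function over the circle through `x`. -/
lemma integral_ringLaw_norm (f : ℂ → ℝ) (hf : Continuous f) (x : ℂ) :
    ∫ θ, f (Complex.exp ((θ : ℂ) * Complex.I) * x) ∂uniformPhase = ∫ u, f u ∂ringLaw ‖x‖ := by
  set c : ℂ := Complex.exp (Complex.arg x * Complex.I) with hcdef
  have hc : ‖c‖ = 1 := Complex.norm_exp_ofReal_mul_I _
  conv_rhs => rw [← map_mul_ringLaw ‖x‖ hc]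
  rw [integral_map (by fun_prop) (by fun_prop), ringLaw, integral_map (by fun_prop) (by fun_prop)]
  refine integral_congr_ae (.of_forall fun θ => ?_)
  simp only
  congr 1
  conv_lhs => rw [← Complex.norm_mul_exp_arg_mul_I x]
  rw [hcdef]
  ring

/-- Averaging test integrals over all rotations changes nothing, and the average of `f` over the
rotations of `x` depends on `‖x‖` only. -/
lemma hasIndepUniformPhase_of_map_mul_eq {μ : Measure ℂ} [IsProbabilityMeasure μ]
    (h : ∀ c : ℂ, ‖c‖ = 1 → μ.map (fun u => c * u) = μ) : HasIndepUniformPhase μ := by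
  unfold HasIndepUniformPhase modulusLaw
  have hp : IsProbabilityMeasure (μ.map fun x : ℂ => ‖x‖) := Measure.isProbabilityMeasure_map (by fun_prop)
  have hp2 : IsProbabilityMeasure (((μ.map fun x : ℂ => ‖x‖).prod uniformPhase).map
      (fun p : ℝ × ℝ => (p.1 : ℂ) * Complex.exp ((p.2 : ℂ) * Complex.I))) :=
    Measure.isProbabilityMeasure_map (by fun_prop)
  refine ext_of_forall_integral_eq_of_IsFiniteMeasure fun f => ?_
  have hbdd : ∀ {α : Type} [MeasurableSpace α] {ν : Measure α} [IsFiniteMeasure ν] {g : α → ℂ},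
      Measurable g → Integrable (fun z => f (g z)) ν := by
    intro α _ ν _ g hg
    refine (integrable_const ‖f‖).mono' (f.continuous.measurable.comp hg).aestronglyMeasurable
      (.of_forall fun z => f.norm_coe_le_norm _)
  rw [integral_map (by fun_prop) (by fun_prop), integral_prod _ (hbdd (by fun_prop))]
  have e1 : ∀ r : ℝ, ∫ θ, f ((r : ℂ) * Complex.exp ((θ : ℂ) * Complex.I)) ∂uniformPhase
      = ∫ u, f u ∂ringLaw r := by
    intro r
    rw [ringLaw, integral_map (by fun_prop) (by fun_prop)]
  have e2 : ∀ θ : ℝ, ∫ x, f (Complex.exp ((θ : ℂ) * Complex.I) * x) ∂μ = ∫ x, f x ∂μ := by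
    intro θ
    conv_rhs => rw [← h _ (Complex.norm_exp_ofReal_mul_I θ)]
    rw [integral_map (by fun_prop) (by fun_prop)]
  have hmeas : AEStronglyMeasurable
      (fun r : ℝ => ∫ θ, f ((r : ℂ) * Complex.exp ((θ : ℂ) * Complex.I)) ∂uniformPhase)
      (μ.map fun x : ℂ => ‖x‖) :=
    (hbdd (ν := (μ.map fun x : ℂ => ‖x‖).prod uniformPhase)
      (g := fun p : ℝ × ℝ => (p.1 : ℂ) * Complex.exp ((p.2 : ℂ) * Complex.I))
      (by fun_prop)).integral_prod_left.aestronglyMeasurable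
  rw [integral_map (by fun_prop) hmeas]
  simp_rw [e1, ← integral_ringLaw_norm f f.continuous]
  rw [integral_integral_swap (hbdd (g := fun p : ℂ × ℝ => Complex.exp ((p.2 : ℂ) * Complex.I) * p.1)
    (by fun_prop))]
  simp_rw [e2]
  simp

/-! ### Unboundedness of the optimal support. -/

/-- The log-sum inequality for the noise density and its translate. -/
lemma noiseDensity_log_sum (a : ℝ) (x w : ℂ) :
    noiseDensity a w * (Real.log (noiseDensity a w) - Real.log (noiseDensity a (x + w))) ≤
      ∫ u, gaussDensity (w - u) * (‖x‖ ^ 2 + 2 * ((starRingEnd ℂ) x * (w - u)).re) ∂ringLaw a := by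
  have hG := continuous_gaussDensity
  set A := noiseDensity a w with hA
  set B := noiseDensity a (x + w) with hB
  have hA0 : 0 < A := noiseDensity_pos a w
  have hB0 : 0 < B := noiseDensity_pos a _
  have i1 : Integrable (fun u => gaussDensity (w - u)) (ringLaw a) :=
    integrable_smoothed hG (fun w => (gaussDensity_pos w).le) gaussDensity_le w
  have i2 : Integrable (fun u => gaussDensity (x + w - u)) (ringLaw a) :=
    integrable_smoothed hG (fun w => (gaussDensity_pos w).le) gaussDensity_le (x + w)
  -- The bound `log s ≤ s - 1`, with the translated Gaussian rescaled by `A / B` so that the linear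
  -- terms cancel after integration over the circle.
  have hpt : ∀ u, gaussDensity (w - u) * (Real.log A - Real.log B + 1) - A / B * gaussDensity (x + w - u) ≤
      gaussDensity (w - u) * (‖x‖ ^ 2 + 2 * ((starRingEnd ℂ) x * (w - u)).re) := by
    intro u
    have hg := gaussDensity_pos (w - u)
    have hh := gaussDensity_pos (x + w - u)
    have hAB : 0 < A / B := by positivity
    have key := relEntropy_nonneg hg (mul_pos hAB hh)
    rw [Real.log_mul hAB.ne' hh.ne', Real.log_div hA0.ne' hB0.ne'] at key
    have e : Real.log (gaussDensity (w - u)) - Real.log (gaussDensity (x + w - u))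
        = ‖x‖ ^ 2 + 2 * ((starRingEnd ℂ) x * (w - u)).re := by
      unfold gaussDensity
      rw [Real.log_mul (by positivity) (by positivity), Real.log_mul (by positivity) (by positivity),
        Real.log_exp, Real.log_exp, Complex.sq_norm, Complex.sq_norm, Complex.sq_norm, Complex.normSq_apply,
        Complex.normSq_apply, Complex.normSq_apply]
      simp
      ring
    rw [← e]
    linarith
  have i3 : Integrable (fun u => gaussDensity (w - u) * (‖x‖ ^ 2 + 2 * ((starRingEnd ℂ) x * (w - u)).re))
      (ringLaw a) := by
    refine (integrable_const (Real.pi⁻¹ * (‖x‖ ^ 2 + 2 * (‖x‖ * (‖w‖ + |a|))))).mono' (by fun_prop) ?_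
    filter_upwards [ae_norm_ringLaw a] with u hu
    rw [norm_mul, Real.norm_of_nonneg (gaussDensity_pos _).le]
    refine mul_le_mul (gaussDensity_le _) ?_ (norm_nonneg _) (by positivity)
    have h1 : |((starRingEnd ℂ) x * (w - u)).re| ≤ ‖x‖ * (‖w‖ + |a|) := by
      refine (Complex.abs_re_le_norm _).trans ?_
      rw [norm_mul, RCLike.norm_conj, ← hu]
      gcongr
      exact norm_sub_le _ _
    rw [Real.norm_eq_abs]
    refine (abs_add_le _ _).trans ?_
    rw [abs_mul, abs_of_nonneg (by positivity : (0 : ℝ) ≤ ‖x‖ ^ 2), abs_two]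
    linarith
  have i4 : Integrable (fun u => gaussDensity (w - u) * (Real.log A - Real.log B + 1)
      - A / B * gaussDensity (x + w - u)) (ringLaw a) := (i1.mul_const _).sub (i2.const_mul _)
  have h := integral_mono i4 i3 hpt
  rw [integral_sub (i1.mul_const _) (i2.const_mul _), integral_mul_const, integral_const_mul] at h
  have eA : ∫ u, gaussDensity (w - u) ∂ringLaw a = A := rfl
  have eB : ∫ u, gaussDensity (x + w - u) ∂ringLaw a = B := rfl
  rw [eA, eB, div_mul_cancel₀ _ hB0.ne'] at h
  linarith

open scoped Convolution in
-- The excess of the loss over the noise entropy is the divergence of the noise law from its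
-- translate. Mixing over the circle cannot raise it above the divergence `|x|²` of two Gaussians.
lemma loss_dirac_zero_le (a : ℝ) (x : ℂ) : loss a (Measure.dirac 0) x ≤ noiseEntropy a + ‖x‖ ^ 2 := by
  have hG := continuous_gaussDensity
  have hm := hG.measurable
  have hmf := (continuous_noiseDensity a).measurable
  set g : ℂ → ℝ := fun v => gaussDensity v * (‖x‖ ^ 2 + 2 * ((starRingEnd ℂ) x * v).re) with hg
  have hlin : Integrable (fun v : ℂ => ((starRingEnd ℂ) x * v).re) complexGaussian :=
    integrable_re_mul integrable_norm_sq_complexGaussian x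
  have hint : Integrable (fun v : ℂ => ‖x‖ ^ 2 + 2 * ((starRingEnd ℂ) x * v).re) complexGaussian :=
    (integrable_const _).add (hlin.const_mul 2)
  have hgi : Integrable g := by
    rw [complexGaussian_eq, integrable_withDensity_iff_integrable_smul' (by fun_prop) (by simp)] at hint
    refine hint.congr (.of_forall fun v => ?_)
    simp [hg, ENNReal.toReal_ofReal (gaussDensity_pos v).le]
  have hgv : ∫ v, g v = ‖x‖ ^ 2 := by
    have e : ∫ v, (‖x‖ ^ 2 + 2 * ((starRingEnd ℂ) x * v).re) ∂complexGaussian = ‖x‖ ^ 2 := by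
      rw [integral_add (integrable_const _) (hlin.const_mul 2), integral_const_mul,
        integral_re_mul_of_symm (map_mul_complexGaussian (by simp))]
      simp
    rw [← e, complexGaussian_eq, integral_withDensity_eq_integral_toReal_smul (by fun_prop) (by simp)]
    refine integral_congr_ae (.of_forall fun v => ?_)
    simp [hg, ENNReal.toReal_ofReal (gaussDensity_pos v).le]
  have hcv : ((fun _ : ℂ => (1 : ℝ)) ⋆[ContinuousLinearMap.mul ℝ ℝ, ringLaw a] g)
      = fun w => ∫ u, g (w - u) ∂ringLaw a := by
    ext w; simp [convolution_def]
  have hΦi : Integrable fun w => ∫ u, g (w - u) ∂ringLaw a := by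
    have := (Integrable.convolution_integrand (ContinuousLinearMap.mul ℝ ℝ) (ν := ringLaw a)
      (integrable_const (1 : ℝ)) hgi).integral_prod_left
    simpa using this
  have hΦ : ∫ w, ∫ u, g (w - u) ∂ringLaw a = ‖x‖ ^ 2 := by
    rw [← hcv, integral_convolution _ (integrable_const (1 : ℝ)) hgi, hgv]
    simp
  have hq := quadGrowth_noiseDensity a
  have j1 : Integrable (fun w => -Real.log (noiseDensity a (x + w))) (noise a) := hq.integrable_noise a x
  have j2 : Integrable (fun w => -Real.log (noiseDensity a w)) (noise a) :=
    hq.integrable (integrable_norm_sq_noise a)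
  have j3 : Integrable (fun w => Real.log (noiseDensity a w) - Real.log (noiseDensity a (x + w))) (noise a) := by
    refine (j1.sub j2).congr (.of_forall fun w => ?_)
    simp only [Pi.sub_apply]; ring
  have e1 : loss a (Measure.dirac 0) x - noiseEntropy a
      = ∫ w, (Real.log (noiseDensity a w) - Real.log (noiseDensity a (x + w))) ∂noise a := by
    rw [loss, noiseEntropy, outDensity_dirac_zero, ← integral_sub j1 j2]
    refine integral_congr_ae (.of_forall fun w => ?_)
    simp only; ring
  have e2 : ∫ w, (Real.log (noiseDensity a w) - Real.log (noiseDensity a (x + w))) ∂noise a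
      = ∫ w, noiseDensity a w * (Real.log (noiseDensity a w) - Real.log (noiseDensity a (x + w))) := by
    rw [noise_eq, integral_withDensity_eq_integral_toReal_smul (by fun_prop) (by simp)]
    refine integral_congr_ae (.of_forall fun v => ?_)
    simp [ENNReal.toReal_ofReal (noiseDensity_pos a v).le]
  have j4 : Integrable fun w =>
      noiseDensity a w * (Real.log (noiseDensity a w) - Real.log (noiseDensity a (x + w))) := by
    rw [noise_eq, integrable_withDensity_iff_integrable_smul' (by fun_prop) (by simp)] at j3
    refine j3.congr (.of_forall fun v => ?_)
    simp [ENNReal.toReal_ofReal (noiseDensity_pos a v).le]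
  have := integral_mono j4 hΦi fun w => noiseDensity_log_sum a x w
  rw [hΦ, ← e2, ← e1] at this
  linarith

/-- Young's inequality: absorbing the shift costs an arbitrarily small fraction of the Gaussian
exponent. -/
lemma norm_sub_sq_ge {ε : ℝ} (h0 : 0 < ε) (h1 : ε ≤ 1) (y c : ℂ) :
    (1 - ε) * ‖y‖ ^ 2 - ‖c‖ ^ 2 / ε ≤ ‖y - c‖ ^ 2 := by
  have h : ‖y‖ ≤ ‖y - c‖ + ‖c‖ := by simpa using norm_add_le (y - c) c
  have h2 : ‖y‖ ^ 2 ≤ (‖y - c‖ + ‖c‖) ^ 2 := by gcongr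
  have h3 := mul_le_mul_of_nonneg_left h2 (sub_nonneg.2 h1)
  set V := ‖y - c‖
  set C := ‖c‖
  have h4 : (1 - ε) * (V + C) ^ 2 ≤ V ^ 2 + C ^ 2 / ε := by
    rw [← sub_nonneg]
    have e : V ^ 2 + C ^ 2 / ε - (1 - ε) * (V + C) ^ 2
        = ((ε * V - (1 - ε) * C) ^ 2 + ε * C ^ 2) / ε := by
      field_simp
      ring
    rw [e]
    positivity
  linarith

/-- A bounded input gives the output a Gaussian tail of exponent at least `1 - ε`, so the loss grows
at least like `(1 - ε)|x|²`, while it is bounded by `l|x|²` plus a constant. -/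
lemma IsOptimal.one_le_multiplier {a snr l : ℝ} {μ : Measure ℂ} (hμ : IsProbabilityMeasure μ)
    {B : ℝ} (hB : ∀ᵐ x ∂μ, ‖x‖ ≤ B)
    (hl : ∀ x, loss a μ x ≤ outEntropy a μ + l * (‖x‖ ^ 2 - snr)) : 1 ≤ l := by
  refine le_of_forall_sub_le fun ε hε => ?_
  wlog hε1 : ε ≤ 1 generalizing ε
  · exact le_trans (by linarith) (this 1 one_pos le_rfl)
  set K : ℝ := (B + |a|) ^ 2 / ε with hK
  have hf : ∀ (y x : ℂ), ‖x‖ ≤ B →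
      noiseDensity a (y - x) ≤ Real.pi⁻¹ * Real.exp (-((1 - ε) * ‖y‖ ^ 2 - K)) := by
    intro y x hx
    have : ∫ _, Real.pi⁻¹ * Real.exp (-((1 - ε) * ‖y‖ ^ 2 - K)) ∂ringLaw a
        = Real.pi⁻¹ * Real.exp (-((1 - ε) * ‖y‖ ^ 2 - K)) := by simp
    rw [← this]
    refine integral_mono_ae (integrable_smoothed continuous_gaussDensity (fun w => (gaussDensity_pos w).le)
      gaussDensity_le _) (integrable_const _) ?_
    filter_upwards [ae_norm_ringLaw a] with u hu
    unfold gaussDensity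
    have h1 := norm_sub_sq_ge hε hε1 y (x + u)
    have h2 : ‖x + u‖ ^ 2 / ε ≤ K := by
      rw [hK]
      gcongr
      exact (norm_add_le _ _).trans (by rw [hu]; linarith)
    rw [sub_sub]
    gcongr
    linarith
  have hp : ∀ y, outDensity a μ y ≤ Real.pi⁻¹ * Real.exp (-((1 - ε) * ‖y‖ ^ 2 - K)) := by
    intro y
    have : ∫ _, Real.pi⁻¹ * Real.exp (-((1 - ε) * ‖y‖ ^ 2 - K)) ∂μ
        = Real.pi⁻¹ * Real.exp (-((1 - ε) * ‖y‖ ^ 2 - K)) := by simp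
    rw [← this]
    refine integral_mono_ae (integrable_smoothed (continuous_noiseDensity a)
      (fun w => (noiseDensity_pos a w).le) (noiseDensity_le a) _) (integrable_const _) ?_
    filter_upwards [hB] with x hx
    exact hf y x hx
  have hlog : ∀ y, (1 - ε) * ‖y‖ ^ 2 - K ≤ -Real.log (outDensity a μ y) := by
    intro y
    have h := Real.log_le_log (outDensity_pos a μ y) (hp y)
    rw [Real.log_mul (by positivity) (by positivity), Real.log_exp, Real.log_inv] at h
    have : 0 < Real.log Real.pi := Real.log_pos (by linarith [Real.pi_gt_three])
    linarith
  have hloss : ∀ x, (1 - ε) * ‖x‖ ^ 2 - K ≤ loss a μ x := by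
    intro x
    have hi : Integrable (fun w => ‖x + w‖ ^ 2) (noise a) := quadGrowth_norm_sq.integrable_noise a x
    have h := integral_mono ((hi.const_mul (1 - ε)).sub (integrable_const K))
      ((quadGrowth_outDensity a μ).integrable_noise a x) fun w => hlog (x + w)
    simp only [Pi.sub_apply] at h
    rw [integral_sub (hi.const_mul (1 - ε)) (integrable_const K), integral_const_mul,
      integral_norm_add_sq_noise] at h
    simp only [integral_const, probReal_univ, one_smul] at h
    have := mul_nonneg (sub_nonneg.2 hε1) (noisePower_nonneg a)
    have e : ∫ w, -Real.log (outDensity a μ (x + w)) ∂noise a = loss a μ x := rfl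
    rw [e] at h
    linarith
  by_contra! hlt
  obtain ⟨n, hn⟩ := exists_nat_gt ((outEntropy a μ - l * snr + K) / (1 - ε - l))
  rw [div_lt_iff₀ (by linarith)] at hn
  have h1 := (hloss ((n : ℂ) + 1)).trans (hl _)
  have e : ‖((n : ℂ) + 1)‖ = n + 1 := by
    rw [← Nat.cast_add_one, Complex.norm_natCast]; push_cast; ring
  rw [e] at h1
  have hn0 : (0 : ℝ) ≤ n := n.cast_nonneg
  have h2 : (n : ℝ) ≤ (n + 1) ^ 2 := by nlinarith
  have h3 := mul_le_mul_of_nonneg_right h2 (by linarith : 0 ≤ 1 - ε - l)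
  linarith

/-- The support of an optimal input is unbounded. -/
lemma IsOptimal.not_ae_bounded {a snr : ℝ} {μ : Measure ℂ} (hsnr : 0 < snr) (h : IsOptimal a snr μ) (B : ℝ) :
    ¬ ∀ᵐ x ∂μ, ‖x‖ ≤ B := by
  intro hB
  obtain ⟨hp, hi, hs⟩ := (mem_admissible_iff hsnr.le).1 h.1
  obtain ⟨l, -, hl, -⟩ := h.exists_multiplier hsnr
  have hl1 : 1 ≤ l := IsOptimal.one_le_multiplier hp hB hl
  have hl0 := hl 0
  simp only [norm_zero, ne_eq, OfNat.ofNat_ne_zero, not_false_eq_true, zero_pow, zero_sub] at hl0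
  have hd := integrable_norm_sq_dirac 0
  -- With `l ≥ 1` this bounds the loss at `0` by the noise entropy, the equality case of Gibbs'
  -- inequality for the point mass. So `μ` is the point mass, and the condition at `0` then reads `l
  -- * snr ≤ 0`.
  have hH : outEntropy a μ ≤ noiseEntropy a + snr := by
    calc _ ≤ ∫ x, loss a (Measure.dirac 0) x ∂μ := outEntropy_le_integral_loss hi
      _ ≤ ∫ x, (noiseEntropy a + ‖x‖ ^ 2) ∂μ :=
        integral_mono (integrable_loss hi) ((integrable_const _).add hi) (loss_dirac_zero_le a)
      _ = noiseEntropy a + ∫ x, ‖x‖ ^ 2 ∂μ := by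
        rw [integral_add (integrable_const _) hi]; simp
      _ ≤ _ := by gcongr
  have h0 : noiseEntropy a ≤ loss a μ 0 := by
    have := outEntropy_le_integral_loss (a := a) (μ' := μ) hd
    rwa [outEntropy_dirac, integral_dirac] at this
  have hd' : outDensity a (Measure.dirac 0) = outDensity a μ := by
    refine outDensity_eq_of_integral_loss_le hd ?_
    rw [outEntropy_dirac, integral_dirac]
    nlinarith
  have hμ := eq_of_outDensity_eq hd'
  have : outEntropy a μ = noiseEntropy a := by rw [← hμ, outEntropy_dirac]
  nlinarith

/-! ### Analytic continuation: even functions and Gaussian transforms. -/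

/-- An even entire function is an entire function of the square. -/
lemma exists_comp_sq_of_even {P : ℂ → ℂ} (hP : Differentiable ℂ P) (heven : ∀ z, P (-z) = P z) :
    ∃ Q : ℂ → ℂ, Differentiable ℂ Q ∧ ∀ z, Q (z ^ 2) = P z := by
  set Q : ℂ → ℂ := fun s => P (s ^ (2⁻¹ : ℂ)) with hQ
  have hroot : ∀ s : ℂ, (s ^ (2⁻¹ : ℂ)) ^ 2 = s := fun s => Complex.cpow_nat_inv_pow s two_ne_zero
  have hsq : ∀ z, Q (z ^ 2) = P z := by
    intro z
    rcases sq_eq_sq_iff_eq_or_eq_neg.1 (hroot (z ^ 2)) with h | h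
    · simp only [hQ, h]
    · simp only [hQ, h, heven]
  have hslit : ∀ s ∈ Complex.slitPlane, DifferentiableAt ℂ (fun s : ℂ => s ^ (2⁻¹ : ℂ)) s := fun s hs =>
    differentiableAt_id.cpow_const hs
  refine ⟨Q, ?_, hsq⟩
  have hne : ∀ s : ℂ, s ≠ 0 → DifferentiableAt ℂ Q s := by
    intro s hs
    by_cases h : s ∈ Complex.slitPlane
    · exact (hP _).comp s (hslit s h)
    · have h' : -s ∈ Complex.slitPlane := (Complex.mem_slitPlane_or_neg_mem_slitPlane hs).resolve_left h
      -- Across the cut of the principal root use the other root `I * √(-s)`; evenness makes the two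
      -- choices agree.
      have e : Q = fun s => P (Complex.I * (-s) ^ (2⁻¹ : ℂ)) := by
        ext s
        rw [← hsq, mul_pow, hroot, Complex.I_sq]
        simp
      rw [e]
      have h1 : DifferentiableAt ℂ (fun s : ℂ => (-s) ^ (2⁻¹ : ℂ)) s :=
        (hslit (-s) h').comp s (differentiableAt_id.neg)
      exact (hP _).comp s (h1.const_mul _)
  -- Continuity at the branch point makes it a removable singularity.
  have hc0 : ContinuousAt Q 0 := by
    refine hP.continuous.continuousAt.comp ?_
    refine (tendsto_zero_iff_norm_tendsto_zero.2 ?_ : Tendsto _ _ _).congr' .rfl |>.trans_eq ?_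
    · have : Tendsto (fun s : ℂ => Real.sqrt ‖s‖) (𝓝 0) (𝓝 0) := by
        refine Continuous.tendsto' (by fun_prop) _ _ (by simp)
      refine this.congr fun s => ?_
      rw [Real.sqrt_eq_iff_mul_self_eq (norm_nonneg _) (norm_nonneg _), ← norm_mul, ← sq, hroot]
    · simp
  have := (Complex.differentiableOn_compl_singleton_and_continuousAt_iff (f := Q) (s := Set.univ) (c := 0)
    univ_mem).1 ⟨fun s hs => (hne s hs.2).differentiableWithinAt, hc0⟩
  exact differentiableOn_univ.1 this

lemma QuadGrowth.integrable_mul_exp {φ : ℂ → ℝ} (hφ : QuadGrowth φ) (R : ℝ) :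
    Integrable fun y => φ y * Real.exp (-‖y‖ ^ 2 + R * ‖y‖) := by
  obtain ⟨hc, A, hA⟩ := hφ
  have hA0 : 0 ≤ A := by simpa using (abs_nonneg _).trans (hA 0)
  refine ((integrable_exp_neg_mul_norm_sq (b := 1 / 4) (by norm_num)).const_mul
    (A * 4 * Real.exp (R ^ 2))).mono' (Continuous.aestronglyMeasurable (by fun_prop)) (.of_forall fun y => ?_)
  rw [norm_mul, Real.norm_eq_abs, Real.norm_of_nonneg (Real.exp_pos _).le]
  have h1 : 1 + ‖y‖ ^ 2 ≤ 4 * Real.exp (1 / 4 * ‖y‖ ^ 2) := by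
    have := Real.add_one_le_exp (1 / 4 * ‖y‖ ^ 2)
    linarith
  have h2 : -‖y‖ ^ 2 + R * ‖y‖ ≤ R ^ 2 + -(1 / 2) * ‖y‖ ^ 2 := by
    nlinarith [sq_nonneg (‖y‖ - R), sq_nonneg R]
  calc |φ y| * Real.exp (-‖y‖ ^ 2 + R * ‖y‖)
      ≤ A * (4 * Real.exp (1 / 4 * ‖y‖ ^ 2)) * Real.exp (R ^ 2 + -(1 / 2) * ‖y‖ ^ 2) := by
        refine mul_le_mul ((hA y).trans (by gcongr)) (Real.exp_le_exp.2 h2) (Real.exp_pos _).le (by positivity)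
    _ = A * 4 * Real.exp (R ^ 2) * (Real.exp (1 / 4 * ‖y‖ ^ 2) * Real.exp (-(1 / 2) * ‖y‖ ^ 2)) := by
        rw [Real.exp_add]; ring
    _ = _ := by
        rw [← Real.exp_add]
        ring_nf

/-- The two-sided Laplace transform, in direction `ξ`, of `φ` times a Gaussian. -/
def gaussTransform (φ : ℂ → ℝ) (ξ z : ℂ) : ℂ :=
  ∫ y, ((φ y * Real.exp (-‖y‖ ^ 2) : ℝ) : ℂ) * Complex.exp (z * (inner ℝ y ξ : ℝ))

lemma QuadGrowth.differentiable_gaussTransform {φ : ℂ → ℝ} (hφ : QuadGrowth φ) (ξ : ℂ) :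
    Differentiable ℂ (gaussTransform φ ξ) := by
  intro z₀
  have hc := hφ.1
  refine differentiableAt_integral_of_dominated (δ := 1)
    (g := fun y => ‖φ y * Real.exp (-‖y‖ ^ 2 + ((‖z₀‖ + 1) * ‖ξ‖) * ‖y‖)‖) one_pos
    (hφ.integrable_mul_exp _).norm ?_ ?_ ?_
  · intro z _
    exact Continuous.aestronglyMeasurable (by fun_prop)
  · exact .of_forall fun y => Differentiable.differentiableOn (by fun_prop)
  · refine .of_forall fun y z hz => ?_
    rw [norm_mul, Complex.norm_real, norm_mul, norm_mul, Complex.norm_exp, Real.exp_add, norm_mul, mul_assoc]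
    gcongr
    rw [Real.norm_of_nonneg (Real.exp_pos _).le]
    refine Real.exp_le_exp.2 ((Complex.re_le_norm _).trans ?_)
    rw [norm_mul, Complex.norm_real]
    have h1 : ‖z‖ ≤ ‖z₀‖ + 1 := by
      have := norm_sub_norm_le z z₀
      rw [Metric.mem_ball, dist_eq_norm] at hz
      linarith
    have h2 := norm_inner_le_norm (𝕜 := ℝ) y ξ
    calc ‖z‖ * ‖inner ℝ y ξ‖ ≤ (‖z₀‖ + 1) * (‖y‖ * ‖ξ‖) := by gcongr
      _ = _ := by ring

/-- Completing the square turns Gaussian smoothing along a line into a Laplace transform, which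
extends to complex arguments. -/
lemma integral_add_complexGaussian (φ : ℂ → ℝ) (ξ : ℂ) (t : ℝ) :
    ((∫ v, φ (t • ξ + v) ∂complexGaussian : ℝ) : ℂ)
      = (Real.pi⁻¹ * Real.exp (-‖t • ξ‖ ^ 2) : ℝ) * gaussTransform φ ξ (2 * t) := by
  have hm := continuous_gaussDensity.measurable
  rw [complexGaussian_eq, integral_withDensity_eq_integral_toReal_smul (by fun_prop) (by simp),
    ← integral_add_left_eq_self _ (-(t • ξ)), gaussTransform, ← integral_const_mul, ← integral_complex_ofReal]
  refine integral_congr_ae (.of_forall fun y => ?_)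
  simp only [add_neg_cancel_left]
  rw [ENNReal.toReal_ofReal (gaussDensity_pos _).le, smul_eq_mul, gaussDensity]
  have e : ‖-(t • ξ) + y‖ ^ 2 = ‖y‖ ^ 2 - 2 * t * inner ℝ y ξ + ‖t • ξ‖ ^ 2 := by
    rw [neg_add_eq_sub, norm_sub_sq_real, real_inner_smul_right]
    ring
  rw [e]
  have e2 : -(‖y‖ ^ 2 - 2 * t * inner ℝ y ξ + ‖t • ξ‖ ^ 2)
      = -‖t • ξ‖ ^ 2 + -‖y‖ ^ 2 + 2 * t * inner ℝ y ξ := by ring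
  rw [e2, Real.exp_add, Real.exp_add]
  push_cast
  ring

/-- An entire function that vanishes on infinitely many points of a bounded real interval vanishes. -/
lemma eq_zero_of_infinite_zeros {F : ℂ → ℂ} (hF : Differentiable ℂ F) {b c : ℝ}
    (h : ({r : ℝ | F r = 0} ∩ Set.Icc b c).Infinite) (z : ℂ) : F z = 0 := by
  obtain ⟨r, -, hr⟩ := h.exists_accPt_of_subset_isCompact isCompact_Icc Set.inter_subset_right
  have han : AnalyticOnNhd ℂ F Set.univ := fun z _ => hF.analyticAt z
  refine han.eqOn_zero_of_preconnected_of_frequently_eq_zero isPreconnected_univ (Set.mem_univ (r : ℂ)) ?_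
    (Set.mem_univ z)
  rw [accPt_iff_frequently_nhdsNE] at hr
  have ht : Tendsto (fun t : ℝ => (t : ℂ)) (𝓝[≠] r) (𝓝[≠] (r : ℂ)) := by
    refine tendsto_nhdsWithin_of_tendsto_nhds_of_eventually_within _ ?_ ?_
    · exact (Complex.continuous_ofReal.tendsto r).mono_left nhdsWithin_le_nhds
    · filter_upwards [self_mem_nhdsWithin] with t ht
      simpa using ht
  exact ht.frequently (hr.mono fun t ht => ht.1)

/-- Gaussian smoothing is injective on continuous functions of quadratic growth. -/
lemma QuadGrowth.eq_zero_of_integral_complexGaussian {φ : ℂ → ℝ} (hφ : QuadGrowth φ)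
    (h : ∀ x, ∫ v, φ (x + v) ∂complexGaussian = 0) : φ = 0 := by
  have hc := hφ.1
  have htr : ∀ ξ z, gaussTransform φ ξ z = 0 := by
    intro ξ
    refine eq_zero_of_infinite_zeros (hφ.differentiable_gaussTransform ξ) (b := 0) (c := 1) ?_
    have : {r : ℝ | gaussTransform φ ξ r = 0} ∩ Set.Icc 0 1 = Set.Icc 0 1 := by
      refine Set.inter_eq_right.2 fun r _ => ?_
      have e := integral_add_complexGaussian φ ξ (r / 2)
      rw [h] at e
      have hne : ((Real.pi⁻¹ * Real.exp (-‖(r / 2) • ξ‖ ^ 2) : ℝ) : ℂ) ≠ 0 := by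
        exact_mod_cast (by positivity : Real.pi⁻¹ * Real.exp (-‖(r / 2) • ξ‖ ^ 2) ≠ 0)
      have e2 : (2 : ℂ) * ((r / 2 : ℝ) : ℂ) = r := by push_cast; ring
      rw [e2, Complex.ofReal_zero, eq_comm, mul_eq_zero] at e
      exact e.resolve_left hne
    rw [this]
    exact Set.Icc_infinite one_pos
  set k : ℂ → ℝ := fun y => φ y * Real.exp (-‖y‖ ^ 2) with hk
  have hkc : Continuous k := by fun_prop
  have hki : Integrable k := by simpa using hφ.integrable_mul_exp 0
  have hfin : ∀ g : ℂ → ℝ, Integrable g → IsFiniteMeasure (volume.withDensity fun y => ENNReal.ofReal (g y)) :=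
    fun g hg => isFiniteMeasure_withDensity_ofReal hg.2
  have := hfin k hki
  have := hfin (fun y => -k y) hki.neg
  have hmk := hkc.measurable
  -- The positive and negative parts of `k` are densities of finite measures whose characteristic
  -- functions differ by the transform at `z = I`, hence coincide.
  have heq : (volume.withDensity fun y => ENNReal.ofReal (k y))
      = volume.withDensity fun y => ENNReal.ofReal (-k y) := by
    refine Measure.ext_of_charFun (funext fun ξ => ?_)
    rw [charFun_apply, charFun_apply, integral_withDensity_eq_integral_toReal_smul (by fun_prop) (by simp),
      integral_withDensity_eq_integral_toReal_smul (by fun_prop) (by simp), ← sub_eq_zero, ← integral_sub]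
    · rw [← htr ξ Complex.I, gaussTransform]
      refine integral_congr_ae (.of_forall fun y => ?_)
      simp only
      rw [← sub_smul, ENNReal.toReal_ofReal', ENNReal.toReal_ofReal', Complex.real_smul, mul_comm Complex.I]
      congr 2
      exact max_zero_sub_eq_self (k y)
    · refine hki.norm.mono' (Measurable.aestronglyMeasurable (by fun_prop)) (.of_forall fun y => ?_)
      rw [norm_smul, Complex.norm_exp_ofReal_mul_I, mul_one, ENNReal.toReal_ofReal', Real.norm_eq_abs,
        Real.norm_eq_abs, abs_of_nonneg (le_max_right _ _)]
      exact max_le (le_abs_self _) (abs_nonneg _)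
    · refine hki.norm.mono' (Measurable.aestronglyMeasurable (by fun_prop)) (.of_forall fun y => ?_)
      rw [norm_smul, Complex.norm_exp_ofReal_mul_I, mul_one, ENNReal.toReal_ofReal', Real.norm_eq_abs,
        Real.norm_eq_abs, abs_of_nonneg (le_max_right _ _)]
      exact max_le (neg_le_abs _) (abs_nonneg _)
  rw [withDensity_eq_iff (by fun_prop) (by fun_prop) hki.lintegral_lt_top.ne] at heq
  have hk0 : k =ᵐ[volume] fun _ => 0 := by
    filter_upwards [heq] with y hy
    rcases lt_trichotomy (k y) 0 with h | h | h
    · rw [ENNReal.ofReal_of_nonpos h.le, eq_comm, ENNReal.ofReal_eq_zero] at hy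
      linarith
    · exact h
    · rw [ENNReal.ofReal_of_nonpos (by linarith : -k y ≤ 0), ENNReal.ofReal_eq_zero] at hy
      linarith
  have hk1 := (hkc.ae_eq_iff_eq volume continuous_const).1 hk0
  ext y
  have := congrFun hk1 y
  simpa [hk, Real.exp_ne_zero] using this

/-! ### A zero of the characteristic function of a circle. -/

lemma cos_le_quartic (y : ℝ) : Real.cos y ≤ 1 - y ^ 2 / 2 + y ^ 4 / 24 := by
  wlog hy : 0 ≤ y generalizing y
  · have := this (-y) (by linarith)
    rw [Real.cos_neg] at this
    simpa [Even.neg_pow (by decide : Even 4)] using this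
  have hs : MonotoneOn (fun y : ℝ => Real.sin y - y + y ^ 3 / 6) (Set.Ici 0) := by
    refine monotoneOn_of_hasDerivWithinAt_nonneg (f' := fun y => Real.cos y - 1 + y ^ 2 / 2) (convex_Ici 0)
      (by fun_prop) (fun y _ => ?_) fun y _ => by linarith [Real.one_sub_sq_div_two_le_cos (x := y)]
    have := ((Real.hasDerivAt_sin y).sub (hasDerivAt_id y)).add ((hasDerivAt_pow 3 y).div_const 6)
    refine (this.congr_deriv ?_).hasDerivWithinAt
    simp; ring
  have hc : MonotoneOn (fun y : ℝ => 1 - y ^ 2 / 2 + y ^ 4 / 24 - Real.cos y) (Set.Ici 0) := by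
    refine monotoneOn_of_hasDerivWithinAt_nonneg (f' := fun y => Real.sin y - y + y ^ 3 / 6) (convex_Ici 0)
      (by fun_prop) (fun y _ => ?_) fun y hy => ?_
    · have := ((((hasDerivAt_pow 2 y).div_const 2).const_sub 1).add ((hasDerivAt_pow 4 y).div_const 24)).sub
        (Real.hasDerivAt_cos y)
      refine (this.congr_deriv ?_).hasDerivWithinAt
      simp; ring
    · rw [interior_Ici] at hy
      have := hs (Set.mem_Ici.2 le_rfl) (Set.mem_Ici.2 (le_of_lt hy)) (le_of_lt hy)
      simpa using this
  have := hc (Set.mem_Ici.2 le_rfl) hy hy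
  simp at this
  linarith

lemma charFun_ringLaw_im (a : ℝ) (ξ : ℂ) : (charFun (ringLaw a) ξ).im = 0 := by
  have h1 : charFun (ringLaw a) (-ξ) = charFun (ringLaw a) ξ := by
    conv_rhs => rw [← map_mul_ringLaw a (c := -1) (by simp)]
    rw [charFun_apply, charFun_apply, integral_map (by fun_prop) (by fun_prop)]
    simp
  rw [charFun_neg] at h1
  exact Complex.conj_eq_iff_im.1 h1

lemma charFun_ringLaw_re (a t : ℝ) :
    (charFun (ringLaw a) t).re
      = (2 * Real.pi)⁻¹ * ∫ θ in (0 : ℝ)..2 * Real.pi, Real.cos (a * t * Real.cos θ) := by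
  rw [← integral_uniformPhase, charFun_apply, ringLaw, integral_map (by fun_prop) (by fun_prop)]
  have hint : Integrable (fun θ : ℝ => Complex.exp
      (((inner ℝ ((a : ℂ) * Complex.exp ((θ : ℂ) * Complex.I)) (t : ℂ) : ℝ) : ℂ) * Complex.I)) uniformPhase := by
    refine (integrable_const (1 : ℝ)).mono' (Continuous.aestronglyMeasurable (by fun_prop))
      (.of_forall fun θ => ?_)
    rw [Complex.norm_exp_ofReal_mul_I]
  have := integral_re hint
  simp only [RCLike.re_eq_complex_re] at this
  rw [← this]
  refine integral_congr_ae (.of_forall fun θ => ?_)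
  simp only [Complex.exp_ofReal_mul_I_re]
  congr 1
  rw [Complex.inner]
  simp [Complex.exp_ofReal_mul_I_re, Complex.exp_ofReal_mul_I_im]
  ring

/-- The characteristic function of a nondegenerate circle law has a zero. -/
lemma exists_charFun_ringLaw_eq_zero {a : ℝ} (ha : 0 < a) : ∃ ξ, charFun (ringLaw a) ξ = 0 := by
  set g : ℝ → ℝ := fun t => (charFun (ringLaw a) (t : ℂ)).re with hg
  have hgc : Continuous g := Complex.continuous_re.comp (continuous_charFun.comp Complex.continuous_ofReal)
  have hg0 : g 0 = 1 := by simp [hg]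
  -- Averaging the quartic bound at `s cos θ` gives `(1 - s²/8)²`, which vanishes exactly at `s² =
  -- 8`.
  set t : ℝ := Real.sqrt 8 / a with ht
  have hat : a * t = Real.sqrt 8 := by rw [ht]; field_simp
  have h8 : Real.sqrt 8 ^ 2 = 8 := Real.sq_sqrt (by norm_num)
  have h84 : Real.sqrt 8 ^ 4 = 64 := by
    rw [show (4 : ℕ) = 2 * 2 by norm_num, pow_mul, h8]; norm_num
  have hgt : g t ≤ 0 := by
    simp only [hg]
    rw [charFun_ringLaw_re, hat]
    have hle : ∫ θ in (0 : ℝ)..2 * Real.pi, Real.cos (Real.sqrt 8 * Real.cos θ) ≤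
        ∫ θ in (0 : ℝ)..2 * Real.pi, (1 - 4 * Real.cos θ ^ 2 + 8 / 3 * Real.cos θ ^ 4) := by
      refine intervalIntegral.integral_mono (by positivity) (Continuous.intervalIntegrable (by fun_prop) _ _)
        (Continuous.intervalIntegrable (by fun_prop) _ _) fun θ => ?_
      have := cos_le_quartic (Real.sqrt 8 * Real.cos θ)
      rw [mul_pow, mul_pow, h8, h84] at this
      simp only
      linarith
    have hval : ∫ θ in (0 : ℝ)..2 * Real.pi, (1 - 4 * Real.cos θ ^ 2 + 8 / 3 * Real.cos θ ^ 4) = 0 := by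
      rw [intervalIntegral.integral_add (Continuous.intervalIntegrable (by fun_prop) _ _)
        (Continuous.intervalIntegrable (by fun_prop) _ _),
        intervalIntegral.integral_sub (Continuous.intervalIntegrable (by fun_prop) _ _)
        (Continuous.intervalIntegrable (by fun_prop) _ _), intervalIntegral.integral_const_mul,
        intervalIntegral.integral_const_mul, integral_cos_pow 2, integral_cos_sq]
      simp
      ring
    rw [hval] at hle
    exact mul_nonpos_of_nonneg_of_nonpos (by positivity) hle
  obtain ⟨s, -, hs⟩ := intermediate_value_Icc' (a := 0) (b := t) (by positivity) hgc.continuousOn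
    (⟨hgt, by rw [hg0]; norm_num⟩ : (0 : ℝ) ∈ Set.Icc (g t) (g 0))
  exact ⟨s, Complex.ext hs (charFun_ringLaw_im a s)⟩

/-! ### Circle means of the log-density and the contact set. -/

/-- The mean of `φ` over the circle of radius `a` around `x`. -/
def circleMean (a : ℝ) (φ : ℂ → ℝ) (x : ℂ) : ℝ := ∫ u, φ (x + u) ∂ringLaw a

lemma circleMean_eq {a : ℝ} {φ : ℂ → ℝ} (hφ : Continuous φ) (x : ℂ) :
    circleMean a φ x = (2 * Real.pi)⁻¹ *
      ∫ θ in (0 : ℝ)..2 * Real.pi, φ (x + (a : ℂ) * Complex.exp ((θ : ℂ) * Complex.I)) := by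
  rw [circleMean, ringLaw, integral_map (by fun_prop) (by fun_prop), integral_uniformPhase]

lemma QuadGrowth.circleMean {φ : ℂ → ℝ} (hφ : QuadGrowth φ) (a : ℝ) : QuadGrowth (circleMean a φ) := by
  obtain ⟨hc, A, hA⟩ := hφ
  have hA0 : 0 ≤ A := by simpa using (abs_nonneg _).trans (hA 0)
  refine ⟨?_, A * (2 + 2 * a ^ 2), fun x => ?_⟩
  · rw [funext (circleMean_eq hc)]
    refine continuous_const.mul ?_
    exact intervalIntegral.continuous_parametric_intervalIntegral_of_continuous' (by fun_prop) _ _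
  · have h1 : ∀ᵐ u ∂ringLaw a, ‖φ (x + u)‖ ≤ A * (2 + 2 * a ^ 2) * (1 + ‖x‖ ^ 2) := by
      filter_upwards [ae_norm_ringLaw a] with u hu
      refine (hA _).trans ?_
      rw [mul_assoc]
      gcongr
      have h2 := norm_add_le x u
      have h3 : ‖u‖ ^ 2 = a ^ 2 := by rw [hu, sq_abs]
      nlinarith [norm_nonneg (x + u), sq_nonneg (‖x‖ - ‖u‖), norm_nonneg x, norm_nonneg u,
        mul_nonneg (sq_nonneg ‖x‖) (sq_nonneg a)]
    have := norm_integral_le_of_norm_le_const h1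
    rw [probReal_univ, mul_one] at this
    exact this

/-- Averaging over the circle first exhibits the loss as a Gaussian smoothing, so that analyticity
and injectivity of the latter apply. -/
lemma loss_eq_integral_circleMean (a : ℝ) (μ : Measure ℂ) [IsProbabilityMeasure μ] (x : ℂ) :
    loss a μ x = ∫ v, circleMean a (fun y => -Real.log (outDensity a μ y)) (x + v) ∂complexGaussian := by
  have hi := (quadGrowth_outDensity a μ).integrable_noise a x
  rw [loss]
  rw [noise, Measure.conv_comm] at hi ⊢
  rw [integral_conv hi]
  simp only [circleMean, add_assoc]

section isotropic

variable {a : ℝ} {μ : Measure ℂ}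

lemma outDensity_mul (hinv : ∀ c : ℂ, ‖c‖ = 1 → μ.map (fun u => c * u) = μ) {c : ℂ} (hc : ‖c‖ = 1) (y : ℂ) :
    outDensity a μ (c * y) = outDensity a μ y := by
  conv_lhs => rw [← hinv c hc]
  exact outDensity_map_mul a μ hc y

lemma exists_eq_mul_norm (y : ℂ) : ∃ c : ℂ, ‖c‖ = 1 ∧ y = c * (‖y‖ : ℂ) :=
  ⟨Complex.exp (Complex.arg y * Complex.I), Complex.norm_exp_ofReal_mul_I _, by
    conv_lhs => rw [← Complex.norm_mul_exp_arg_mul_I y]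
    ring⟩

lemma outDensity_norm (hinv : ∀ c : ℂ, ‖c‖ = 1 → μ.map (fun u => c * u) = μ) (y : ℂ) :
    outDensity a μ (‖y‖ : ℂ) = outDensity a μ y := by
  obtain ⟨c, hc, hy⟩ := exists_eq_mul_norm y
  conv_rhs => rw [hy]
  exact (outDensity_mul hinv hc _).symm

lemma loss_norm [IsProbabilityMeasure μ] (hinv : ∀ c : ℂ, ‖c‖ = 1 → μ.map (fun u => c * u) = μ) (x : ℂ) :
    loss a μ (‖x‖ : ℂ) = loss a μ x := by
  obtain ⟨c, hc, hx⟩ := exists_eq_mul_norm x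
  have hq := ((quadGrowth_outDensity a μ).translate x).1
  unfold loss
  conv_rhs => rw [← map_mul_noise a hc]
  rw [integral_map (by fun_prop) hq.aestronglyMeasurable]
  refine integral_congr_ae (.of_forall fun w => ?_)
  simp only
  conv_rhs => rw [hx, ← mul_add, outDensity_mul hinv hc]

lemma exists_entire_loss (a : ℝ) (μ : Measure ℂ) [IsProbabilityMeasure μ] :
    ∃ F : ℂ → ℂ, Differentiable ℂ F ∧ ∀ r : ℝ, F r = loss a μ r := by
  have hq := (quadGrowth_outDensity a μ).circleMean a
  have hd := hq.differentiable_gaussTransform 1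
  refine ⟨fun z => (Real.pi⁻¹ : ℝ) * Complex.exp (-z ^ 2) *
    gaussTransform (circleMean a fun y => -Real.log (outDensity a μ y)) 1 (2 * z), ?_, fun r => ?_⟩
  · exact Differentiable.mul (by fun_prop) (hd.comp (by fun_prop))
  · have := integral_add_complexGaussian (circleMean a fun y => -Real.log (outDensity a μ y)) 1 r
    rw [loss_eq_integral_circleMean]
    simp only [Complex.real_smul, mul_one] at this
    rw [this]
    simp

/-- The output density of an isotropic input is an entire function of the squared modulus. -/
lemma exists_entire_outDensity (a : ℝ) [IsProbabilityMeasure μ]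
    (hinv : ∀ c : ℂ, ‖c‖ = 1 → μ.map (fun u => c * u) = μ) :
    ∃ Q : ℂ → ℂ, Differentiable ℂ Q ∧ (∀ s, ‖Q s‖ ≤ Real.pi⁻¹ * Real.exp ‖s‖) ∧
      ∀ y : ℂ, Q ((‖y‖ ^ 2 : ℝ) : ℂ) = outDensity a μ y := by
  have hG := continuous_gaussDensity
  set κ := μ ∗ ringLaw a with hκ
  have hκinv : κ.map (fun u => (-1 : ℂ) * u) = κ := by
    rw [hκ, map_mul_conv, hinv _ (by simp), map_mul_ringLaw a (by simp)]
  have hp : ∀ y, outDensity a μ y = ∫ v, gaussDensity (y - v) ∂κ := by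
    intro y
    rw [hκ, integral_conv (integrable_smoothed hG (fun w => (gaussDensity_pos w).le) gaussDensity_le y)]
    simp only [← sub_sub]
    rfl
  -- The Gaussian kernel at a real point `r`, expanded and continued in `r`. The real part of its
  -- exponent is at most `|z|²` for every `v`, hence exponential type in `z²`.
  set P : ℂ → ℂ := fun z => ∫ v : ℂ, (Real.pi⁻¹ : ℝ) * Complex.exp (-z ^ 2 + 2 * z * v.re - ‖v‖ ^ 2) ∂κ with hP
  have hbound : ∀ z v : ℂ, ‖((Real.pi⁻¹ : ℝ) : ℂ) * Complex.exp (-z ^ 2 + 2 * z * v.re - ‖v‖ ^ 2)‖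
      ≤ Real.pi⁻¹ * Real.exp (‖z‖ ^ 2) := by
    intro z v
    rw [norm_mul, Complex.norm_exp, Complex.norm_real, Real.norm_of_nonneg (by positivity)]
    gcongr
    rw [Complex.sq_norm, Complex.normSq_apply]
    have e : (-z ^ 2 + 2 * z * v.re - ‖v‖ ^ 2 : ℂ).re
        = z.im * z.im - z.re * z.re + 2 * z.re * v.re - ‖v‖ ^ 2 := by
      rw [← Complex.ofReal_pow]
      simp [sq]
    rw [e, Complex.sq_norm, Complex.normSq_apply]
    nlinarith [sq_nonneg (z.re - v.re), sq_nonneg v.im, sq_nonneg z.re]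
  have hPd : Differentiable ℂ P := by
    intro z₀
    refine differentiableAt_integral_of_dominated (δ := 1)
      (g := fun _ => Real.pi⁻¹ * Real.exp ((‖z₀‖ + 1) ^ 2)) one_pos (integrable_const _) ?_ ?_ ?_
    · intro z _
      exact Continuous.aestronglyMeasurable (by fun_prop)
    · exact .of_forall fun v => Differentiable.differentiableOn (by fun_prop)
    · refine .of_forall fun v z hz => (hbound z v).trans ?_
      have h1 : ‖z‖ ≤ ‖z₀‖ + 1 := by
        have := norm_sub_norm_le z z₀
        rw [Metric.mem_ball, dist_eq_norm] at hz
        linarith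
      gcongr
  have hPb : ∀ z, ‖P z‖ ≤ Real.pi⁻¹ * Real.exp (‖z‖ ^ 2) := by
    intro z
    have := norm_integral_le_of_norm_le_const (μ := κ) (.of_forall (hbound z))
    rw [probReal_univ, mul_one] at this
    exact this
  have hPeven : ∀ z, P (-z) = P z := by
    intro z
    simp only [hP]
    conv_lhs => rw [← hκinv]
    rw [integral_map (by fun_prop) (Continuous.aestronglyMeasurable (by fun_prop))]
    simp
  have hPreal : ∀ r : ℝ, P r = outDensity a μ r := by
    intro r
    rw [hp, ← integral_complex_ofReal]
    refine integral_congr_ae (.of_forall fun v => ?_)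
    simp only [gaussDensity]
    push_cast
    congr 2
    have e : ‖(r : ℂ) - v‖ ^ 2 = r ^ 2 - 2 * r * v.re + ‖v‖ ^ 2 := by
      rw [Complex.sq_norm, Complex.sq_norm, Complex.normSq_apply, Complex.normSq_apply]
      simp
      ring
    rw [← Complex.ofReal_pow ‖(r : ℂ) - v‖, e]
    push_cast
    ring
  obtain ⟨Q, hQ, hQP⟩ := exists_comp_sq_of_even hPd hPeven
  refine ⟨Q, hQ, fun s => ?_, fun y => ?_⟩
  · obtain ⟨z, rfl⟩ : ∃ z : ℂ, z ^ 2 = s := ⟨s ^ (2⁻¹ : ℂ), Complex.cpow_nat_inv_pow s two_ne_zero⟩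
    rw [hQP, norm_pow]
    exact hPb z
  · rw [Complex.ofReal_pow, hQP, hPreal, outDensity_norm hinv]

/-- The output density of an interfered channel is never Gaussian. -/
lemma outDensity_ne_exp (ha : 0 < a) [IsProbabilityMeasure μ] (α β : ℂ) :
    ¬ ∀ y : ℂ, ((outDensity a μ y : ℝ) : ℂ) = Complex.exp (α + β * (‖y‖ ^ 2 : ℝ)) := by
  intro h
  -- Otherwise the density would be bounded below and could not be integrable.
  have hβ : β.re < 0 := by
    by_contra! hβ
    have hle : ∀ y, Real.exp α.re ≤ outDensity a μ y := by
      intro y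
      have := congrArg norm (h y)
      rw [Complex.norm_real, Real.norm_of_nonneg (outDensity_pos a μ y).le, Complex.norm_exp] at this
      rw [this]
      refine Real.exp_le_exp.2 ?_
      rw [Complex.add_re, Complex.re_mul_ofReal]
      have := mul_nonneg hβ (sq_nonneg ‖y‖)
      linarith
    have hi : Integrable (fun _ : ℂ => Real.exp α.re) :=
      (integrable_outDensity (a := a) (μ := μ)).mono' aestronglyMeasurable_const (.of_forall fun y => by
        rw [Real.norm_of_nonneg (Real.exp_pos _).le]; exact hle y)
    rw [integrable_const_iff] at hi
    rcases hi with hi | hi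
    · exact (Real.exp_pos _).ne' hi
    · have := hi.measure_univ_lt_top
      simp at this
  -- The output inherits this zero, whereas the transform of a Gaussian has none.
  obtain ⟨ξ, hξ⟩ := exists_charFun_ringLaw_eq_zero ha
  have h0 : charFun (μ ∗ noise a) ξ = 0 := by
    rw [charFun_conv, charFun_noise, hξ]; simp
  have hm := (continuous_outDensity a μ).measurable
  have hgauss := GaussianFourier.integral_cexp_neg_mul_sq_norm_add (b := -β) (V := ℂ) (by simpa using hβ)
    Complex.I ξ
  rw [charFun_apply, conv_noise_eq, integral_withDensity_eq_integral_toReal_smul (by fun_prop) (by simp)] at h0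
  have e : ∀ y : ℂ, (ENNReal.ofReal (outDensity a μ y)).toReal • Complex.exp (↑(inner ℝ y ξ) * Complex.I)
      = Complex.exp α * Complex.exp (-(-β) * ‖y‖ ^ 2 + Complex.I * ↑(inner ℝ ξ y)) := by
    intro y
    rw [ENNReal.toReal_ofReal (outDensity_pos a μ y).le, Complex.real_smul, h y, ← Complex.exp_add,
      ← Complex.exp_add, real_inner_comm]
    congr 1
    push_cast
    ring
  simp_rw [e] at h0
  rw [integral_const_mul, hgauss, Complex.finrank_real_complex] at h0
  have hβ0 : β ≠ 0 := by rintro rfl; simp at hβ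
  have hpi : (Real.pi : ℂ) ≠ 0 := by exact_mod_cast Real.pi_ne_zero
  simp [hβ0, hpi, Complex.exp_ne_zero] at h0

/-- For an isotropic input the output log-loss agrees with a quadratic only at finitely many radii in
a bounded interval. -/
lemma finite_loss_eq_quadratic (ha : 0 < a) [IsProbabilityMeasure μ]
    (hinv : ∀ c : ℂ, ‖c‖ = 1 → μ.map (fun u => c * u) = μ) (A B b c : ℝ) :
    ({r : ℝ | loss a μ r = A * r ^ 2 + B} ∩ Set.Icc b c).Finite := by
  by_contra hinf
  -- Infinitely many contacts in a bounded interval accumulate, so the entire extension of the loss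
  -- is the quadratic.
  have hloss : ∀ x : ℂ, loss a μ x = A * ‖x‖ ^ 2 + B := by
    obtain ⟨F, hF, hFl⟩ := exists_entire_loss a μ
    have hz := eq_zero_of_infinite_zeros (F := fun z => F z - (A * z ^ 2 + B)) (by fun_prop) (b := b) (c := c) (by
      refine Set.Infinite.mono ?_ hinf
      rintro r ⟨hr, hr'⟩
      refine ⟨?_, hr'⟩
      have hr1 : loss a μ r = A * r ^ 2 + B := hr
      show F r - (A * r ^ 2 + B) = 0
      rw [hFl, hr1]
      push_cast
      ring)
    intro x
    have h := hz (‖x‖ : ℂ)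
    rw [hFl, loss_norm hinv, sub_eq_zero] at h
    exact_mod_cast h
  set ψ : ℂ → ℝ := fun y => -Real.log (outDensity a μ y) with hψ
  have hψq : QuadGrowth ψ := quadGrowth_outDensity a μ
  set M : ℝ := ∫ v, ‖v‖ ^ 2 ∂complexGaussian with hM
  have hgsq : ∀ x : ℂ, ∫ v, ‖x + v‖ ^ 2 ∂complexGaussian = ‖x‖ ^ 2 + M :=
    integral_norm_add_sq_of_symm integrable_norm_sq_complexGaussian (map_mul_complexGaussian (by simp))
  have hmean : ∀ x, circleMean a ψ x = A * ‖x‖ ^ 2 + (B - A * M) := by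
    -- Gaussian smoothing adds `A * M` to `A‖x‖²`, so the difference from the corrected quadratic
    -- smooths to zero and must vanish.
    have hq : QuadGrowth fun y => circleMean a ψ y + (-A * ‖y‖ ^ 2 + -(B - A * M)) :=
      (hψq.circleMean a).add ((quadGrowth_norm_sq.const_mul (-A)).add (quadGrowth_const _))
    have h0 := hq.eq_zero_of_integral_complexGaussian fun x => by
      have i1 : Integrable (fun v => circleMean a ψ (x + v)) complexGaussian :=
        ((hψq.circleMean a).translate x).integrable integrable_norm_sq_complexGaussian
      have i2 : Integrable (fun v => ‖x + v‖ ^ 2) complexGaussian :=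
        (quadGrowth_norm_sq.translate x).integrable integrable_norm_sq_complexGaussian
      have i3 : Integrable (fun v => -A * ‖x + v‖ ^ 2 + -(B - A * M)) complexGaussian :=
        (i2.const_mul _).add (integrable_const _)
      rw [integral_add i1 i3, integral_add (i2.const_mul _) (integrable_const _), integral_const_mul, hgsq,
        ← loss_eq_integral_circleMean, hloss]
      simp
      ring
    intro x
    have := congrFun h0 x
    simp only [Pi.zero_apply] at this
    linarith
  obtain ⟨Q, hQ, hQb, hQp⟩ := exists_entire_outDensity a hinv
  have hQx : ∀ x : ℝ, 0 ≤ x → Q x = outDensity a μ (Real.sqrt x : ℂ) := by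
    intro x hx
    rw [← hQp]
    congr 2
    rw [Complex.norm_real, Real.norm_of_nonneg (Real.sqrt_nonneg _), Real.sq_sqrt hx]
  -- The sign and the factor `2π` arise because `ψ` is minus the logarithm and `circleMean` is
  -- normalized.
  obtain ⟨α, β, hexp⟩ := exists_eq_exp_affine_of_circle_means hQ (a := a) (C := Real.pi⁻¹)
    (A := -(2 * Real.pi * A)) (B := -(2 * Real.pi * (B - A * M))) ha hQb
    (fun x hx => by rw [hQx x hx, Complex.ofReal_im])
    (fun x hx => by rw [hQx x hx, Complex.ofReal_re]; exact outDensity_pos a μ _) (by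
      intro r
      have h := hmean r
      rw [circleMean_eq hψq.1, Complex.norm_real, Real.norm_eq_abs, sq_abs] at h
      have e : ∀ θ : ℝ, Real.log (Q ((r ^ 2 + a ^ 2 + 2 * r * a * Real.cos θ : ℝ) : ℂ)).re
          = -ψ ((r : ℂ) + (a : ℂ) * Complex.exp ((θ : ℂ) * Complex.I)) := by
        intro θ
        have e1 : r ^ 2 + a ^ 2 + 2 * r * a * Real.cos θ
            = ‖(r : ℂ) + (a : ℂ) * Complex.exp ((θ : ℂ) * Complex.I)‖ ^ 2 := by
          rw [Complex.sq_norm, Complex.normSq_apply]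
          simp [Complex.exp_ofReal_mul_I_re, Complex.exp_ofReal_mul_I_im]
          linear_combination (-a ^ 2) * Real.sin_sq_add_cos_sq θ
        rw [e1, hQp, Complex.ofReal_re]
        simp [hψ]
      simp_rw [e]
      rw [intervalIntegral.integral_neg]
      rw [inv_mul_eq_iff_eq_mul₀ (by positivity)] at h
      rw [h]
      ring)
  exact outDensity_ne_exp ha α β fun y => by rw [← hQp, hexp]

end isotropic

/-! ### From the contact set to the capacity-achieving law. -/

/-- A measure carried by a locally finite set is purely atomic, and finitely many atoms would bound
its support. -/
lemma isDiscreteInfiniteLocallyFinite_of_contact {ρ : Measure ℝ} {E : Set ℝ}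
    (hE : ∀ b c : ℝ, (E ∩ Set.Icc b c).Finite) (hρ : ρ Eᶜ = 0) (hunb : ∀ B : ℝ, ¬ ∀ᵐ r ∂ρ, r ≤ B) :
    IsDiscreteInfiniteLocallyFinite ρ := by
  have hEc : E.Countable := by
    have : E = ⋃ n : ℕ, E ∩ Set.Icc (-n : ℝ) n := by
      rw [← Set.inter_iUnion, eq_comm, Set.inter_eq_left]
      intro r _
      obtain ⟨n, hn⟩ := exists_nat_ge |r|
      exact Set.mem_iUnion.2 ⟨n, abs_le.1 hn⟩
    rw [this]
    exact Set.countable_iUnion fun n => (hE _ _).countable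
  have hME : massPoints ρ ⊆ E := by
    intro r hr
    by_contra hrE
    exact (ne_of_gt hr) (measure_mono_null (Set.singleton_subset_iff.2 hrE) hρ)
  have hnull : ρ (massPoints ρ)ᶜ = 0 := by
    have h1 : ρ (E \ massPoints ρ) = 0 := by
      rw [← Set.biUnion_of_singleton (E \ massPoints ρ), measure_biUnion_null_iff (hEc.mono Set.sdiff_subset)]
      intro r hr
      by_contra h
      exact hr.2 (pos_iff_ne_zero.2 h)
    refine measure_mono_null ?_ (measure_union_null hρ h1)
    intro r hr
    by_cases h : r ∈ E
    · exact .inr ⟨h, hr⟩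
    · exact .inl h
  refine ⟨hnull, hEc.mono hME, fun hfin => ?_, fun b c => (hE b c).subset (by gcongr)⟩
  obtain ⟨B, hB⟩ := hfin.bddAbove
  refine hunb B ?_
  filter_upwards [measure_eq_zero_iff_ae_notMem.1 hnull] with r hr
  exact hB (not_not.1 hr)

variable {snr inr : ℝ} {μ : Measure ℂ}

lemma IsOptimal.hasIndepUniformPhase {a : ℝ} (hsnr : 0 ≤ snr) (h : IsOptimal a snr μ) :
    HasIndepUniformPhase μ :=
  have := h.1.1
  hasIndepUniformPhase_of_map_mul_eq fun _ hc => h.map_mul_eq hsnr hc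

lemma IsOptimal.isDiscreteInfiniteLocallyFinite {a : ℝ} (ha : 0 < a) (hsnr : 0 < snr)
    (h : IsOptimal a snr μ) : IsDiscreteInfiniteLocallyFinite (modulusLaw μ) := by
  have := h.1.1
  have hinv : ∀ c : ℂ, ‖c‖ = 1 → μ.map (fun u => c * u) = μ := fun _ hc => h.map_mul_eq hsnr.le hc
  obtain ⟨l, -, -, hae⟩ := h.exists_multiplier hsnr
  have hfin := finite_loss_eq_quadratic ha hinv l (outEntropy a μ - l * snr)
  have hm : Measurable fun x : ℂ => ‖x‖ := by fun_prop
  have hunb : ∀ B : ℝ, ¬ ∀ᵐ r ∂modulusLaw μ, r ≤ B := by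
    intro B hB
    exact h.not_ae_bounded hsnr B (ae_of_ae_map hm.aemeasurable hB)
  -- Used only for the measurability of the contact set.
  have hclosed : IsClosed {r : ℝ | loss a μ r = l * r ^ 2 + (outEntropy a μ - l * snr)} := by
    obtain ⟨F, hF, hFl⟩ := exists_entire_loss a μ
    have : Continuous fun r : ℝ => loss a μ r := by
      have e : (fun r : ℝ => loss a μ r) = fun r : ℝ => (F r).re := by
        ext r; rw [hFl, Complex.ofReal_re]
      rw [e]
      exact Complex.continuous_re.comp (hF.continuous.comp Complex.continuous_ofReal)
    exact isClosed_eq this (by fun_prop)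
  refine isDiscreteInfiniteLocallyFinite_of_contact hfin ?_ hunb
  rw [modulusLaw, Measure.map_apply hm hclosed.measurableSet.compl]
  rw [measure_eq_zero_iff_ae_notMem]
  filter_upwards [hae] with x hx
  simp only [Set.mem_preimage, Set.mem_compl_iff, not_not, Set.mem_ofPred_eq]
  rw [loss_norm hinv, hx]
  ring

/-- Achieving the capacity means maximizing the output entropy. -/
lemma isCapacityAchieving_iff_isOptimal (hsnr : 0 < snr) :
    IsCapacityAchieving snr inr μ ↔ IsOptimal (Real.sqrt inr) snr μ := by
  set a := Real.sqrt inr with ha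
  obtain ⟨μ₀, hμ₀, hmax⟩ := exists_isMaxOn_outEntropy a hsnr.le
  have hopt : IsOptimal a snr μ₀ := ⟨hμ₀, hmax⟩
  have hinfo : ∀ ν ∈ admissible snr,
      mutualInfo (jointLaw inr ν) = ENNReal.ofReal (outEntropy a ν - noiseEntropy a) := by
    intro ν hν
    obtain ⟨hp, hi, -⟩ := (mem_admissible_iff hsnr.le).1 hν
    exact mutualInfo_jointLaw inr hi
  have h0 : Measure.dirac (0 : ℂ) ∈ admissible snr := ⟨inferInstance, by simp⟩
  -- `ENNReal.ofReal` truncates at zero, so equality of informations yields equality of entropies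
  -- only if the capacity is positive. Otherwise the point mass at `0` would be optimal, against the
  -- unboundedness of optimal supports.
  have hpos : 0 < outEntropy a μ₀ - noiseEntropy a := by
    by_contra! hle
    have hd : IsOptimal a snr (Measure.dirac 0) := ⟨h0, fun ν hν => by
      rw [outEntropy_dirac]; linarith [hmax ν hν]⟩
    exact hd.not_ae_bounded hsnr 0 (by rw [ae_dirac_eq]; simp)
  have hcap : capacity snr inr = ENNReal.ofReal (outEntropy a μ₀ - noiseEntropy a) := by
    refine le_antisymm (iSup₂_le fun ν hν => ?_) ?_
    · rw [hinfo ν hν]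
      exact ENNReal.ofReal_le_ofReal (by linarith [hmax ν hν])
    · rw [← hinfo μ₀ hμ₀]
      exact le_iSup₂ (f := fun ν (_ : ν ∈ admissible snr) => mutualInfo (jointLaw inr ν)) μ₀ hμ₀
  constructor
  · rintro ⟨hμ, heq⟩
    refine ⟨hμ, fun ν hν => (hmax ν hν).trans ?_⟩
    rw [hinfo μ hμ, hcap] at heq
    have := (ENNReal.ofReal_le_ofReal_iff' (p := outEntropy a μ₀ - noiseEntropy a)
      (q := outEntropy a μ - noiseEntropy a)).1 heq.ge
    rcases this with h | h <;> linarith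
  · intro h
    rw [← hopt.unique hsnr.le h]
    exact ⟨hμ₀, by rw [hinfo μ₀ hμ₀, hcap]⟩

end

end RadarChannel

end

theorem theorem1 (snr inr : ℝ) (hsnr : 0 < snr) (hinr : 0 ≤ inr) :
    (∃! μ : MeasureTheory.Measure ℂ, RadarChannel.IsCapacityAchieving snr inr μ) ∧
    ∀ μ : MeasureTheory.Measure ℂ, RadarChannel.IsCapacityAchieving snr inr μ →
      RadarChannel.HasIndepUniformPhase μ ∧
      (0 < inr →
        RadarChannel.IsDiscreteInfiniteLocallyFinite (RadarChannel.modulusLaw μ)) := by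
  simp_rw [RadarChannel.isCapacityAchieving_iff_isOptimal hsnr]
  obtain ⟨μ, hμ⟩ := RadarChannel.exists_isMaxOn_outEntropy (Real.sqrt inr) hsnr.le
  exact ⟨⟨μ, hμ, fun ν hν => hν.unique hsnr.le hμ⟩, fun ν hν => ⟨hν.hasIndepUniformPhase hsnr.le,
    fun h => hν.isDiscreteInfiniteLocallyFinite (Real.sqrt_pos.2 h) hsnr⟩⟩
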